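/- Let $n,m\ge 1$ be integers. The surface of the $n\times n\times m$ box is divided into $2n^2+4nm$ unit squares. Two of these squares are called diagonally adjacent if they have exactly one point in common; a bishop moves along diagonals, that is, through consecutive diagonally adjacent squares, always leaving a square through the corner opposite to the one through which it entered. (So a diagonal continues across an edge of the box onto the neighbouring face, and it ends at a corner of the box.) Let $B^3_{n,n,m}$ be the graph whose vertices are the unit squares, two different squares being adjacent if a bishop can move from one to the other along a diagonal, and let $\beta_0$ denote the independence number of a graph. Write $m=kn+r$ with $k,r\in\mathbb Z$ and $0\le r<n$. Then $$ \beta_0(B^3_{n,n,kn+r})= \begin{cases} 2n+4 & \text{if } k \text{ is odd, } n \text{ is odd and } r=0,\\ 2n+3-r & \text{if } k \text{ is odd, and at least one of } (n \text{ odd and } r>0),\ (r \text{ odd) holds},\\ 2n-r & \text{if } k \text{ is odd and } n \text{ and } r \text{ are even},\\ n+5 & \text{if } k \text{ is even, } n \text{ is odd and } r=0,\\ n+3+r & \text{if } k \text{ is even, and at least one of } (n \text{ odd and } r>0),\ (r \text{ odd) holds},\\ n+r & \text{if } k \text{ is even and } n \text{ and } r \text{ are even}. \end{cases} $$ -/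

import Mathlib

/-!  Bishops on the surface of a cuboid.

The box `[0, L 0] × [0, L 1] × [0, L 2]` is drawn in `ℤ³` with all coordinates doubled, so that the
lattice points of its surface have even coordinates and the centre of a unit square has one even
coordinate (the one fixed on its face) and two odd ones.  A unit square is identified with its
centre. -/

/-- `c` is the (doubled) centre of a unit square on the surface of the box with sides `L`:
on one of the two faces orthogonal to direction `i`, at an interior odd position in the others. -/
def IsSurfaceSquare (L : Fin 3 → ℕ) (c : Fin 3 → ℤ) : Prop :=
  ∃ i, (c i = 0 ∨ c i = 2 * (L i : ℤ)) ∧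
    ∀ j, j ≠ i → Odd (c j) ∧ 0 < c j ∧ c j < 2 * (L j : ℤ)

/-- The unit squares of the surface of the box with sides `L`. -/
abbrev SurfaceSquare (L : Fin 3 → ℕ) : Type := {c : Fin 3 → ℤ // IsSurfaceSquare L c}

/-- `v` is one of the four corner points of the unit square with centre `c`. -/
def IsCornerOf (v c : Fin 3 → ℤ) : Prop :=
  ∀ j, Even (v j) ∧ |v j - c j| ≤ 1

/-- The squares `c` and `d` are diagonally adjacent at the point `v`: they touch in `v` and
nowhere else.  (At a point of the surface where four squares meet, these are the two pairs of
opposite squares, also when the point lies on an edge of the box and the squares on different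
faces; at a corner of the box any two of the three squares share an edge, so there are none.) -/
def DiagonallyAdjacentAt (c d v : Fin 3 → ℤ) : Prop :=
  ∀ w, (IsCornerOf w c ∧ IsCornerOf w d) ↔ w = v

/-- `a` and `b` lie on a common diagonal: there is a finite run `c 0 = a, c 1, …, c l = b` of
squares of the surface, consecutive ones being diagonally adjacent at `v 0, …, v (l - 1)`, which
goes straight on, that is, each intermediate square is left through the corner opposite to the
one through which it was entered. -/
def OnCommonDiagonal {L : Fin 3 → ℕ} (a b : SurfaceSquare L) : Prop :=
  ∃ (l : ℕ) (c : ℕ → SurfaceSquare L) (v : ℕ → Fin 3 → ℤ),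
    c 0 = a ∧ c l = b ∧
    (∀ i, i < l → DiagonallyAdjacentAt (c i).1 (c (i + 1)).1 (v i)) ∧
    (∀ i, i + 1 < l → v i + v (i + 1) = 2 • (c (i + 1)).1)

theorem DiagonallyAdjacentAt.symm {c d v : Fin 3 → ℤ} (h : DiagonallyAdjacentAt c d v) :
    DiagonallyAdjacentAt d c v := fun w => and_comm.trans (h w)

theorem OnCommonDiagonal.symm {L : Fin 3 → ℕ} {a b : SurfaceSquare L}
    (h : OnCommonDiagonal a b) : OnCommonDiagonal b a := by
  obtain ⟨l, c, v, h0, hl, hadj, hstr⟩ := h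
  refine ⟨l, fun i => c (l - i), fun i => v (l - 1 - i), by simpa using hl, by simpa using h0,
    fun i hi => ?_, fun i hi => ?_⟩
  · have h1 := (hadj (l - 1 - i) (by omega)).symm
    rw [show l - 1 - i + 1 = l - i by omega] at h1
    dsimp only
    rwa [show l - (i + 1) = l - 1 - i by omega]
  · have h1 := hstr (l - 1 - (i + 1)) (by omega)
    rw [show l - 1 - (i + 1) + 1 = l - 1 - i by omega] at h1
    dsimp only
    rw [add_comm, h1, show l - 1 - i = l - (i + 1) by omega]

/-- The graph of bishop moves on the surface of the cuboid with sides `L`: two different squares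
are adjacent if a bishop can move from one to the other along a diagonal. -/
def cuboidBishopGraph (L : Fin 3 → ℕ) : SimpleGraph (SurfaceSquare L) where
  Adj a b := a ≠ b ∧ OnCommonDiagonal a b
  symm := ⟨fun _ _ h => ⟨h.1.symm, h.2.symm⟩⟩
  loopless := ⟨fun _ h => h.1 rfl⟩

/-- The bishop graph `B³_{n,n,m}` on the surface of the `n × n × m` square prism. -/
abbrev prismBishopGraph (n m : ℕ) : SimpleGraph (SurfaceSquare ![n, n, m]) :=
  cuboidBishopGraph ![n, n, m]

/-- The board is finite, so its independence number is a maximum. -/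
instance finite_surfaceSquare (L : Fin 3 → ℕ) : Finite (SurfaceSquare L) := by
  refine ((Set.finite_Icc (0 : Fin 3 → ℤ) (fun j => 2 * (L j : ℤ))).subset ?_).to_subtype
  rintro c ⟨i, hi, hj⟩
  have key : ∀ j, 0 ≤ c j ∧ c j ≤ 2 * (L j : ℤ) := fun j => by
    by_cases h : j = i
    · subst h
      rcases hi with h | h <;> rw [h] <;> omega
    · have := hj j h
      omega
  exact ⟨fun j => (key j).1, fun j => (key j).2⟩

theorem diagonallyAdjacentAt_iff {c d v : Fin 3 → ℤ} :
    DiagonallyAdjacentAt c d v ↔ ∀ j, v j % 2 = 0 ∧ (-1 ≤ v j - c j ∧ v j - c j ≤ 1) ∧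
      (-1 ≤ v j - d j ∧ v j - d j ≤ 1) ∧ (c j = d j → c j % 2 = 0) := by
  constructor
  · intro h j
    have hv := (h v).2 rfl
    have hc := hv.1 j
    have hd := hv.2 j
    rw [abs_le, Int.even_iff] at hc hd
    refine ⟨hc.1, hc.2, hd.2, fun hcd => ?_⟩
    by_contra hodd
    have hw := (h (Function.update v j (2 * c j - v j))).1 ⟨fun i => ?_, fun i => ?_⟩
    · have := congrFun hw j
      rw [Function.update_self] at this
      omega
    all_goals
      by_cases hi : i = j
      · subst hi
        rw [Function.update_self, abs_le, Int.even_iff]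
        omega
      · rw [Function.update_of_ne hi]
        first | exact hv.1 i | exact hv.2 i
  · intro h w
    constructor
    · rintro ⟨hc, hd⟩
      funext j
      have h1 := hc j
      have h2 := hd j
      rw [abs_le, Int.even_iff] at h1 h2
      have := h j
      omega
    · rintro rfl
      refine ⟨fun j => ?_, fun j => ?_⟩ <;>
      · have := h j
        rw [abs_le, Int.even_iff]
        omega

/-- A flag `(c, v)` is a square `c` with a corner `v`; a step passes to the opposite corner of the
same square, or through the corner to the diagonally adjacent square. -/
def FlagStep (L : Fin 3 → ℕ) (x y : (Fin 3 → ℤ) × (Fin 3 → ℤ)) : Prop :=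
  (y.1 = x.1 ∧ y.2 = 2 • x.1 - x.2) ∨
    (y.2 = x.2 ∧ IsSurfaceSquare L x.1 ∧ IsSurfaceSquare L y.1 ∧
      DiagonallyAdjacentAt x.1 y.1 x.2)

/-- Two flags are connected if they belong to the same diagonal. -/
def FlagConn (L : Fin 3 → ℕ) : (Fin 3 → ℤ) × (Fin 3 → ℤ) → (Fin 3 → ℤ) × (Fin 3 → ℤ) → Prop :=
  Relation.ReflTransGen (FlagStep L)

theorem FlagStep.symm {L : Fin 3 → ℕ} {x y : (Fin 3 → ℤ) × (Fin 3 → ℤ)} (h : FlagStep L x y) :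
    FlagStep L y x := by
  rcases h with ⟨h1, h2⟩ | ⟨h1, h2, h3, h4⟩
  · exact Or.inl ⟨h1.symm, by rw [h1, h2]; abel⟩
  · exact Or.inr ⟨h1.symm, h3, h2, by rw [h1]; exact h4.symm⟩

theorem FlagConn.refl {L : Fin 3 → ℕ} (x : (Fin 3 → ℤ) × (Fin 3 → ℤ)) : FlagConn L x x :=
  Relation.ReflTransGen.refl

theorem FlagConn.symm {L : Fin 3 → ℕ} {x y : (Fin 3 → ℤ) × (Fin 3 → ℤ)} (h : FlagConn L x y) :
    FlagConn L y x := by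
  induction h with
  | refl => exact FlagConn.refl x
  | tail _ h ih => exact .head h.symm ih

theorem FlagConn.trans {L : Fin 3 → ℕ} {x y z : (Fin 3 → ℤ) × (Fin 3 → ℤ)}
    (h : FlagConn L x y) (h' : FlagConn L y z) : FlagConn L x z :=
  Relation.ReflTransGen.trans h h'

theorem FlagConn.flip {L : Fin 3 → ℕ} (c v : Fin 3 → ℤ) : FlagConn L (c, v) (c, 2 • c - v) :=
  Relation.ReflTransGen.single (Or.inl ⟨rfl, rfl⟩)

theorem FlagConn.cross {L : Fin 3 → ℕ} {c d v : Fin 3 → ℤ} (hc : IsSurfaceSquare L c)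
    (hd : IsSurfaceSquare L d) (h : DiagonallyAdjacentAt c d v) : FlagConn L (c, v) (d, v) :=
  Relation.ReflTransGen.single (Or.inr ⟨rfl, hc, hd, h⟩)

/-- A bishop can run straight from the square of the first flag, leaving through its corner, to
the square of the second flag, where it is about to leave through the corner. -/
inductive StraightRun (L : Fin 3 → ℕ) :
    (Fin 3 → ℤ) × (Fin 3 → ℤ) → (Fin 3 → ℤ) × (Fin 3 → ℤ) → Prop
  | refl (c v : Fin 3 → ℤ) : IsSurfaceSquare L c → StraightRun L (c, v) (c, v)
  | cons (c d v : Fin 3 → ℤ) (y : (Fin 3 → ℤ) × (Fin 3 → ℤ)) : IsSurfaceSquare L c →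
      DiagonallyAdjacentAt c d v → StraightRun L (d, 2 • d - v) y → StraightRun L (c, v) y

theorem StraightRun.exists_seq {L : Fin 3 → ℕ} {x y : (Fin 3 → ℤ) × (Fin 3 → ℤ)}
    (h : StraightRun L x y) : ∃ (l : ℕ) (c : ℕ → SurfaceSquare L) (v : ℕ → Fin 3 → ℤ),
    (c 0).1 = x.1 ∧ (c l).1 = y.1 ∧ v 0 = x.2 ∧
    (∀ i, i < l → DiagonallyAdjacentAt (c i).1 (c (i + 1)).1 (v i)) ∧
    (∀ i, i + 1 < l → v i + v (i + 1) = 2 • (c (i + 1)).1) := by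
  induction h with
  | refl c v hc => exact ⟨0, fun _ => ⟨c, hc⟩, fun _ => v, rfl, rfl, rfl, by simp, by simp⟩
  | cons c d v y hc hcd _ ih =>
    obtain ⟨l, s, w, h0, hl, hw, hadj, hstr⟩ := ih
    refine ⟨l + 1, fun i => Nat.casesOn i ⟨c, hc⟩ s, fun i => Nat.casesOn i v w, rfl, hl, rfl,
      ?_, ?_⟩
    · rintro (_ | i) hi
      · simpa [h0] using hcd
      · exact hadj i (by omega)
    · rintro (_ | i) hi
      · simp [h0, hw]
      · exact hstr i (by omega)

theorem StraightRun.onCommonDiagonal {L : Fin 3 → ℕ} {a b : SurfaceSquare L} {v w : Fin 3 → ℤ}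
    (h : StraightRun L (a.1, v) (b.1, w)) : OnCommonDiagonal a b := by
  obtain ⟨l, c, v, h0, hl, -, hadj, hstr⟩ := h.exists_seq
  exact ⟨l, c, v, Subtype.ext h0, Subtype.ext hl, hadj, hstr⟩

theorem FlagConn.exists_straightRun {L : Fin 3 → ℕ}
    (huniq : ∀ c d d' v : Fin 3 → ℤ, IsSurfaceSquare L c → IsSurfaceSquare L d →
      IsSurfaceSquare L d' → DiagonallyAdjacentAt c d v → DiagonallyAdjacentAt c d' v → d = d')
    {x y : (Fin 3 → ℤ) × (Fin 3 → ℤ)} (h : FlagConn L x y) (hy : IsSurfaceSquare L y.1) :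
    IsSurfaceSquare L x.1 ∧ ∃ v w, StraightRun L (x.1, v) (y.1, w) ∧
      (v = x.2 ∨ v = 2 • x.1 - x.2) ∧ (w = y.2 ∨ w = 2 • y.1 - y.2) := by
  have key : IsSurfaceSquare L x.1 ∧ ∃ w, (w = y.2 ∨ w = 2 • y.1 - y.2) ∧
      (StraightRun L (x.1, x.2) (y.1, w) ∨ StraightRun L (x.1, 2 • x.1 - x.2) (y.1, w)) := by
    induction h using Relation.ReflTransGen.head_induction_on with
    | refl => exact ⟨hy, y.2, Or.inl rfl, Or.inl (.refl _ _ hy)⟩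
    | @head x z hxz _ ih =>
      obtain ⟨hz, w, hw, hrun⟩ := ih
      obtain ⟨c, v⟩ := x
      obtain ⟨d, u⟩ := z
      rcases hxz with ⟨h1, h2⟩ | ⟨h1, h2, h3, h4⟩
      · dsimp only at h1 h2 hz hrun ⊢
        subst h1 h2
        refine ⟨hz, w, hw, ?_⟩
        rw [sub_sub_cancel] at hrun
        exact hrun.symm
      · dsimp only at h1 h2 h3 h4 hrun ⊢
        subst h1
        refine ⟨h2, ?_⟩
        rcases hrun with hrun | hrun
        · generalize hy' : (y.1, w) = y' at hrun
          generalize hx' : (d, u) = x' at hrun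
          cases hrun with
          | refl e t he =>
            cases hx'
            simp only [Prod.mk.injEq] at hy'
            refine ⟨2 • y.1 - w, ?_, Or.inl ?_⟩
            · rcases hw with rfl | rfl
              · exact Or.inr rfl
              · left; abel
            · rw [hy'.1, hy'.2]
              exact .cons _ _ _ _ h2 h4 (.refl _ _ h3)
          | cons e f t _ he hef hrun =>
            cases hx'
            subst hy'
            have hf : IsSurfaceSquare L f := by
              obtain ⟨l, s, -, h0, -⟩ := hrun.exists_seq
              dsimp only at h0
              rw [← h0]
              exact (s 0).2
            have := huniq d c f u h3 h2 hf h4.symm hef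
            subst this
            exact ⟨w, hw, Or.inr hrun⟩
        · exact ⟨w, hw, Or.inl (.cons _ _ _ _ h2 h4 hrun)⟩
  obtain ⟨hx, w, hw, h | h⟩ := key
  · exact ⟨hx, _, w, h, Or.inl rfl, hw⟩
  · exact ⟨hx, _, w, h, Or.inr rfl, hw⟩

theorem isSurfaceSquare_prism_iff {n m : ℕ} {c : Fin 3 → ℤ} :
    IsSurfaceSquare ![n, n, m] c ↔
      ((c 0 = 0 ∨ c 0 = 2 * n) ∧ (c 1 % 2 = 1 ∧ 0 < c 1 ∧ c 1 < 2 * n) ∧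
        (c 2 % 2 = 1 ∧ 0 < c 2 ∧ c 2 < 2 * m)) ∨
      ((c 1 = 0 ∨ c 1 = 2 * n) ∧ (c 0 % 2 = 1 ∧ 0 < c 0 ∧ c 0 < 2 * n) ∧
        (c 2 % 2 = 1 ∧ 0 < c 2 ∧ c 2 < 2 * m)) ∨
      ((c 2 = 0 ∨ c 2 = 2 * m) ∧ (c 0 % 2 = 1 ∧ 0 < c 0 ∧ c 0 < 2 * n) ∧
        (c 1 % 2 = 1 ∧ 0 < c 1 ∧ c 1 < 2 * n)) := by
  simp [IsSurfaceSquare, Fin.exists_fin_succ, Fin.forall_fin_succ, Int.odd_iff]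

theorem diagonallyAdjacentAt_iff_coord {c d v : Fin 3 → ℤ} :
    DiagonallyAdjacentAt c d v ↔
      (v 0 % 2 = 0 ∧ (-1 ≤ v 0 - c 0 ∧ v 0 - c 0 ≤ 1) ∧
        (-1 ≤ v 0 - d 0 ∧ v 0 - d 0 ≤ 1) ∧ (c 0 = d 0 → c 0 % 2 = 0)) ∧
      (v 1 % 2 = 0 ∧ (-1 ≤ v 1 - c 1 ∧ v 1 - c 1 ≤ 1) ∧
        (-1 ≤ v 1 - d 1 ∧ v 1 - d 1 ≤ 1) ∧ (c 1 = d 1 → c 1 % 2 = 0)) ∧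
      (v 2 % 2 = 0 ∧ (-1 ≤ v 2 - c 2 ∧ v 2 - c 2 ≤ 1) ∧
        (-1 ≤ v 2 - d 2 ∧ v 2 - d 2 ≤ 1) ∧ (c 2 = d 2 → c 2 % 2 = 0)) := by
  simp [diagonallyAdjacentAt_iff, Fin.forall_fin_succ]

theorem eq_of_adjacent_coord {a b b' v l : ℤ} (ha : a % 2 = 1 ∧ 0 < a ∧ a < 2 * l)
    (hb : 0 ≤ b ∧ b ≤ 2 * l ∧ (b % 2 = 0 → b = 0 ∨ b = 2 * l))
    (hb' : 0 ≤ b' ∧ b' ≤ 2 * l ∧ (b' % 2 = 0 → b' = 0 ∨ b' = 2 * l))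
    (h : v % 2 = 0 ∧ (-1 ≤ v - a ∧ v - a ≤ 1) ∧ (-1 ≤ v - b ∧ v - b ≤ 1) ∧ (a = b → a % 2 = 0))
    (h' : v % 2 = 0 ∧ (-1 ≤ v - a ∧ v - a ≤ 1) ∧ (-1 ≤ v - b' ∧ v - b' ≤ 1) ∧
      (a = b' → a % 2 = 0)) : b = b' := by
  by_cases e : b % 2 = 0 <;> by_cases e' : b' % 2 = 0 <;> omega

theorem IsSurfaceSquare.coord {n m : ℕ} {c : Fin 3 → ℤ} (hc : IsSurfaceSquare ![n, n, m] c) :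
    (0 ≤ c 0 ∧ c 0 ≤ 2 * n ∧ (c 0 % 2 = 0 → c 0 = 0 ∨ c 0 = 2 * n)) ∧
    (0 ≤ c 1 ∧ c 1 ≤ 2 * n ∧ (c 1 % 2 = 0 → c 1 = 0 ∨ c 1 = 2 * n)) ∧
    (0 ≤ c 2 ∧ c 2 ≤ 2 * m ∧ (c 2 % 2 = 0 → c 2 = 0 ∨ c 2 = 2 * m)) ∧
    c 0 % 2 + c 1 % 2 + c 2 % 2 = 2 := by
  rw [isSurfaceSquare_prism_iff] at hc
  rcases hc with ⟨hc, hcc, hccc⟩ | ⟨hc, hcc, hccc⟩ | ⟨hc, hcc, hccc⟩ <;>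
  exact ⟨by omega, by omega, by omega, by omega⟩

theorem DiagonallyAdjacentAt.unique {n m : ℕ} {c d d' v : Fin 3 → ℤ}
    (hc : IsSurfaceSquare ![n, n, m] c) (hd : IsSurfaceSquare ![n, n, m] d)
    (hd' : IsSurfaceSquare ![n, n, m] d') (h : DiagonallyAdjacentAt c d v)
    (h' : DiagonallyAdjacentAt c d' v) : d = d' := by
  rw [isSurfaceSquare_prism_iff] at hc
  rw [diagonallyAdjacentAt_iff_coord] at h h'
  obtain ⟨hd0, hd1, hd2, hd⟩ := hd.coord
  obtain ⟨he0, he1, he2, he⟩ := hd'.coord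
  obtain ⟨h0, h1, h2⟩ := h
  obtain ⟨k0, k1, k2⟩ := h'
  suffices d 0 = d' 0 ∧ d 1 = d' 1 ∧ d 2 = d' 2 by
    funext i
    fin_cases i
    exacts [this.1, this.2.1, this.2.2]
  rcases hc with ⟨f, g, g'⟩ | ⟨f, g, g'⟩ | ⟨f, g, g'⟩
  · have e1 := eq_of_adjacent_coord g hd1 he1 h1 k1
    have e2 := eq_of_adjacent_coord g' hd2 he2 h2 k2
    exact ⟨by omega, e1, e2⟩
  · have e1 := eq_of_adjacent_coord g hd0 he0 h0 k0
    have e2 := eq_of_adjacent_coord g' hd2 he2 h2 k2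
    exact ⟨e1, by omega, e2⟩
  · have e1 := eq_of_adjacent_coord g hd0 he0 h0 k0
    have e2 := eq_of_adjacent_coord g' hd1 he1 h1 k1
    exact ⟨e1, e2, by omega⟩

theorem FlagConn.onCommonDiagonal {n m : ℕ} {a b : SurfaceSquare ![n, n, m]} {v w : Fin 3 → ℤ}
    (h : FlagConn ![n, n, m] (a.1, v) (b.1, w)) : OnCommonDiagonal a b := by
  obtain ⟨-, _, _, hrun, -⟩ := h.exists_straightRun
    (fun _ _ _ _ hc hd hd' h h' => h.unique hc hd hd' h') b.2
  exact hrun.onCommonDiagonal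

/-- The parameters of the `n × n × m` prism with `m = k * n + r`. -/
structure PrismParams (n m k r : ℤ) : Prop where
  n_pos : 0 < n
  m_pos : 0 < m
  eq : m = k * n + r
  r_nonneg : 0 ≤ r
  r_lt : r < n

/-- The number of different diagonals that go up through the top edges at distance `x` from the
preceding corners. -/
def posModulus (k r x : ℤ) : ℤ :=
  if x = 0 ∨ x = r ∨ (x < r ∧ k % 2 = 0) ∨ (r < x ∧ k % 2 = 1) then 4 else 2

/-- The label of the diagonal that goes up to the top edge at position `u` of its perimeter. -/
def posLabel (n k r u : ℤ) : ℤ × ℤ := (u % n, u / n % posModulus k r (u % n))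

/-- The label of the diagonal that goes down from the top edge at position `y`. -/
def downLabel (n k r y : ℤ) : ℤ × ℤ :=
  if y % n = 0 then
    if r = 0 then (-2, y / n % 4) else posLabel n k r (y + (2 * k + 2) * n)
  else posLabel n k r (2 * n * (y / n) - y)

def beltLabel (n m k r u h : ℤ) (up : Prop) [Decidable up] : ℤ × ℤ :=
  if up then posLabel n k r ((u + 2 * m - h) / 2) else downLabel n k r ((u - 2 * m + h) / 2)

def topLabel (n k r a b : ℤ) (diag : Prop) [Decidable diag] : ℤ × ℤ :=
  if diag then
    if a = b then (-1, 0)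
    else if b < a then posLabel n k r ((a - b) / 2) else posLabel n k r (2 * n + (b - a) / 2)
  else
    if a + b = 2 * n then (-1, 1)
    else if a + b < 2 * n then posLabel n k r (4 * n - (a + b) / 2)
    else posLabel n k r ((a + b) / 2)

def bottomLabel (n m k r a b : ℤ) (diag : Prop) [Decidable diag] : ℤ × ℤ :=
  if diag then
    if a = b then (-1, 2)
    else if b < a then posLabel n k r (m + 2 * n - (a - b) / 2)
    else posLabel n k r (m + 4 * n - (b - a) / 2)
  else
    if a + b = 2 * n then (-1, 3)
    else if a + b < 2 * n then posLabel n k r (m + (a + b) / 2)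
    else posLabel n k r (m + 4 * n - (a + b) / 2)

/-- The label of the diagonal through the square `(a, b, h)` and its corner `(x, y, z)`. -/
def flagLabel (n m k r a b h x y z : ℤ) : ℤ × ℤ :=
  if h = 2 * m then topLabel n k r a b (x - a = y - b)
  else if h = 0 then bottomLabel n m k r a b (x - a = y - b)
  else if b = 0 then beltLabel n m k r a h (x - a = z - h)
  else if a = 2 * n then beltLabel n m k r (2 * n + b) h (y - b = z - h)
  else if b = 2 * n then beltLabel n m k r (6 * n - a) h (¬ x - a = z - h)
  else beltLabel n m k r (8 * n - b) h (¬ y - b = z - h)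

theorem posLabel_mul_add {n k r q x : ℤ} (h0 : 0 ≤ x) (h1 : x < n) :
    posLabel n k r (q * n + x) = (x, q % posModulus k r x) := by
  have hx : (q * n + x) % n = x := by
    rw [add_comm, Int.add_mul_emod_self_right, Int.emod_eq_of_lt h0 h1]
  have hq : (q * n + x) / n = q := by
    rw [add_comm, Int.add_mul_ediv_right _ _ (by omega), Int.ediv_eq_zero_of_lt h0 h1, zero_add]
  rw [posLabel, hx, hq]

theorem posModulus_cases (k r x : ℤ) : posModulus k r x = 4 ∨ posModulus k r x = 2 := by
  unfold posModulus
  split_ifs <;> simp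

theorem posLabel_add_four {n : ℤ} (hn : 0 < n) (k r u : ℤ) :
    posLabel n k r (u + 4 * n) = posLabel n k r u := by
  rw [posLabel, posLabel, Int.add_mul_emod_self_right, Int.add_mul_ediv_right _ _ hn.ne']
  congr 1
  rcases posModulus_cases k r (u % n) with h | h <;> rw [h] <;> omega

theorem posLabel_congr {n k r u v : ℤ} (hn : 0 < n)
    (h : u = v ∨ u = v + 4 * n ∨ u = v - 4 * n) : posLabel n k r u = posLabel n k r v := by
  rcases h with rfl | rfl | rfl
  · rfl
  · exact posLabel_add_four hn k r v
  · rw [← posLabel_add_four hn k r (v - 4 * n), sub_add_cancel]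

theorem posLabel_add_mul {n : ℤ} (hn : 0 < n) (k r u i : ℤ) :
    posLabel n k r (u + i * (4 * n)) = posLabel n k r u := by
  induction i using Int.induction_on with
  | zero => simp
  | succ i ih => rw [← ih]; exact posLabel_congr hn (Or.inr (Or.inl (by ring)))
  | pred i ih => rw [← ih]; exact posLabel_congr hn (Or.inr (Or.inr (by ring)))

theorem downLabel_of_lt {n k r j y z : ℤ} (h0 : j * n < y) (h1 : y < (j + 1) * n)
    (hz : z = 2 * j * n - y) : downLabel n k r y = posLabel n k r z := by
  have hn : 0 < n := by linarith
  have hq : y / n = j := by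
    apply le_antisymm
    · exact Int.lt_add_one_iff.1 (Int.ediv_lt_of_lt_mul hn h1)
    · exact Int.le_ediv_of_mul_le hn h0.le
  have hy : y % n ≠ 0 := by
    intro h
    have := Int.emod_add_mul_ediv y n
    rw [hq, h] at this
    linarith [mul_comm n j]
  rw [downLabel, if_neg hy, hq, hz]
  congr 1
  ring

theorem downLabel_mul {n k r : ℤ} (hn : 0 < n) (j : ℤ) : downLabel n k r (j * n) =
    if r = 0 then (-2, j % 4) else posLabel n k r ((j + 2 * k + 2) * n) := by
  rw [downLabel, if_pos (Int.mul_emod_left _ _), Int.mul_ediv_cancel _ hn.ne']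
  split_ifs
  · rfl
  · congr 1
    ring

theorem downLabel_add_four {n : ℤ} (hn : 0 < n) (k r u : ℤ) :
    downLabel n k r (u + 4 * n) = downLabel n k r u := by
  rw [downLabel, downLabel, Int.add_mul_emod_self_right, Int.add_mul_ediv_right _ _ hn.ne']
  split_ifs
  · congr 1
    omega
  · exact posLabel_congr hn (Or.inr (Or.inl (by ring)))
  · exact posLabel_congr hn (Or.inr (Or.inl (by ring)))

theorem downLabel_congr {n k r u v : ℤ} (hn : 0 < n)
    (h : u = v ∨ u = v + 4 * n ∨ u = v - 4 * n) : downLabel n k r u = downLabel n k r v := by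
  rcases h with rfl | rfl | rfl
  · rfl
  · exact downLabel_add_four hn k r v
  · rw [← downLabel_add_four hn k r (v - 4 * n), sub_add_cancel]

theorem posLabel_two_apart {n k r x q q' : ℤ} (h0 : 0 ≤ x) (h1 : x < n)
    (h : q % 4 = q' % 4 ∨ (q % 2 = q' % 2 ∧ posModulus k r x = 2)) {u v : ℤ}
    (hu : u = q * n + x) (hv : v = q' * n + x) : posLabel n k r u = posLabel n k r v := by
  rw [hu, hv, posLabel_mul_add h0 h1, posLabel_mul_add h0 h1]
  congr 1
  rcases posModulus_cases k r x with h' | h' <;> rw [h'] <;> omega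

/-- Labels are preserved by crossing the bottom face. -/
theorem PrismParams.downLabel_bottom {n m k r : ℤ} (P : PrismParams n m k r) {j w y z : ℤ}
    (h0 : j * n < w) (h1 : w < (j + 1) * n) (hy : y = w - m) (hz : z = (2 * j + 2) * n - w + m) :
    downLabel n k r y = posLabel n k r z := by
  obtain ⟨hn, hm, he, hr0, hrn⟩ := P
  obtain ⟨x, rfl⟩ : ∃ x, w = j * n + x := ⟨w - j * n, by ring⟩
  have hx0 : 0 < x := by linarith
  have hx1 : x < n := by linarith
  subst hy hz he
  rcases lt_trichotomy x r with h | rfl | h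
  · rw [downLabel_of_lt (j := j - k - 1) (z := (j - k - 2) * n + (r - x)) (by linarith)
      (by linarith) (by ring)]
    refine posLabel_two_apart (x := r - x) (q := j - k - 2) (q' := j + 2 + k) (by omega)
      (by omega) ?_ (by ring) (by ring)
    unfold posModulus
    by_cases hk : k % 2 = 0
    · left; omega
    · right; rw [if_neg (by omega)]; omega
  · rw [show j * n + x - (k * n + x) = (j - k) * n by ring, downLabel_mul hn, if_neg (by omega)]
    congr 1
    ring
  · rw [downLabel_of_lt (j := j - k) (z := (j - k - 1) * n + (n + r - x)) (by linarith)
      (by linarith) (by ring)]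
    refine posLabel_two_apart (x := n + r - x) (q := j - k - 1) (q' := j + 1 + k) (by omega)
      (by omega) ?_ (by ring) (by ring)
    unfold posModulus
    by_cases hk : k % 2 = 0
    · right; rw [if_neg (by omega)]; omega
    · left; omega

section FlagLabelFaces

variable {n m k r a b h x y z : ℤ}

theorem flagLabel_top (hh : h = 2 * m) :
    flagLabel n m k r a b h x y z = topLabel n k r a b (x - a = y - b) := by
  rw [flagLabel, if_pos hh]

theorem flagLabel_bottom (hm : 0 < m) (hh : h = 0) :
    flagLabel n m k r a b h x y z = bottomLabel n m k r a b (x - a = y - b) := by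
  rw [flagLabel, if_neg (by omega), if_pos hh]

theorem flagLabel_front (hh : 0 < h ∧ h < 2 * m) (hb : b = 0) :
    flagLabel n m k r a b h x y z = beltLabel n m k r a h (x - a = z - h) := by
  rw [flagLabel, if_neg (by omega), if_neg (by omega), if_pos hb]

theorem flagLabel_right (hh : 0 < h ∧ h < 2 * m) (ha : a = 2 * n) (hb : 0 < b) :
    flagLabel n m k r a b h x y z = beltLabel n m k r (2 * n + b) h (y - b = z - h) := by
  rw [flagLabel, if_neg (by omega), if_neg (by omega), if_neg (by omega), if_pos ha]

theorem flagLabel_back (hh : 0 < h ∧ h < 2 * m) (hb : b = 2 * n) (ha : 0 < a ∧ a < 2 * n) :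
    flagLabel n m k r a b h x y z = beltLabel n m k r (6 * n - a) h (¬ x - a = z - h) := by
  rw [flagLabel, if_neg (by omega), if_neg (by omega), if_neg (by omega), if_neg (by omega),
    if_pos hb]

theorem flagLabel_left (hh : 0 < h ∧ h < 2 * m) (ha : a = 0) (hb : 0 < b ∧ b < 2 * n) :
    flagLabel n m k r a b h x y z = beltLabel n m k r (8 * n - b) h (¬ y - b = z - h) := by
  rw [flagLabel, if_neg (by omega), if_neg (by omega), if_neg (by omega), if_neg (by omega),
    if_neg (by omega)]

end FlagLabelFaces

theorem beltLabel_congr {n m k r u h u' h' : ℤ} (hn : 0 < n) {p q : Prop} [Decidable p]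
    [Decidable q] (hpq : p ↔ q)
    (hp : p → (u + 2 * m - h) / 2 = (u' + 2 * m - h') / 2 ∨
      (u + 2 * m - h) / 2 = (u' + 2 * m - h') / 2 + 4 * n ∨
      (u + 2 * m - h) / 2 = (u' + 2 * m - h') / 2 - 4 * n)
    (hq : ¬ p → (u - 2 * m + h) / 2 = (u' - 2 * m + h') / 2 ∨
      (u - 2 * m + h) / 2 = (u' - 2 * m + h') / 2 + 4 * n ∨
      (u - 2 * m + h) / 2 = (u' - 2 * m + h') / 2 - 4 * n) :
    beltLabel n m k r u h p = beltLabel n m k r u' h' q := by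
  by_cases h : p
  · rw [beltLabel, beltLabel, if_pos h, if_pos (hpq.1 h)]
    exact posLabel_congr hn (hp h)
  · rw [beltLabel, beltLabel, if_neg h, if_neg (fun hq => h (hpq.2 hq))]
    exact downLabel_congr hn (hq h)

theorem topLabel_eq_beltLabel {n m k r a b u h w j : ℤ} {p q : Prop} [Decidable p] [Decidable q] (h0 : j * n < w)
    (h1 : w < (j + 1) * n)
    (hup : q → (u + 2 * m - h) / 2 = w ∧ topLabel n k r a b p = posLabel n k r w)
    (hdown : ¬ q → (u - 2 * m + h) / 2 = w ∧
      topLabel n k r a b p = posLabel n k r (2 * j * n - w)) :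
    topLabel n k r a b p = beltLabel n m k r u h q := by
  by_cases hq : q
  · rw [beltLabel, if_pos hq, (hup hq).2, (hup hq).1]
  · rw [beltLabel, if_neg hq, (hdown hq).2, (hdown hq).1, downLabel_of_lt h0 h1 rfl]

theorem PrismParams.bottomLabel_eq_beltLabel {n m k r : ℤ} (P : PrismParams n m k r)
    {a b u h w j : ℤ} {p q : Prop} [Decidable p] [Decidable q] (h0 : j * n < w)
    (h1 : w < (j + 1) * n)
    (hup : q → (u + 2 * m - h) / 2 = w + m ∧
      bottomLabel n m k r a b p = posLabel n k r (w + m))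
    (hdown : ¬ q → (u - 2 * m + h) / 2 = w - m ∧
      bottomLabel n m k r a b p = posLabel n k r ((2 * j + 2) * n - w + m)) :
    bottomLabel n m k r a b p = beltLabel n m k r u h q := by
  by_cases hq : q
  · rw [beltLabel, if_pos hq, (hup hq).2, (hup hq).1]
  · rw [beltLabel, if_neg hq, (hdown hq).2, (hdown hq).1, P.downLabel_bottom h0 h1 rfl rfl]

section FlagLabelCross

variable {n m k r a b h a' b' h' x y z : ℤ}

theorem PrismParams.flagLabel_top_top (P : PrismParams n m k r)
    (fh : h = 2 * m) (ga : a % 2 = 1 ∧ 0 < a ∧ a < 2 * n)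
    (gb : b % 2 = 1 ∧ 0 < b ∧ b < 2 * n)
    (fh' : h' = 2 * m) (ga' : a' % 2 = 1 ∧ 0 < a' ∧ a' < 2 * n)
    (gb' : b' % 2 = 1 ∧ 0 < b' ∧ b' < 2 * n)
    (hx : x % 2 = 0 ∧ (-1 ≤ x - a ∧ x - a ≤ 1) ∧ (-1 ≤ x - a' ∧ x - a' ≤ 1) ∧
      (a = a' → a % 2 = 0))
    (hy : y % 2 = 0 ∧ (-1 ≤ y - b ∧ y - b ≤ 1) ∧ (-1 ≤ y - b' ∧ y - b' ≤ 1) ∧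
      (b = b' → b % 2 = 0))
    (hz : z % 2 = 0 ∧ (-1 ≤ z - h ∧ z - h ≤ 1) ∧ (-1 ≤ z - h' ∧ z - h' ≤ 1) ∧
      (h = h' → h % 2 = 0)) :
    flagLabel n m k r a b h x y z = flagLabel n m k r a' b' h' x y z := by
  have hn := P.n_pos
  have hm := P.m_pos
  rw [flagLabel_top fh, flagLabel_top fh']
  simp only [topLabel]
  split_ifs <;> first
    | rfl
    | (exfalso; omega)
    | exact posLabel_congr hn (by omega)

theorem PrismParams.flagLabel_bottom_bottom (P : PrismParams n m k r)
    (fh : h = 0) (ga : a % 2 = 1 ∧ 0 < a ∧ a < 2 * n)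
    (gb : b % 2 = 1 ∧ 0 < b ∧ b < 2 * n)
    (fh' : h' = 0) (ga' : a' % 2 = 1 ∧ 0 < a' ∧ a' < 2 * n)
    (gb' : b' % 2 = 1 ∧ 0 < b' ∧ b' < 2 * n)
    (hx : x % 2 = 0 ∧ (-1 ≤ x - a ∧ x - a ≤ 1) ∧ (-1 ≤ x - a' ∧ x - a' ≤ 1) ∧
      (a = a' → a % 2 = 0))
    (hy : y % 2 = 0 ∧ (-1 ≤ y - b ∧ y - b ≤ 1) ∧ (-1 ≤ y - b' ∧ y - b' ≤ 1) ∧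
      (b = b' → b % 2 = 0))
    (hz : z % 2 = 0 ∧ (-1 ≤ z - h ∧ z - h ≤ 1) ∧ (-1 ≤ z - h' ∧ z - h' ≤ 1) ∧
      (h = h' → h % 2 = 0)) :
    flagLabel n m k r a b h x y z = flagLabel n m k r a' b' h' x y z := by
  have hn := P.n_pos
  have hm := P.m_pos
  rw [flagLabel_bottom P.m_pos fh, flagLabel_bottom P.m_pos fh']
  simp only [bottomLabel]
  split_ifs <;> first
    | rfl
    | (exfalso; omega)
    | exact posLabel_congr hn (by omega)

theorem PrismParams.flagLabel_front_front (P : PrismParams n m k r)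
    (fb : b = 0) (ga : a % 2 = 1 ∧ 0 < a ∧ a < 2 * n)
    (gh : h % 2 = 1 ∧ 0 < h ∧ h < 2 * m)
    (fb' : b' = 0) (ga' : a' % 2 = 1 ∧ 0 < a' ∧ a' < 2 * n)
    (gh' : h' % 2 = 1 ∧ 0 < h' ∧ h' < 2 * m)
    (hx : x % 2 = 0 ∧ (-1 ≤ x - a ∧ x - a ≤ 1) ∧ (-1 ≤ x - a' ∧ x - a' ≤ 1) ∧
      (a = a' → a % 2 = 0))
    (hy : y % 2 = 0 ∧ (-1 ≤ y - b ∧ y - b ≤ 1) ∧ (-1 ≤ y - b' ∧ y - b' ≤ 1) ∧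
      (b = b' → b % 2 = 0))
    (hz : z % 2 = 0 ∧ (-1 ≤ z - h ∧ z - h ≤ 1) ∧ (-1 ≤ z - h' ∧ z - h' ≤ 1) ∧
      (h = h' → h % 2 = 0)) :
    flagLabel n m k r a b h x y z = flagLabel n m k r a' b' h' x y z := by
  have hn := P.n_pos
  have hm := P.m_pos
  rw [flagLabel_front gh.2 fb, flagLabel_front gh'.2 fb']
  exact beltLabel_congr hn (by omega) (by omega) (by omega)

theorem PrismParams.flagLabel_front_right (P : PrismParams n m k r)
    (fb : b = 0) (ga : a % 2 = 1 ∧ 0 < a ∧ a < 2 * n)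
    (gh : h % 2 = 1 ∧ 0 < h ∧ h < 2 * m)
    (fa' : a' = 2 * n) (gb' : b' % 2 = 1 ∧ 0 < b' ∧ b' < 2 * n)
    (gh' : h' % 2 = 1 ∧ 0 < h' ∧ h' < 2 * m)
    (hx : x % 2 = 0 ∧ (-1 ≤ x - a ∧ x - a ≤ 1) ∧ (-1 ≤ x - a' ∧ x - a' ≤ 1) ∧
      (a = a' → a % 2 = 0))
    (hy : y % 2 = 0 ∧ (-1 ≤ y - b ∧ y - b ≤ 1) ∧ (-1 ≤ y - b' ∧ y - b' ≤ 1) ∧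
      (b = b' → b % 2 = 0))
    (hz : z % 2 = 0 ∧ (-1 ≤ z - h ∧ z - h ≤ 1) ∧ (-1 ≤ z - h' ∧ z - h' ≤ 1) ∧
      (h = h' → h % 2 = 0)) :
    flagLabel n m k r a b h x y z = flagLabel n m k r a' b' h' x y z := by
  have hn := P.n_pos
  have hm := P.m_pos
  rw [flagLabel_front gh.2 fb, flagLabel_right gh'.2 fa' gb'.2.1]
  exact beltLabel_congr hn (by omega) (by omega) (by omega)

theorem PrismParams.flagLabel_right_right (P : PrismParams n m k r)
    (fa : a = 2 * n) (gb : b % 2 = 1 ∧ 0 < b ∧ b < 2 * n)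
    (gh : h % 2 = 1 ∧ 0 < h ∧ h < 2 * m)
    (fa' : a' = 2 * n) (gb' : b' % 2 = 1 ∧ 0 < b' ∧ b' < 2 * n)
    (gh' : h' % 2 = 1 ∧ 0 < h' ∧ h' < 2 * m)
    (hx : x % 2 = 0 ∧ (-1 ≤ x - a ∧ x - a ≤ 1) ∧ (-1 ≤ x - a' ∧ x - a' ≤ 1) ∧
      (a = a' → a % 2 = 0))
    (hy : y % 2 = 0 ∧ (-1 ≤ y - b ∧ y - b ≤ 1) ∧ (-1 ≤ y - b' ∧ y - b' ≤ 1) ∧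
      (b = b' → b % 2 = 0))
    (hz : z % 2 = 0 ∧ (-1 ≤ z - h ∧ z - h ≤ 1) ∧ (-1 ≤ z - h' ∧ z - h' ≤ 1) ∧
      (h = h' → h % 2 = 0)) :
    flagLabel n m k r a b h x y z = flagLabel n m k r a' b' h' x y z := by
  have hn := P.n_pos
  have hm := P.m_pos
  rw [flagLabel_right gh.2 fa gb.2.1, flagLabel_right gh'.2 fa' gb'.2.1]
  exact beltLabel_congr hn (by omega) (by omega) (by omega)

theorem PrismParams.flagLabel_right_back (P : PrismParams n m k r)
    (fa : a = 2 * n) (gb : b % 2 = 1 ∧ 0 < b ∧ b < 2 * n)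
    (gh : h % 2 = 1 ∧ 0 < h ∧ h < 2 * m)
    (fb' : b' = 2 * n) (ga' : a' % 2 = 1 ∧ 0 < a' ∧ a' < 2 * n)
    (gh' : h' % 2 = 1 ∧ 0 < h' ∧ h' < 2 * m)
    (hx : x % 2 = 0 ∧ (-1 ≤ x - a ∧ x - a ≤ 1) ∧ (-1 ≤ x - a' ∧ x - a' ≤ 1) ∧
      (a = a' → a % 2 = 0))
    (hy : y % 2 = 0 ∧ (-1 ≤ y - b ∧ y - b ≤ 1) ∧ (-1 ≤ y - b' ∧ y - b' ≤ 1) ∧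
      (b = b' → b % 2 = 0))
    (hz : z % 2 = 0 ∧ (-1 ≤ z - h ∧ z - h ≤ 1) ∧ (-1 ≤ z - h' ∧ z - h' ≤ 1) ∧
      (h = h' → h % 2 = 0)) :
    flagLabel n m k r a b h x y z = flagLabel n m k r a' b' h' x y z := by
  have hn := P.n_pos
  have hm := P.m_pos
  rw [flagLabel_right gh.2 fa gb.2.1, flagLabel_back gh'.2 fb' ga'.2]
  exact beltLabel_congr hn (by omega) (by omega) (by omega)

theorem PrismParams.flagLabel_back_back (P : PrismParams n m k r)
    (fb : b = 2 * n) (ga : a % 2 = 1 ∧ 0 < a ∧ a < 2 * n)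
    (gh : h % 2 = 1 ∧ 0 < h ∧ h < 2 * m)
    (fb' : b' = 2 * n) (ga' : a' % 2 = 1 ∧ 0 < a' ∧ a' < 2 * n)
    (gh' : h' % 2 = 1 ∧ 0 < h' ∧ h' < 2 * m)
    (hx : x % 2 = 0 ∧ (-1 ≤ x - a ∧ x - a ≤ 1) ∧ (-1 ≤ x - a' ∧ x - a' ≤ 1) ∧
      (a = a' → a % 2 = 0))
    (hy : y % 2 = 0 ∧ (-1 ≤ y - b ∧ y - b ≤ 1) ∧ (-1 ≤ y - b' ∧ y - b' ≤ 1) ∧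
      (b = b' → b % 2 = 0))
    (hz : z % 2 = 0 ∧ (-1 ≤ z - h ∧ z - h ≤ 1) ∧ (-1 ≤ z - h' ∧ z - h' ≤ 1) ∧
      (h = h' → h % 2 = 0)) :
    flagLabel n m k r a b h x y z = flagLabel n m k r a' b' h' x y z := by
  have hn := P.n_pos
  have hm := P.m_pos
  rw [flagLabel_back gh.2 fb ga.2, flagLabel_back gh'.2 fb' ga'.2]
  exact beltLabel_congr hn (by omega) (by omega) (by omega)

theorem PrismParams.flagLabel_back_left (P : PrismParams n m k r)
    (fb : b = 2 * n) (ga : a % 2 = 1 ∧ 0 < a ∧ a < 2 * n)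
    (gh : h % 2 = 1 ∧ 0 < h ∧ h < 2 * m)
    (fa' : a' = 0) (gb' : b' % 2 = 1 ∧ 0 < b' ∧ b' < 2 * n)
    (gh' : h' % 2 = 1 ∧ 0 < h' ∧ h' < 2 * m)
    (hx : x % 2 = 0 ∧ (-1 ≤ x - a ∧ x - a ≤ 1) ∧ (-1 ≤ x - a' ∧ x - a' ≤ 1) ∧
      (a = a' → a % 2 = 0))
    (hy : y % 2 = 0 ∧ (-1 ≤ y - b ∧ y - b ≤ 1) ∧ (-1 ≤ y - b' ∧ y - b' ≤ 1) ∧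
      (b = b' → b % 2 = 0))
    (hz : z % 2 = 0 ∧ (-1 ≤ z - h ∧ z - h ≤ 1) ∧ (-1 ≤ z - h' ∧ z - h' ≤ 1) ∧
      (h = h' → h % 2 = 0)) :
    flagLabel n m k r a b h x y z = flagLabel n m k r a' b' h' x y z := by
  have hn := P.n_pos
  have hm := P.m_pos
  rw [flagLabel_back gh.2 fb ga.2, flagLabel_left gh'.2 fa' gb'.2]
  exact beltLabel_congr hn (by omega) (by omega) (by omega)

theorem PrismParams.flagLabel_left_left (P : PrismParams n m k r)
    (fa : a = 0) (gb : b % 2 = 1 ∧ 0 < b ∧ b < 2 * n)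
    (gh : h % 2 = 1 ∧ 0 < h ∧ h < 2 * m)
    (fa' : a' = 0) (gb' : b' % 2 = 1 ∧ 0 < b' ∧ b' < 2 * n)
    (gh' : h' % 2 = 1 ∧ 0 < h' ∧ h' < 2 * m)
    (hx : x % 2 = 0 ∧ (-1 ≤ x - a ∧ x - a ≤ 1) ∧ (-1 ≤ x - a' ∧ x - a' ≤ 1) ∧
      (a = a' → a % 2 = 0))
    (hy : y % 2 = 0 ∧ (-1 ≤ y - b ∧ y - b ≤ 1) ∧ (-1 ≤ y - b' ∧ y - b' ≤ 1) ∧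
      (b = b' → b % 2 = 0))
    (hz : z % 2 = 0 ∧ (-1 ≤ z - h ∧ z - h ≤ 1) ∧ (-1 ≤ z - h' ∧ z - h' ≤ 1) ∧
      (h = h' → h % 2 = 0)) :
    flagLabel n m k r a b h x y z = flagLabel n m k r a' b' h' x y z := by
  have hn := P.n_pos
  have hm := P.m_pos
  rw [flagLabel_left gh.2 fa gb.2, flagLabel_left gh'.2 fa' gb'.2]
  exact beltLabel_congr hn (by omega) (by omega) (by omega)

theorem PrismParams.flagLabel_left_front (P : PrismParams n m k r)
    (fa : a = 0) (gb : b % 2 = 1 ∧ 0 < b ∧ b < 2 * n)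
    (gh : h % 2 = 1 ∧ 0 < h ∧ h < 2 * m)
    (fb' : b' = 0) (ga' : a' % 2 = 1 ∧ 0 < a' ∧ a' < 2 * n)
    (gh' : h' % 2 = 1 ∧ 0 < h' ∧ h' < 2 * m)
    (hx : x % 2 = 0 ∧ (-1 ≤ x - a ∧ x - a ≤ 1) ∧ (-1 ≤ x - a' ∧ x - a' ≤ 1) ∧
      (a = a' → a % 2 = 0))
    (hy : y % 2 = 0 ∧ (-1 ≤ y - b ∧ y - b ≤ 1) ∧ (-1 ≤ y - b' ∧ y - b' ≤ 1) ∧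
      (b = b' → b % 2 = 0))
    (hz : z % 2 = 0 ∧ (-1 ≤ z - h ∧ z - h ≤ 1) ∧ (-1 ≤ z - h' ∧ z - h' ≤ 1) ∧
      (h = h' → h % 2 = 0)) :
    flagLabel n m k r a b h x y z = flagLabel n m k r a' b' h' x y z := by
  have hn := P.n_pos
  have hm := P.m_pos
  rw [flagLabel_left gh.2 fa gb.2, flagLabel_front gh'.2 fb']
  exact beltLabel_congr hn (by omega) (by omega) (by omega)

theorem PrismParams.flagLabel_top_front (P : PrismParams n m k r)
    (fh : h = 2 * m) (ga : a % 2 = 1 ∧ 0 < a ∧ a < 2 * n)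
    (gb : b % 2 = 1 ∧ 0 < b ∧ b < 2 * n)
    (fb' : b' = 0) (ga' : a' % 2 = 1 ∧ 0 < a' ∧ a' < 2 * n)
    (gh' : h' % 2 = 1 ∧ 0 < h' ∧ h' < 2 * m)
    (hx : x % 2 = 0 ∧ (-1 ≤ x - a ∧ x - a ≤ 1) ∧ (-1 ≤ x - a' ∧ x - a' ≤ 1) ∧
      (a = a' → a % 2 = 0))
    (hy : y % 2 = 0 ∧ (-1 ≤ y - b ∧ y - b ≤ 1) ∧ (-1 ≤ y - b' ∧ y - b' ≤ 1) ∧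
      (b = b' → b % 2 = 0))
    (hz : z % 2 = 0 ∧ (-1 ≤ z - h ∧ z - h ≤ 1) ∧ (-1 ≤ z - h' ∧ z - h' ≤ 1) ∧
      (h = h' → h % 2 = 0)) :
    flagLabel n m k r a b h x y z = flagLabel n m k r a' b' h' x y z := by
  have hn := P.n_pos
  have hm := P.m_pos
  rw [flagLabel_top fh, flagLabel_front gh'.2 fb']
  refine topLabel_eq_beltLabel (w := x / 2) (j := 0) (by omega) (by omega) (fun hq => ⟨by omega, ?_⟩)
    (fun hq => ⟨by omega, ?_⟩)
  all_goals
    simp only [topLabel]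
    split_ifs <;> first
      | (exfalso; omega)
      | exact posLabel_congr hn (by omega)

theorem PrismParams.flagLabel_bottom_front (P : PrismParams n m k r)
    (fh : h = 0) (ga : a % 2 = 1 ∧ 0 < a ∧ a < 2 * n)
    (gb : b % 2 = 1 ∧ 0 < b ∧ b < 2 * n)
    (fb' : b' = 0) (ga' : a' % 2 = 1 ∧ 0 < a' ∧ a' < 2 * n)
    (gh' : h' % 2 = 1 ∧ 0 < h' ∧ h' < 2 * m)
    (hx : x % 2 = 0 ∧ (-1 ≤ x - a ∧ x - a ≤ 1) ∧ (-1 ≤ x - a' ∧ x - a' ≤ 1) ∧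
      (a = a' → a % 2 = 0))
    (hy : y % 2 = 0 ∧ (-1 ≤ y - b ∧ y - b ≤ 1) ∧ (-1 ≤ y - b' ∧ y - b' ≤ 1) ∧
      (b = b' → b % 2 = 0))
    (hz : z % 2 = 0 ∧ (-1 ≤ z - h ∧ z - h ≤ 1) ∧ (-1 ≤ z - h' ∧ z - h' ≤ 1) ∧
      (h = h' → h % 2 = 0)) :
    flagLabel n m k r a b h x y z = flagLabel n m k r a' b' h' x y z := by
  have hn := P.n_pos
  have hm := P.m_pos
  rw [flagLabel_bottom P.m_pos fh, flagLabel_front gh'.2 fb']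
  refine P.bottomLabel_eq_beltLabel (w := x / 2) (j := 0) (by omega) (by omega) (fun hq => ⟨by omega, ?_⟩)
    (fun hq => ⟨by omega, ?_⟩)
  all_goals
    simp only [bottomLabel]
    split_ifs <;> first
      | (exfalso; omega)
      | exact posLabel_congr hn (by omega)

theorem PrismParams.flagLabel_top_right (P : PrismParams n m k r)
    (fh : h = 2 * m) (ga : a % 2 = 1 ∧ 0 < a ∧ a < 2 * n)
    (gb : b % 2 = 1 ∧ 0 < b ∧ b < 2 * n)
    (fa' : a' = 2 * n) (gb' : b' % 2 = 1 ∧ 0 < b' ∧ b' < 2 * n)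
    (gh' : h' % 2 = 1 ∧ 0 < h' ∧ h' < 2 * m)
    (hx : x % 2 = 0 ∧ (-1 ≤ x - a ∧ x - a ≤ 1) ∧ (-1 ≤ x - a' ∧ x - a' ≤ 1) ∧
      (a = a' → a % 2 = 0))
    (hy : y % 2 = 0 ∧ (-1 ≤ y - b ∧ y - b ≤ 1) ∧ (-1 ≤ y - b' ∧ y - b' ≤ 1) ∧
      (b = b' → b % 2 = 0))
    (hz : z % 2 = 0 ∧ (-1 ≤ z - h ∧ z - h ≤ 1) ∧ (-1 ≤ z - h' ∧ z - h' ≤ 1) ∧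
      (h = h' → h % 2 = 0)) :
    flagLabel n m k r a b h x y z = flagLabel n m k r a' b' h' x y z := by
  have hn := P.n_pos
  have hm := P.m_pos
  rw [flagLabel_top fh, flagLabel_right gh'.2 fa' gb'.2.1]
  refine topLabel_eq_beltLabel (w := n + y / 2) (j := 1) (by omega) (by omega) (fun hq => ⟨by omega, ?_⟩)
    (fun hq => ⟨by omega, ?_⟩)
  all_goals
    simp only [topLabel]
    split_ifs <;> first
      | (exfalso; omega)
      | exact posLabel_congr hn (by omega)

theorem PrismParams.flagLabel_bottom_right (P : PrismParams n m k r)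
    (fh : h = 0) (ga : a % 2 = 1 ∧ 0 < a ∧ a < 2 * n)
    (gb : b % 2 = 1 ∧ 0 < b ∧ b < 2 * n)
    (fa' : a' = 2 * n) (gb' : b' % 2 = 1 ∧ 0 < b' ∧ b' < 2 * n)
    (gh' : h' % 2 = 1 ∧ 0 < h' ∧ h' < 2 * m)
    (hx : x % 2 = 0 ∧ (-1 ≤ x - a ∧ x - a ≤ 1) ∧ (-1 ≤ x - a' ∧ x - a' ≤ 1) ∧
      (a = a' → a % 2 = 0))
    (hy : y % 2 = 0 ∧ (-1 ≤ y - b ∧ y - b ≤ 1) ∧ (-1 ≤ y - b' ∧ y - b' ≤ 1) ∧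
      (b = b' → b % 2 = 0))
    (hz : z % 2 = 0 ∧ (-1 ≤ z - h ∧ z - h ≤ 1) ∧ (-1 ≤ z - h' ∧ z - h' ≤ 1) ∧
      (h = h' → h % 2 = 0)) :
    flagLabel n m k r a b h x y z = flagLabel n m k r a' b' h' x y z := by
  have hn := P.n_pos
  have hm := P.m_pos
  rw [flagLabel_bottom P.m_pos fh, flagLabel_right gh'.2 fa' gb'.2.1]
  refine P.bottomLabel_eq_beltLabel (w := n + y / 2) (j := 1) (by omega) (by omega) (fun hq => ⟨by omega, ?_⟩)
    (fun hq => ⟨by omega, ?_⟩)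
  all_goals
    simp only [bottomLabel]
    split_ifs <;> first
      | (exfalso; omega)
      | exact posLabel_congr hn (by omega)

theorem PrismParams.flagLabel_top_back (P : PrismParams n m k r)
    (fh : h = 2 * m) (ga : a % 2 = 1 ∧ 0 < a ∧ a < 2 * n)
    (gb : b % 2 = 1 ∧ 0 < b ∧ b < 2 * n)
    (fb' : b' = 2 * n) (ga' : a' % 2 = 1 ∧ 0 < a' ∧ a' < 2 * n)
    (gh' : h' % 2 = 1 ∧ 0 < h' ∧ h' < 2 * m)
    (hx : x % 2 = 0 ∧ (-1 ≤ x - a ∧ x - a ≤ 1) ∧ (-1 ≤ x - a' ∧ x - a' ≤ 1) ∧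
      (a = a' → a % 2 = 0))
    (hy : y % 2 = 0 ∧ (-1 ≤ y - b ∧ y - b ≤ 1) ∧ (-1 ≤ y - b' ∧ y - b' ≤ 1) ∧
      (b = b' → b % 2 = 0))
    (hz : z % 2 = 0 ∧ (-1 ≤ z - h ∧ z - h ≤ 1) ∧ (-1 ≤ z - h' ∧ z - h' ≤ 1) ∧
      (h = h' → h % 2 = 0)) :
    flagLabel n m k r a b h x y z = flagLabel n m k r a' b' h' x y z := by
  have hn := P.n_pos
  have hm := P.m_pos
  rw [flagLabel_top fh, flagLabel_back gh'.2 fb' ga'.2]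
  refine topLabel_eq_beltLabel (w := 3 * n - x / 2) (j := 2) (by omega) (by omega) (fun hq => ⟨by omega, ?_⟩)
    (fun hq => ⟨by omega, ?_⟩)
  all_goals
    simp only [topLabel]
    split_ifs <;> first
      | (exfalso; omega)
      | exact posLabel_congr hn (by omega)

theorem PrismParams.flagLabel_bottom_back (P : PrismParams n m k r)
    (fh : h = 0) (ga : a % 2 = 1 ∧ 0 < a ∧ a < 2 * n)
    (gb : b % 2 = 1 ∧ 0 < b ∧ b < 2 * n)
    (fb' : b' = 2 * n) (ga' : a' % 2 = 1 ∧ 0 < a' ∧ a' < 2 * n)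
    (gh' : h' % 2 = 1 ∧ 0 < h' ∧ h' < 2 * m)
    (hx : x % 2 = 0 ∧ (-1 ≤ x - a ∧ x - a ≤ 1) ∧ (-1 ≤ x - a' ∧ x - a' ≤ 1) ∧
      (a = a' → a % 2 = 0))
    (hy : y % 2 = 0 ∧ (-1 ≤ y - b ∧ y - b ≤ 1) ∧ (-1 ≤ y - b' ∧ y - b' ≤ 1) ∧
      (b = b' → b % 2 = 0))
    (hz : z % 2 = 0 ∧ (-1 ≤ z - h ∧ z - h ≤ 1) ∧ (-1 ≤ z - h' ∧ z - h' ≤ 1) ∧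
      (h = h' → h % 2 = 0)) :
    flagLabel n m k r a b h x y z = flagLabel n m k r a' b' h' x y z := by
  have hn := P.n_pos
  have hm := P.m_pos
  rw [flagLabel_bottom P.m_pos fh, flagLabel_back gh'.2 fb' ga'.2]
  refine P.bottomLabel_eq_beltLabel (w := 3 * n - x / 2) (j := 2) (by omega) (by omega) (fun hq => ⟨by omega, ?_⟩)
    (fun hq => ⟨by omega, ?_⟩)
  all_goals
    simp only [bottomLabel]
    split_ifs <;> first
      | (exfalso; omega)
      | exact posLabel_congr hn (by omega)

theorem PrismParams.flagLabel_top_left (P : PrismParams n m k r)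
    (fh : h = 2 * m) (ga : a % 2 = 1 ∧ 0 < a ∧ a < 2 * n)
    (gb : b % 2 = 1 ∧ 0 < b ∧ b < 2 * n)
    (fa' : a' = 0) (gb' : b' % 2 = 1 ∧ 0 < b' ∧ b' < 2 * n)
    (gh' : h' % 2 = 1 ∧ 0 < h' ∧ h' < 2 * m)
    (hx : x % 2 = 0 ∧ (-1 ≤ x - a ∧ x - a ≤ 1) ∧ (-1 ≤ x - a' ∧ x - a' ≤ 1) ∧
      (a = a' → a % 2 = 0))
    (hy : y % 2 = 0 ∧ (-1 ≤ y - b ∧ y - b ≤ 1) ∧ (-1 ≤ y - b' ∧ y - b' ≤ 1) ∧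
      (b = b' → b % 2 = 0))
    (hz : z % 2 = 0 ∧ (-1 ≤ z - h ∧ z - h ≤ 1) ∧ (-1 ≤ z - h' ∧ z - h' ≤ 1) ∧
      (h = h' → h % 2 = 0)) :
    flagLabel n m k r a b h x y z = flagLabel n m k r a' b' h' x y z := by
  have hn := P.n_pos
  have hm := P.m_pos
  rw [flagLabel_top fh, flagLabel_left gh'.2 fa' gb'.2]
  refine topLabel_eq_beltLabel (w := 4 * n - y / 2) (j := 3) (by omega) (by omega) (fun hq => ⟨by omega, ?_⟩)
    (fun hq => ⟨by omega, ?_⟩)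
  all_goals
    simp only [topLabel]
    split_ifs <;> first
      | (exfalso; omega)
      | exact posLabel_congr hn (by omega)

theorem PrismParams.flagLabel_bottom_left (P : PrismParams n m k r)
    (fh : h = 0) (ga : a % 2 = 1 ∧ 0 < a ∧ a < 2 * n)
    (gb : b % 2 = 1 ∧ 0 < b ∧ b < 2 * n)
    (fa' : a' = 0) (gb' : b' % 2 = 1 ∧ 0 < b' ∧ b' < 2 * n)
    (gh' : h' % 2 = 1 ∧ 0 < h' ∧ h' < 2 * m)
    (hx : x % 2 = 0 ∧ (-1 ≤ x - a ∧ x - a ≤ 1) ∧ (-1 ≤ x - a' ∧ x - a' ≤ 1) ∧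
      (a = a' → a % 2 = 0))
    (hy : y % 2 = 0 ∧ (-1 ≤ y - b ∧ y - b ≤ 1) ∧ (-1 ≤ y - b' ∧ y - b' ≤ 1) ∧
      (b = b' → b % 2 = 0))
    (hz : z % 2 = 0 ∧ (-1 ≤ z - h ∧ z - h ≤ 1) ∧ (-1 ≤ z - h' ∧ z - h' ≤ 1) ∧
      (h = h' → h % 2 = 0)) :
    flagLabel n m k r a b h x y z = flagLabel n m k r a' b' h' x y z := by
  have hn := P.n_pos
  have hm := P.m_pos
  rw [flagLabel_bottom P.m_pos fh, flagLabel_left gh'.2 fa' gb'.2]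
  refine P.bottomLabel_eq_beltLabel (w := 4 * n - y / 2) (j := 3) (by omega) (by omega) (fun hq => ⟨by omega, ?_⟩)
    (fun hq => ⟨by omega, ?_⟩)
  all_goals
    simp only [bottomLabel]
    split_ifs <;> first
      | (exfalso; omega)
      | exact posLabel_congr hn (by omega)

end FlagLabelCross

/-- The label of the diagonal through the square `c` and its corner `v`. -/
def prismLabel (n m k r : ℤ) (c v : Fin 3 → ℤ) : ℤ × ℤ :=
  flagLabel n m k r (c 0) (c 1) (c 2) (v 0) (v 1) (v 2)

theorem flagLabel_flip (n m k r a b h x y z : ℤ) :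
    flagLabel n m k r a b h (2 * a - x) (2 * b - y) (2 * h - z) =
      flagLabel n m k r a b h x y z := by
  have h1 : (2 * a - x - a = 2 * b - y - b) = (x - a = y - b) := by
    rw [eq_iff_iff]; constructor <;> intro <;> omega
  have h2 : (2 * a - x - a = 2 * h - z - h) = (x - a = z - h) := by
    rw [eq_iff_iff]; constructor <;> intro <;> omega
  have h3 : (2 * b - y - b = 2 * h - z - h) = (y - b = z - h) := by
    rw [eq_iff_iff]; constructor <;> intro <;> omega
  simp only [flagLabel, topLabel, bottomLabel, beltLabel, h1, h2, h3]

theorem prismLabel_flip (n m k r : ℤ) (c v : Fin 3 → ℤ) :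
    prismLabel n m k r c (2 • c - v) = prismLabel n m k r c v := by
  simp only [prismLabel, Pi.sub_apply, nsmul_eq_mul, Nat.cast_ofNat]
  exact flagLabel_flip ..

theorem PrismParams.prismLabel_cross {n m : ℕ} {k r : ℤ} (P : PrismParams n m k r)
    {c d v : Fin 3 → ℤ} (hc : IsSurfaceSquare ![n, n, m] c) (hd : IsSurfaceSquare ![n, n, m] d)
    (h : DiagonallyAdjacentAt c d v) : prismLabel n m k r c v = prismLabel n m k r d v := by
  have h' := h.symm
  rw [isSurfaceSquare_prism_iff] at hc hd
  rw [diagonallyAdjacentAt_iff_coord] at h h'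
  obtain ⟨hx, hy, hz⟩ := h
  obtain ⟨hx', hy', hz'⟩ := h'
  have hn := P.n_pos
  have hm := P.m_pos
  unfold prismLabel
  rcases hc with ⟨f | f, g, g'⟩ | ⟨f | f, g, g'⟩ | ⟨f | f, g, g'⟩ <;>
  rcases hd with ⟨e | e, i, i'⟩ | ⟨e | e, i, i'⟩ | ⟨e | e, i, i'⟩
  · exact P.flagLabel_left_left f g g' e i i' hx hy hz
  · omega
  · exact P.flagLabel_left_front f g g' e i i' hx hy hz
  · exact (P.flagLabel_back_left e i i' f g g' hx' hy' hz').symm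
  · exact (P.flagLabel_bottom_left e i i' f g g' hx' hy' hz').symm
  · exact (P.flagLabel_top_left e i i' f g g' hx' hy' hz').symm
  · omega
  · exact P.flagLabel_right_right f g g' e i i' hx hy hz
  · exact (P.flagLabel_front_right e i i' f g g' hx' hy' hz').symm
  · exact P.flagLabel_right_back f g g' e i i' hx hy hz
  · exact (P.flagLabel_bottom_right e i i' f g g' hx' hy' hz').symm
  · exact (P.flagLabel_top_right e i i' f g g' hx' hy' hz').symm
  · exact (P.flagLabel_left_front e i i' f g g' hx' hy' hz').symm
  · exact P.flagLabel_front_right f g g' e i i' hx hy hz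
  · exact P.flagLabel_front_front f g g' e i i' hx hy hz
  · omega
  · exact (P.flagLabel_bottom_front e i i' f g g' hx' hy' hz').symm
  · exact (P.flagLabel_top_front e i i' f g g' hx' hy' hz').symm
  · exact P.flagLabel_back_left f g g' e i i' hx hy hz
  · exact (P.flagLabel_right_back e i i' f g g' hx' hy' hz').symm
  · omega
  · exact P.flagLabel_back_back f g g' e i i' hx hy hz
  · exact (P.flagLabel_bottom_back e i i' f g g' hx' hy' hz').symm
  · exact (P.flagLabel_top_back e i i' f g g' hx' hy' hz').symm
  · exact P.flagLabel_bottom_left f g g' e i i' hx hy hz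
  · exact P.flagLabel_bottom_right f g g' e i i' hx hy hz
  · exact P.flagLabel_bottom_front f g g' e i i' hx hy hz
  · exact P.flagLabel_bottom_back f g g' e i i' hx hy hz
  · exact P.flagLabel_bottom_bottom f g g' e i i' hx hy hz
  · omega
  · exact P.flagLabel_top_left f g g' e i i' hx hy hz
  · exact P.flagLabel_top_right f g g' e i i' hx hy hz
  · exact P.flagLabel_top_front f g g' e i i' hx hy hz
  · exact P.flagLabel_top_back f g g' e i i' hx hy hz
  · omega
  · exact P.flagLabel_top_top f g g' e i i' hx hy hz

theorem PrismParams.prismLabel_eq_of_flagConn {n m : ℕ} {k r : ℤ} (P : PrismParams n m k r)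
    {x y : (Fin 3 → ℤ) × (Fin 3 → ℤ)} (h : FlagConn ![n, n, m] x y) :
    prismLabel n m k r x.1 x.2 = prismLabel n m k r y.1 y.2 := by
  induction h with
  | refl => rfl
  | tail _ hyz ih =>
    rw [ih]
    rcases hyz with ⟨h1, h2⟩ | ⟨h1, h2, h3, h4⟩
    · rw [h1, h2, prismLabel_flip]
    · rw [h1, P.prismLabel_cross h2 h3 h4]

/-- Squares on a common diagonal share a label. -/
theorem PrismParams.exists_label_eq {n m : ℕ} {k r : ℤ} (P : PrismParams n m k r)
    {a b : SurfaceSquare ![n, n, m]} (h : OnCommonDiagonal a b) (hab : a ≠ b) :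
    ∃ v w, IsCornerOf v a.1 ∧ IsCornerOf w b.1 ∧
      prismLabel n m k r a.1 v = prismLabel n m k r b.1 w := by
  obtain ⟨l, c, v, rfl, rfl, hadj, hstr⟩ := h
  obtain _ | l := l
  · exact absurd rfl hab
  have key : ∀ i, i < l + 1 →
      prismLabel n m k r (c 0).1 (v 0) = prismLabel n m k r (c (i + 1)).1 (v i) := by
    intro i
    induction i with
    | zero => exact fun hi => P.prismLabel_cross (c 0).2 (c 1).2 (hadj 0 hi)
    | succ i ih =>
      intro hi
      rw [ih (by omega), ← P.prismLabel_cross (c (i + 1)).2 (c (i + 2)).2 (hadj _ hi),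
        ← prismLabel_flip, ← hstr i hi, add_sub_cancel_left]
  exact ⟨v 0, v l, ((hadj 0 (by omega) _).2 rfl).1, ((hadj l (by omega) _).2 rfl).2,
    key l (by omega)⟩

theorem FlagConn.map {L : Fin 3 → ℕ} {f : (Fin 3 → ℤ) → Fin 3 → ℤ}
    (hflip : ∀ c v, f (2 • c - v) = 2 • f c - f v)
    (hsurf : ∀ c, IsSurfaceSquare L c → IsSurfaceSquare L (f c))
    (hadj : ∀ c d v, DiagonallyAdjacentAt c d v → DiagonallyAdjacentAt (f c) (f d) (f v))
    {x y : (Fin 3 → ℤ) × (Fin 3 → ℤ)} (h : FlagConn L x y) :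
    FlagConn L (Prod.map f f x) (Prod.map f f y) := by
  induction h with
  | refl => exact FlagConn.refl _
  | tail _ hyz ih =>
    refine ih.tail ?_
    rcases hyz with ⟨h1, h2⟩ | ⟨h1, h2, h3, h4⟩
    · exact Or.inl ⟨congrArg f h1, by simp only [Prod.map_snd, Prod.map_fst, h2, hflip]⟩
    · exact Or.inr ⟨congrArg f h1, hsurf _ h2, hsurf _ h3, hadj _ _ _ h4⟩

/-- The quarter turn of the prism about its axis. -/
def quarterTurn (n : ℤ) (v : Fin 3 → ℤ) : Fin 3 → ℤ := ![2 * n - v 1, v 0, v 2]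

/-- The reflection of the prism that exchanges its top and its bottom. -/
def upsideDown (m : ℤ) (v : Fin 3 → ℤ) : Fin 3 → ℤ := ![v 0, v 1, 2 * m - v 2]

theorem FlagConn.quarterTurn {n m : ℕ} {x y : (Fin 3 → ℤ) × (Fin 3 → ℤ)}
    (h : FlagConn ![n, n, m] x y) :
    FlagConn ![n, n, m] (Prod.map (quarterTurn n) (quarterTurn n) x)
      (Prod.map (_root_.quarterTurn n) (_root_.quarterTurn n) y) := by
  refine h.map (fun c v => ?_) (fun c hc => ?_) (fun c d v hv => ?_)
  · funext i
    fin_cases i <;> simp [_root_.quarterTurn]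
    ring
  · rw [isSurfaceSquare_prism_iff] at hc ⊢
    simp only [_root_.quarterTurn, Matrix.cons_val]
    rcases hc with ⟨h0, h1, h2⟩ | ⟨h0, h1, h2⟩ | ⟨h0, h1, h2⟩
    · exact Or.inr (Or.inl ⟨by omega, by omega, by omega⟩)
    · exact Or.inl ⟨by omega, by omega, by omega⟩
    · exact Or.inr (Or.inr ⟨by omega, by omega, by omega⟩)
  · rw [diagonallyAdjacentAt_iff_coord] at hv ⊢
    obtain ⟨h0, h1, h2⟩ := hv
    simp only [_root_.quarterTurn, Matrix.cons_val]
    exact ⟨by omega, by omega, by omega⟩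

theorem FlagConn.upsideDown {n m : ℕ} {x y : (Fin 3 → ℤ) × (Fin 3 → ℤ)}
    (h : FlagConn ![n, n, m] x y) :
    FlagConn ![n, n, m] (Prod.map (upsideDown m) (upsideDown m) x)
      (Prod.map (_root_.upsideDown m) (_root_.upsideDown m) y) := by
  refine h.map (fun c v => ?_) (fun c hc => ?_) (fun c d v hv => ?_)
  · funext i
    fin_cases i <;> simp [_root_.upsideDown]
    ring
  · rw [isSurfaceSquare_prism_iff] at hc ⊢
    simp only [_root_.upsideDown, Matrix.cons_val]
    rcases hc with ⟨h0, h1, h2⟩ | ⟨h0, h1, h2⟩ | ⟨h0, h1, h2⟩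
    · exact Or.inl ⟨by omega, by omega, by omega⟩
    · exact Or.inr (Or.inl ⟨by omega, by omega, by omega⟩)
    · exact Or.inr (Or.inr ⟨by omega, by omega, by omega⟩)
  · rw [diagonallyAdjacentAt_iff_coord] at hv ⊢
    obtain ⟨h0, h1, h2⟩ := hv
    simp only [_root_.upsideDown, Matrix.cons_val]
    exact ⟨by omega, by omega, by omega⟩

/-- The first coordinate of the point at position `u` on the perimeter of `[0, 2 n]²`. -/
def perimeter (n u : ℤ) : ℤ := max 0 (min (2 * n) (min (u % (8 * n)) (6 * n - u % (8 * n))))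

theorem perimeter_add_mul (n u i : ℤ) : perimeter n (u + i * (8 * n)) = perimeter n u := by
  rw [perimeter, perimeter, Int.add_mul_emod_self_right]

/-- The point of the belt of the prism at position `u` of the perimeter and height `h`. -/
def beltPoint (n u h : ℤ) : Fin 3 → ℤ := ![perimeter n u, perimeter n (u - 2 * n), h]

theorem beltPoint_add_mul (n u h i : ℤ) : beltPoint n (u + i * (8 * n)) h = beltPoint n u h := by
  rw [beltPoint, beltPoint, perimeter_add_mul,
    show u + i * (8 * n) - 2 * n = u - 2 * n + i * (8 * n) by ring, perimeter_add_mul]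

/-- A property of points of the perimeter may be proved on one period. -/
theorem perimeter_induction {n : ℤ} (hn : 0 < n) {p : ℤ → Prop} (u : ℤ)
    (hp : ∀ v i, p v → p (v + i * (8 * n)))
    (h : ∀ v, v % 2 = u % 2 → 0 ≤ v → v < 8 * n → p v) : p u := by
  have e : u = u % (8 * n) + u / (8 * n) * (8 * n) := by
    rw [mul_comm (u / (8 * n))]
    exact (Int.emod_add_mul_ediv u (8 * n)).symm
  rw [e]
  refine hp _ _ (h _ ?_ (Int.emod_nonneg _ (by omega)) (Int.emod_lt_of_pos _ (by omega)))
  exact Int.emod_emod_of_dvd u ⟨4 * n, by ring⟩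

theorem perimeter_front {n u : ℤ} (h0 : 0 ≤ u) (h1 : u ≤ 2 * n) (hn : 0 < n) :
    perimeter n u = u := by
  rw [perimeter, Int.emod_eq_of_lt (by omega) (by omega)]
  omega

theorem perimeter_right {n u : ℤ} (h0 : 2 * n ≤ u) (h1 : u ≤ 4 * n) (hn : 0 < n) :
    perimeter n u = 2 * n := by
  rw [perimeter, Int.emod_eq_of_lt (by omega) (by omega)]
  omega

theorem perimeter_back {n u : ℤ} (h0 : 4 * n ≤ u) (h1 : u ≤ 6 * n) (hn : 0 < n) :
    perimeter n u = 6 * n - u := by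
  rw [perimeter, Int.emod_eq_of_lt (by omega) (by omega)]
  omega

theorem perimeter_left {n u : ℤ} (h0 : 6 * n ≤ u) (h1 : u ≤ 8 * n) (hn : 0 < n) :
    perimeter n u = 0 := by
  rcases h1.lt_or_eq with h | rfl
  · rw [perimeter, Int.emod_eq_of_lt (by omega) (by omega)]
    omega
  · rw [perimeter, Int.emod_self]
    omega

theorem perimeter_left_neg {n u : ℤ} (h0 : -(2 * n) ≤ u) (h1 : u ≤ 0) (hn : 0 < n) :
    perimeter n u = 0 := by
  rw [← perimeter_add_mul n u 1, perimeter_left (by omega) (by omega) hn]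

theorem perimeter_odd {n u x y x₁ y₁ x₂ y₂ : ℤ} (hn : 0 < n) (hu : u % 2 = 1)
    (hx : perimeter n u = x) (hy : perimeter n (u - 2 * n) = y)
    (hx₁ : perimeter n (u - 1) = x₁) (hy₁ : perimeter n (u - 1 - 2 * n) = y₁)
    (hx₂ : perimeter n (u + 1) = x₂) (hy₂ : perimeter n (u + 1 - 2 * n) = y₂) :
    (y = 0 ∧ y₁ = 0 ∧ y₂ = 0 ∧ x % 2 = 1 ∧ 0 < x ∧ x < 2 * n ∧ x₁ = x - 1 ∧ x₂ = x + 1) ∨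
    (x = 2 * n ∧ x₁ = 2 * n ∧ x₂ = 2 * n ∧ y % 2 = 1 ∧ 0 < y ∧ y < 2 * n ∧
      y₁ = y - 1 ∧ y₂ = y + 1) ∨
    (y = 2 * n ∧ y₁ = 2 * n ∧ y₂ = 2 * n ∧ x % 2 = 1 ∧ 0 < x ∧ x < 2 * n ∧
      x₁ = x + 1 ∧ x₂ = x - 1) ∨
    (x = 0 ∧ x₁ = 0 ∧ x₂ = 0 ∧ y % 2 = 1 ∧ 0 < y ∧ y < 2 * n ∧ y₁ = y + 1 ∧ y₂ = y - 1) := by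
  subst hx hy hx₁ hy₁ hx₂ hy₂
  refine perimeter_induction hn u (p := fun u =>
    (perimeter n (u - 2 * n) = 0 ∧ perimeter n (u - 1 - 2 * n) = 0 ∧
      perimeter n (u + 1 - 2 * n) = 0 ∧ perimeter n u % 2 = 1 ∧ 0 < perimeter n u ∧
      perimeter n u < 2 * n ∧ perimeter n (u - 1) = perimeter n u - 1 ∧
      perimeter n (u + 1) = perimeter n u + 1) ∨
    (perimeter n u = 2 * n ∧ perimeter n (u - 1) = 2 * n ∧ perimeter n (u + 1) = 2 * n ∧
      perimeter n (u - 2 * n) % 2 = 1 ∧ 0 < perimeter n (u - 2 * n) ∧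
      perimeter n (u - 2 * n) < 2 * n ∧
      perimeter n (u - 1 - 2 * n) = perimeter n (u - 2 * n) - 1 ∧
      perimeter n (u + 1 - 2 * n) = perimeter n (u - 2 * n) + 1) ∨
    (perimeter n (u - 2 * n) = 2 * n ∧ perimeter n (u - 1 - 2 * n) = 2 * n ∧
      perimeter n (u + 1 - 2 * n) = 2 * n ∧ perimeter n u % 2 = 1 ∧ 0 < perimeter n u ∧
      perimeter n u < 2 * n ∧ perimeter n (u - 1) = perimeter n u + 1 ∧
      perimeter n (u + 1) = perimeter n u - 1) ∨
    (perimeter n u = 0 ∧ perimeter n (u - 1) = 0 ∧ perimeter n (u + 1) = 0 ∧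
      perimeter n (u - 2 * n) % 2 = 1 ∧ 0 < perimeter n (u - 2 * n) ∧
      perimeter n (u - 2 * n) < 2 * n ∧
      perimeter n (u - 1 - 2 * n) = perimeter n (u - 2 * n) + 1 ∧
      perimeter n (u + 1 - 2 * n) = perimeter n (u - 2 * n) - 1)) ?_ ?_
  · intro v i hv
    rwa [show v + i * (8 * n) + 1 = v + 1 + i * (8 * n) by ring,
      show v + i * (8 * n) - 1 = v - 1 + i * (8 * n) by ring,
      show v + 1 + i * (8 * n) - 2 * n = v + 1 - 2 * n + i * (8 * n) by ring,
      show v - 1 + i * (8 * n) - 2 * n = v - 1 - 2 * n + i * (8 * n) by ring,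
      show v + i * (8 * n) - 2 * n = v - 2 * n + i * (8 * n) by ring,
      perimeter_add_mul, perimeter_add_mul, perimeter_add_mul, perimeter_add_mul,
      perimeter_add_mul, perimeter_add_mul]
  · intro v hv h0 h1
    rcases le_or_gt (v + 1) (2 * n) with h | h
    · left
      rw [perimeter_front (u := v) (by omega) (by omega) hn,
        perimeter_front (u := v - 1) (by omega) (by omega) hn,
        perimeter_front (u := v + 1) (by omega) (by omega) hn,
        perimeter_left_neg (u := v - 2 * n) (by omega) (by omega) hn,
        perimeter_left_neg (u := v - 1 - 2 * n) (by omega) (by omega) hn,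
        perimeter_left_neg (u := v + 1 - 2 * n) (by omega) (by omega) hn]
      omega
    rcases le_or_gt (v + 1) (4 * n) with h' | h'
    · right; left
      rw [perimeter_right (u := v) (by omega) (by omega) hn,
        perimeter_right (u := v - 1) (by omega) (by omega) hn,
        perimeter_right (u := v + 1) (by omega) (by omega) hn,
        perimeter_front (u := v - 2 * n) (by omega) (by omega) hn,
        perimeter_front (u := v - 1 - 2 * n) (by omega) (by omega) hn,
        perimeter_front (u := v + 1 - 2 * n) (by omega) (by omega) hn]
      omega
    rcases le_or_gt (v + 1) (6 * n) with h'' | h''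
    · right; right; left
      rw [perimeter_back (u := v) (by omega) (by omega) hn,
        perimeter_back (u := v - 1) (by omega) (by omega) hn,
        perimeter_back (u := v + 1) (by omega) (by omega) hn,
        perimeter_right (u := v - 2 * n) (by omega) (by omega) hn,
        perimeter_right (u := v - 1 - 2 * n) (by omega) (by omega) hn,
        perimeter_right (u := v + 1 - 2 * n) (by omega) (by omega) hn]
      omega
    · right; right; right
      rw [perimeter_left (u := v) (by omega) (by omega) hn,
        perimeter_left (u := v - 1) (by omega) (by omega) hn,
        perimeter_left (u := v + 1) (by omega) (by omega) hn,
        perimeter_back (u := v - 2 * n) (by omega) (by omega) hn,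
        perimeter_back (u := v - 1 - 2 * n) (by omega) (by omega) hn,
        perimeter_back (u := v + 1 - 2 * n) (by omega) (by omega) hn]
      omega

theorem perimeter_opposite {n : ℤ} (hn : 0 < n) (u : ℤ) :
    perimeter n (u + 2 * n) = 2 * n - perimeter n (u - 2 * n) := by
  refine perimeter_induction hn u
    (p := fun u => perimeter n (u + 2 * n) = 2 * n - perimeter n (u - 2 * n))
    (fun v i hv => ?_) (fun v _ h0 h1 => ?_)
  · rw [show v + i * (8 * n) - 2 * n = v - 2 * n + i * (8 * n) by ring,
      show v + i * (8 * n) + 2 * n = v + 2 * n + i * (8 * n) by ring, perimeter_add_mul,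
      perimeter_add_mul, hv]
  · rcases le_or_gt v (2 * n) with h | h
    · rw [perimeter_right (u := v + 2 * n) (by omega) (by omega) hn,
        perimeter_left_neg (u := v - 2 * n) (by omega) (by omega) hn]
      omega
    rcases le_or_gt v (4 * n) with h | h
    · rw [perimeter_back (u := v + 2 * n) (by omega) (by omega) hn,
        perimeter_front (u := v - 2 * n) (by omega) (by omega) hn]
      omega
    rcases le_or_gt v (6 * n) with h | h
    · rw [perimeter_left (u := v + 2 * n) (by omega) (by omega) hn,
        perimeter_right (u := v - 2 * n) (by omega) (by omega) hn]
      omega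
    · rw [← perimeter_add_mul n (v + 2 * n) (-1),
        perimeter_front (u := v + 2 * n + -1 * (8 * n)) (by omega) (by omega) hn,
        perimeter_back (u := v - 2 * n) (by omega) (by omega) hn]
      omega

theorem quarterTurn_beltPoint {n : ℤ} (hn : 0 < n) (u h : ℤ) :
    quarterTurn n (beltPoint n u h) = beltPoint n (u + 2 * n) h := by
  simp [quarterTurn, beltPoint, perimeter_opposite hn]

theorem upsideDown_beltPoint (n m u h : ℤ) :
    upsideDown m (beltPoint n u h) = beltPoint n u (2 * m - h) := by
  simp [upsideDown, beltPoint]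

theorem isSurfaceSquare_beltPoint {n m : ℕ} (hn : 0 < n) {u h : ℤ} (hu : u % 2 = 1)
    (hh : h % 2 = 1) (h0 : 0 < h) (h1 : h < 2 * m) :
    IsSurfaceSquare ![n, n, m] (beltPoint n u h) := by
  rw [isSurfaceSquare_prism_iff]
  simp only [beltPoint, Matrix.cons_val]
  have := perimeter_odd (n := (n : ℤ)) (by omega) hu rfl rfl rfl rfl rfl rfl
  omega

theorem diagonallyAdjacentAt_beltPoint {n : ℤ} (hn : 0 < n) {u h g h' : ℤ} (hu : u % 2 = 1)
    (hg : g % 2 = 0) (h0 : h = g - 1 ∧ h' = g + 1 ∨ h = g + 1 ∧ h' = g - 1) :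
    DiagonallyAdjacentAt (beltPoint n u h) (beltPoint n (u + 2) h') (beltPoint n (u + 1) g) := by
  rw [diagonallyAdjacentAt_iff_coord]
  simp only [beltPoint, Matrix.cons_val]
  have h1 := perimeter_odd hn hu rfl rfl rfl rfl rfl rfl
  have h2 := perimeter_odd (u := u + 2) hn (by omega) rfl rfl rfl rfl rfl rfl
  rw [show u + 2 - 1 = u + 1 by ring] at h2
  generalize perimeter n u = a at *
  generalize perimeter n (u - 2 * n) = b at *
  generalize perimeter n (u + 1) = a' at *
  generalize perimeter n (u + 1 - 2 * n) = b' at *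
  generalize perimeter n (u + 2) = a'' at *
  generalize perimeter n (u + 2 - 2 * n) = b'' at *
  refine ⟨?_, ?_, by omega⟩ <;> clear h0 <;> rcases h1 with h1 | h1 | h1 | h1 <;>
    rcases h2 with h2 | h2 | h2 | h2 <;> omega

theorem beltPoint_reflect {n : ℤ} (hn : 0 < n) {u : ℤ} (hu : u % 2 = 1) {h g g' : ℤ}
    (hg : g + g' = 2 * h) :
    2 • beltPoint n u h - beltPoint n (u - 1) g = beltPoint n (u + 1) g' := by
  have := perimeter_odd hn hu rfl rfl rfl rfl rfl rfl
  funext i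
  fin_cases i <;> simp [beltPoint] <;> omega

theorem FlagConn.flip_beltPoint {L : Fin 3 → ℕ} {n : ℤ} (hn : 0 < n) {u : ℤ} (hu : u % 2 = 1)
    {h g g' : ℤ} (hg : g + g' = 2 * h) :
    FlagConn L (beltPoint n u h, beltPoint n (u - 1) g)
      (beltPoint n u h, beltPoint n (u + 1) g') := by
  rw [← beltPoint_reflect hn hu hg]
  exact FlagConn.flip _ _

/-- The flag of the belt square at `(u, h)` on the diagonal that goes up as `u` increases. -/
def upFlag (n u h : ℤ) : (Fin 3 → ℤ) × (Fin 3 → ℤ) := (beltPoint n u h, beltPoint n (u + 1) (h + 1))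

/-- The flag of the belt square at `(u, h)` on the diagonal that goes down as `u` increases. -/
def downFlag (n u h : ℤ) : (Fin 3 → ℤ) × (Fin 3 → ℤ) :=
  (beltPoint n u h, beltPoint n (u + 1) (h - 1))

theorem upFlag_conn_step {n m : ℕ} (hn : 0 < n) {u h : ℤ} (hu : u % 2 = 1) (hh : h % 2 = 1)
    (h0 : 0 < h) (h1 : h + 2 < 2 * m) :
    FlagConn ![n, n, m] (upFlag n u h) (upFlag n (u + 2) (h + 2)) := by
  refine (FlagConn.cross (d := beltPoint n (u + 2) (h + 2)) ?_ ?_ ?_).trans ?_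
  · exact isSurfaceSquare_beltPoint hn hu hh h0 (by omega)
  · exact isSurfaceSquare_beltPoint hn (by omega) (by omega) (by omega) (by omega)
  · exact diagonallyAdjacentAt_beltPoint (by omega) hu (by omega) (by omega)
  · have := FlagConn.flip_beltPoint (L := ![n, n, m]) (n := n) (by omega) (u := u + 2) (by omega)
      (h := h + 2) (g := h + 1) (g' := h + 2 + 1) (by omega)
    rwa [show u + 2 - 1 = u + 1 by ring] at this

theorem downFlag_conn_step {n m : ℕ} (hn : 0 < n) {u h : ℤ} (hu : u % 2 = 1) (hh : h % 2 = 1)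
    (h0 : 0 < h - 2) (h1 : h < 2 * m) :
    FlagConn ![n, n, m] (downFlag n u h) (downFlag n (u + 2) (h - 2)) := by
  refine (FlagConn.cross (d := beltPoint n (u + 2) (h - 2)) ?_ ?_ ?_).trans ?_
  · exact isSurfaceSquare_beltPoint hn hu hh (by omega) (by omega)
  · exact isSurfaceSquare_beltPoint hn (by omega) (by omega) (by omega) (by omega)
  · exact diagonallyAdjacentAt_beltPoint (by omega) hu (by omega) (by omega)
  · have := FlagConn.flip_beltPoint (L := ![n, n, m]) (n := n) (by omega) (u := u + 2) (by omega)
      (h := h - 2) (g := h - 1) (g' := h - 2 - 1) (by omega)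
    rwa [show u + 2 - 1 = u + 1 by ring] at this

theorem upFlag_conn {n m : ℕ} (hn : 0 < n) {u h : ℤ} (hu : u % 2 = 1) (hh : h % 2 = 1)
    (h0 : 0 < h) (i : ℕ) (h1 : h + 2 * i < 2 * m) :
    FlagConn ![n, n, m] (upFlag n u h) (upFlag n (u + 2 * i) (h + 2 * i)) := by
  induction i with
  | zero => simpa using FlagConn.refl _
  | succ i ih =>
    push_cast at h1 ⊢
    refine (ih (by omega)).trans ?_
    rw [mul_add, mul_one, ← add_assoc, ← add_assoc]
    exact upFlag_conn_step hn (by omega) (by omega) (by omega) (by omega)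

theorem downFlag_conn {n m : ℕ} (hn : 0 < n) {u h : ℤ} (hu : u % 2 = 1) (hh : h % 2 = 1)
    (i : ℕ) (h0 : 0 < h - 2 * i) (h1 : h < 2 * m) :
    FlagConn ![n, n, m] (downFlag n u h) (downFlag n (u + 2 * i) (h - 2 * i)) := by
  induction i with
  | zero => simpa using FlagConn.refl _
  | succ i ih =>
    push_cast at h0 ⊢
    refine (ih (by omega)).trans ?_
    rw [mul_add, mul_one, ← add_assoc, ← sub_sub]
    exact downFlag_conn_step hn (by omega) (by omega) (by omega) (by omega)

/-- The flag of a square of the top row whose diagonal goes up through the top edge at `u`. -/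
def upTop (n m u : ℤ) : (Fin 3 → ℤ) × (Fin 3 → ℤ) := upFlag n (2 * u - 1) (2 * m - 1)

/-- The flag of a square of the top row whose diagonal goes down from the top edge at `u`. -/
def downTop (n m u : ℤ) : (Fin 3 → ℤ) × (Fin 3 → ℤ) := downFlag n (2 * u + 1) (2 * m - 1)

theorem upTop_add_mul (n m u i : ℤ) : upTop n m (u + i * (4 * n)) = upTop n m u := by
  rw [upTop, upTop, upFlag, upFlag,
    show 2 * (u + i * (4 * n)) - 1 = 2 * u - 1 + i * (8 * n) by ring,
    show 2 * u - 1 + i * (8 * n) + 1 = 2 * u - 1 + 1 + i * (8 * n) by ring, beltPoint_add_mul,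
    beltPoint_add_mul]

theorem downTop_add_mul (n m u i : ℤ) : downTop n m (u + i * (4 * n)) = downTop n m u := by
  rw [downTop, downTop, downFlag, downFlag,
    show 2 * (u + i * (4 * n)) + 1 = 2 * u + 1 + i * (8 * n) by ring,
    show 2 * u + 1 + i * (8 * n) + 1 = 2 * u + 1 + 1 + i * (8 * n) by ring, beltPoint_add_mul,
    beltPoint_add_mul]

theorem quarterTurn_upTop {n : ℤ} (hn : 0 < n) (m u : ℤ) :
    Prod.map (quarterTurn n) (quarterTurn n) (upTop n m u) = upTop n m (u + n) := by
  simp only [upTop, upFlag, Prod.map_apply, quarterTurn_beltPoint hn]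
  congr 2 <;> ring

theorem quarterTurn_downTop {n : ℤ} (hn : 0 < n) (m u : ℤ) :
    Prod.map (quarterTurn n) (quarterTurn n) (downTop n m u) = downTop n m (u + n) := by
  simp only [downTop, downFlag, Prod.map_apply, quarterTurn_beltPoint hn]
  congr 2 <;> ring

/-- The flag of the square `(a, b)` of the top face on the diagonal of slope `1`. -/
def topFlag (m a b : ℤ) : (Fin 3 → ℤ) × (Fin 3 → ℤ) := (![a, b, 2 * m], ![a + 1, b + 1, 2 * m])

theorem topFlag_conn {n m : ℕ} {a b : ℤ} (ha : a % 2 = 1) (hb : b % 2 = 1) (ha0 : 0 < a)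
    (hb0 : 0 < b) (i : ℕ) (ha1 : a + 2 * i < 2 * n) (hb1 : b + 2 * i < 2 * n) :
    FlagConn ![n, n, m] (topFlag m a b) (topFlag m (a + 2 * i) (b + 2 * i)) := by
  induction i with
  | zero => simpa using FlagConn.refl _
  | succ i ih =>
    push_cast at ha1 hb1 ⊢
    refine (ih (by omega) (by omega)).trans ?_
    refine (FlagConn.cross (d := ![a + 2 * (i + 1), b + 2 * (i + 1), 2 * m]) ?_ ?_ ?_).trans ?_
    · rw [isSurfaceSquare_prism_iff]
      simp only [Matrix.cons_val, or_true, true_and]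
      omega
    · rw [isSurfaceSquare_prism_iff]
      simp only [Matrix.cons_val, or_true, true_and]
      omega
    · rw [diagonallyAdjacentAt_iff_coord]
      simp only [Matrix.cons_val]
      omega
    · have := FlagConn.flip (L := ![n, n, m]) ![a + 2 * (i + 1), b + 2 * (i + 1), 2 * (m : ℤ)]
        ![a + 2 * i + 1, b + 2 * i + 1, 2 * m]
      rw [show 2 • ![a + 2 * (i + 1), b + 2 * (i + 1), 2 * (m : ℤ)] -
        ![a + 2 * i + 1, b + 2 * i + 1, 2 * (m : ℤ)] =
          ![a + 2 * (i + 1) + 1, b + 2 * (i + 1) + 1, 2 * m] by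
        funext j
        fin_cases j <;> simp <;> ring] at this
      exact this

theorem upTop_conn_topFlag {n m : ℕ} (hm : 0 < m) {u : ℤ} (h0 : 0 < u) (h1 : u < n) :
    FlagConn ![n, n, m] (upTop n m u) (topFlag m (2 * u + 1) 1) := by
  have e : upTop n m u = (![2 * u - 1, 0, 2 * m - 1], ![2 * u, 0, 2 * m]) := by
    simp only [upTop, upFlag, beltPoint]
    rw [perimeter_front (u := 2 * u - 1) (by omega) (by omega) (by omega),
      perimeter_front (u := 2 * u - 1 + 1) (by omega) (by omega) (by omega),
      perimeter_left_neg (u := 2 * u - 1 - 2 * n) (by omega) (by omega) (by omega),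
      perimeter_left_neg (u := 2 * u - 1 + 1 - 2 * n) (by omega) (by omega) (by omega)]
    refine Prod.ext (Matrix.vec3_eq ?_ ?_ ?_) (Matrix.vec3_eq ?_ ?_ ?_) <;> omega
  rw [e]
  refine (FlagConn.cross (d := ![2 * u + 1, 1, 2 * m]) ?_ ?_ ?_).trans ?_
  · rw [isSurfaceSquare_prism_iff]
    simp only [Matrix.cons_val, true_or, true_and]
    omega
  · rw [isSurfaceSquare_prism_iff]
    simp only [Matrix.cons_val, or_true, true_and]
    omega
  · rw [diagonallyAdjacentAt_iff_coord]
    simp only [Matrix.cons_val]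
    omega
  · have := FlagConn.flip (L := ![n, n, m]) ![2 * u + 1, 1, 2 * (m : ℤ)] ![2 * u, 0, 2 * (m : ℤ)]
    rw [show 2 • ![2 * u + 1, 1, 2 * (m : ℤ)] - ![2 * u, 0, 2 * (m : ℤ)] =
        ![2 * u + 1 + 1, 1 + 1, 2 * m] by
      funext j
      fin_cases j <;> simp <;> ring] at this
    exact this

theorem topFlag_conn_downTop {n m : ℕ} (hm : 0 < m) {u : ℤ} (h0 : 0 < u) (h1 : u < n) :
    FlagConn ![n, n, m] (topFlag m (2 * n - 1) (2 * n - 2 * u - 1)) (downTop n m (2 * n - u)) := by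
  have e : downTop n m (2 * n - u) =
      (![2 * (n : ℤ), 2 * n - 2 * u + 1, 2 * m - 1], ![2 * (n : ℤ), 2 * n - 2 * u + 2, 2 * m - 2]) := by
    simp only [downTop, downFlag, beltPoint]
    rw [perimeter_right (u := 2 * (2 * n - u) + 1) (by omega) (by omega) (by omega),
      perimeter_right (u := 2 * (2 * n - u) + 1 + 1) (by omega) (by omega) (by omega),
      perimeter_front (u := 2 * (2 * n - u) + 1 - 2 * n) (by omega) (by omega) (by omega),
      perimeter_front (u := 2 * (2 * n - u) + 1 + 1 - 2 * n) (by omega) (by omega) (by omega)]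
    refine Prod.ext (Matrix.vec3_eq ?_ ?_ ?_) (Matrix.vec3_eq ?_ ?_ ?_) <;> omega
  rw [e, topFlag]
  refine (FlagConn.cross (d := ![2 * (n : ℤ), 2 * n - 2 * u + 1, 2 * m - 1]) ?_ ?_ ?_).trans ?_
  · rw [isSurfaceSquare_prism_iff]
    simp only [Matrix.cons_val, or_true, true_and]
    omega
  · rw [isSurfaceSquare_prism_iff]
    simp only [Matrix.cons_val, or_true, true_and]
    omega
  · rw [diagonallyAdjacentAt_iff_coord]
    simp only [Matrix.cons_val]
    omega
  · have := FlagConn.flip (L := ![n, n, m]) ![2 * (n : ℤ), 2 * n - 2 * u + 1, 2 * (m : ℤ) - 1]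
      ![2 * (n : ℤ) - 1 + 1, 2 * n - 2 * u - 1 + 1, 2 * m]
    rw [show 2 • ![2 * (n : ℤ), 2 * n - 2 * u + 1, 2 * (m : ℤ) - 1] -
        ![2 * (n : ℤ) - 1 + 1, 2 * n - 2 * u - 1 + 1, 2 * m] =
        ![2 * (n : ℤ), 2 * n - 2 * u + 2, 2 * m - 2] by
      funext j
      fin_cases j <;> simp <;> ring] at this
    exact this

/-- A diagonal that goes up at a point of a top edge comes down at its mirror image in the next
corner. -/
theorem upTop_conn_downTop {n m : ℕ} (hm : 0 < m) {j u : ℤ} (h0 : j * n < u)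
    (h1 : u < (j + 1) * n) :
    FlagConn ![n, n, m] (upTop n m u) (downTop n m (2 * (j + 1) * n - u)) := by
  have hn : (0 : ℤ) < n := by linarith
  have key : ∀ (i : ℕ) (x : ℤ), 0 < x → x < n →
      FlagConn ![n, n, m] (upTop n m (x + i * n)) (downTop n m ((i + 2) * n - x)) := by
    intro i x hx0 hx1
    induction i with
    | zero =>
      simp only [Nat.cast_zero, zero_mul, add_zero, zero_add]
      refine (upTop_conn_topFlag hm hx0 hx1).trans (.trans ?_ (topFlag_conn_downTop hm hx0 hx1))
      obtain ⟨i, hi⟩ : ∃ i : ℕ, (i : ℤ) = n - 1 - x := ⟨(n - 1 - x).toNat, by omega⟩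
      have := topFlag_conn (n := n) (m := m) (a := 2 * x + 1) (b := 1) (by omega) (by omega)
        (by omega) (by omega) i (by omega) (by omega)
      rwa [show 2 * x + 1 + 2 * (i : ℤ) = 2 * n - 1 by omega,
        show 1 + 2 * (i : ℤ) = 2 * n - 2 * x - 1 by omega] at this
    | succ i ih =>
      have := ih.quarterTurn
      rw [quarterTurn_upTop hn, quarterTurn_downTop hn] at this
      convert this using 2 <;> push_cast <;> ring
  have := key (j % 4).toNat (u - j * n) (by linarith) (by linarith)
  have hj : ((j % 4).toNat : ℤ) = j - 4 * (j / 4) := by omega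
  rw [hj, ← upTop_add_mul n m _ (j / 4), ← downTop_add_mul n m _ (j / 4)] at this
  convert this using 2 <;> ring

theorem upsideDown_upTop (n m u : ℤ) :
    Prod.map (upsideDown m) (upsideDown m) (upTop n m u) = downFlag n (2 * u - 1) 1 := by
  simp only [upTop, upFlag, downFlag, Prod.map_apply, upsideDown_beltPoint]
  congr 2; all_goals ring

theorem upsideDown_downTop (n m u : ℤ) :
    Prod.map (upsideDown m) (upsideDown m) (downTop n m u) = upFlag n (2 * u + 1) 1 := by
  simp only [downTop, upFlag, downFlag, Prod.map_apply, upsideDown_beltPoint]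
  congr 2; all_goals ring

theorem upFlag_conn_upTop {n m : ℕ} (hn : 0 < n) {u h w : ℤ} (hu : u % 2 = 1)
    (hh : h % 2 = 1) (h0 : 0 < h) (h1 : h < 2 * m) (hw : 2 * w = u + 2 * m - h) :
    FlagConn ![n, n, m] (upFlag n u h) (upTop n m w) := by
  rw [upTop]
  obtain ⟨i, hi⟩ : ∃ i : ℕ, 2 * (i : ℤ) = 2 * m - 1 - h := ⟨((2 * m - 1 - h) / 2).toNat, by omega⟩
  have := upFlag_conn (n := n) (m := m) hn hu hh h0 i (by omega)
  rw [hi] at this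
  convert this using 2 <;> omega

theorem downFlag_conn_downTop {n m : ℕ} (hn : 0 < n) {u h w : ℤ} (hu : u % 2 = 1)
    (hh : h % 2 = 1) (h0 : 0 < h) (h1 : h < 2 * m) (hw : 2 * w = u - 2 * m + h) :
    FlagConn ![n, n, m] (downFlag n u h) (downTop n m w) := by
  rw [downTop]
  obtain ⟨i, hi⟩ : ∃ i : ℕ, 2 * (i : ℤ) = 2 * m - 1 - h := ⟨((2 * m - 1 - h) / 2).toNat, by omega⟩
  have := downFlag_conn (n := n) (m := m) hn (u := 2 * w + 1) (h := 2 * m - 1) (by omega)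
    (by omega) i (by omega) (by omega)
  rw [hi] at this
  convert this.symm using 2 <;> omega

theorem downTop_conn_upTop {n m : ℕ} (hm : 0 < m) {j y : ℤ} (h0 : j * n < y + m)
    (h1 : y + m < (j + 1) * n) :
    FlagConn ![n, n, m] (downTop n m y) (upTop n m (2 * (j + 1) * n - y)) := by
  have hn : (0 : ℤ) < n := by linarith
  have key := (upTop_conn_downTop (n := n) hm h0 h1).upsideDown
  rw [upsideDown_upTop, upsideDown_downTop] at key
  refine .trans ?_ (key.trans ?_)
  · exact (downFlag_conn_downTop (by omega) (by omega) (by omega) (by omega) (by omega)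
      (by omega)).symm
  · exact upFlag_conn_upTop (by omega) (by omega) (by omega) (by omega) (by omega) (by ring)

theorem beltLabel_add_mul {n : ℤ} (hn : 0 < n) (m k r u h i : ℤ) (p : Prop) [Decidable p] :
    beltLabel n m k r (u + i * (8 * n)) h p = beltLabel n m k r u h p := by
  rw [beltLabel, beltLabel,
    show u + i * (8 * n) + 2 * m - h = u + 2 * m - h + i * (4 * n) * 2 by ring,
    show u + i * (8 * n) - 2 * m + h = u - 2 * m + h + i * (4 * n) * 2 by ring,
    Int.add_mul_ediv_right _ _ (by norm_num), Int.add_mul_ediv_right _ _ (by norm_num),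
    posLabel_add_mul hn]
  have hdown : ∀ v : ℤ, downLabel n k r (v + i * (4 * n)) = downLabel n k r v := by
    intro v
    induction i using Int.induction_on with
    | zero => simp
    | succ i ih => rw [← ih]; exact downLabel_congr hn (Or.inr (Or.inl (by ring)))
    | pred i ih => rw [← ih]; exact downLabel_congr hn (Or.inr (Or.inr (by ring)))
  rw [hdown]

theorem prismLabel_beltPoint {n m : ℤ} (hn : 0 < n) (k r : ℤ) {u h g : ℤ} (hu : u % 2 = 1)
    (h0 : 0 < h) (h1 : h < 2 * m) (hg : g = h + 1 ∨ g = h - 1) :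
    prismLabel n m k r (beltPoint n u h) (beltPoint n (u + 1) g) =
      beltLabel n m k r u h (g = h + 1) := by
  refine perimeter_induction hn u (p := fun u =>
    prismLabel n m k r (beltPoint n u h) (beltPoint n (u + 1) g) =
      beltLabel n m k r u h (g = h + 1)) (fun v i hv => ?_) (fun v hv h2 h3 => ?_)
  · rwa [show v + i * (8 * n) + 1 = v + 1 + i * (8 * n) by ring, beltPoint_add_mul,
      beltPoint_add_mul, beltLabel_add_mul hn]
  · simp only [prismLabel, beltPoint, Matrix.cons_val]
    rcases le_or_gt (v + 1) (2 * n) with h | h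
    · rw [perimeter_front (u := v) (by omega) (by omega) hn,
        perimeter_front (u := v + 1) (by omega) (by omega) hn,
        perimeter_left_neg (u := v - 2 * n) (by omega) (by omega) hn,
        perimeter_left_neg (u := v + 1 - 2 * n) (by omega) (by omega) hn,
        flagLabel_front ⟨h0, h1⟩ rfl]
      exact beltLabel_congr hn (by omega) (by omega) (by omega)
    rcases le_or_gt (v + 1) (4 * n) with h' | h'
    · rw [perimeter_right (u := v) (by omega) (by omega) hn,
        perimeter_right (u := v + 1) (by omega) (by omega) hn,
        perimeter_front (u := v - 2 * n) (by omega) (by omega) hn,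
        perimeter_front (u := v + 1 - 2 * n) (by omega) (by omega) hn,
        flagLabel_right ⟨h0, h1⟩ rfl (by omega)]
      exact beltLabel_congr hn (by omega) (by omega) (by omega)
    rcases le_or_gt (v + 1) (6 * n) with h'' | h''
    · rw [perimeter_back (u := v) (by omega) (by omega) hn,
        perimeter_back (u := v + 1) (by omega) (by omega) hn,
        perimeter_right (u := v - 2 * n) (by omega) (by omega) hn,
        perimeter_right (u := v + 1 - 2 * n) (by omega) (by omega) hn,
        flagLabel_back ⟨h0, h1⟩ rfl (by omega)]
      exact beltLabel_congr hn (by omega) (by omega) (by omega)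
    · rw [perimeter_left (u := v) (by omega) (by omega) hn,
        perimeter_left (u := v + 1) (by omega) (by omega) hn,
        perimeter_back (u := v - 2 * n) (by omega) (by omega) hn,
        perimeter_back (u := v + 1 - 2 * n) (by omega) (by omega) hn,
        flagLabel_left ⟨h0, h1⟩ rfl (by omega)]
      exact beltLabel_congr hn (by omega) (by omega) (by omega)

theorem prismLabel_upTop {n m : ℤ} (hn : 0 < n) (hm : 0 < m) (k r u : ℤ) :
    prismLabel n m k r (upTop n m u).1 (upTop n m u).2 = posLabel n k r u := by
  rw [upTop, upFlag, prismLabel_beltPoint hn k r (by omega) (by omega) (by omega) (Or.inl rfl),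
    beltLabel, if_pos rfl]
  congr 1
  omega

theorem prismLabel_downTop {n m : ℤ} (hn : 0 < n) (hm : 0 < m) (k r u : ℤ) :
    prismLabel n m k r (downTop n m u).1 (downTop n m u).2 = downLabel n k r u := by
  rw [downTop, downFlag, prismLabel_beltPoint hn k r (by omega) (by omega) (by omega) (Or.inr rfl),
    beltLabel, if_neg (by omega)]
  congr 1
  omega

/-- Flags of the four diagonals that join opposite corners of the top or the bottom. -/
def cornerFlag (n m : ℤ) : ℤ → (Fin 3 → ℤ) × (Fin 3 → ℤ)
  | 0 => topFlag m 1 1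
  | 1 => Prod.map (quarterTurn n) (quarterTurn n) (topFlag m 1 1)
  | 2 => Prod.map (upsideDown m) (upsideDown m) (topFlag m 1 1)
  | _ => Prod.map (upsideDown m) (upsideDown m)
      (Prod.map (quarterTurn n) (quarterTurn n) (topFlag m 1 1))

theorem prismLabel_cornerFlag {n m : ℤ} (hm : 0 < m) (k r : ℤ) {i : ℤ} (h0 : 0 ≤ i)
    (h1 : i < 4) :
    prismLabel n m k r (cornerFlag n m i).1 (cornerFlag n m i).2 = (-1, i) := by
  interval_cases i
  · simp [prismLabel, cornerFlag, topFlag, flagLabel, topLabel]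
  · simp [prismLabel, cornerFlag, topFlag, flagLabel, topLabel, quarterTurn]
  · simp [prismLabel, cornerFlag, topFlag, flagLabel, bottomLabel, upsideDown, hm.ne']
  · simp [prismLabel, cornerFlag, topFlag, flagLabel, bottomLabel, upsideDown, quarterTurn, hm.ne']

theorem topFlag_flip (m a b : ℤ) :
    2 • (topFlag m a b).1 - (topFlag m a b).2 = ![a - 1, b - 1, 2 * m] := by
  funext i
  fin_cases i <;> simp [topFlag] <;> ring

theorem topFlag_conn_cornerFlag {n m : ℕ} {a : ℤ} (ha : a % 2 = 1) (h0 : 0 < a)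
    (h1 : a < 2 * n) : FlagConn ![n, n, m] (topFlag m a a) (cornerFlag n m 0) := by
  obtain ⟨i, hi⟩ : ∃ i : ℕ, 2 * (i : ℤ) = a - 1 := ⟨((a - 1) / 2).toNat, by omega⟩
  have := topFlag_conn (n := n) (m := m) (a := 1) (b := 1) (by omega) (by omega) (by omega)
    (by omega) i (by omega) (by omega)
  rw [hi, add_sub_cancel] at this
  exact this.symm

theorem topFlag_conn_upTop {n m : ℕ} (hm : 0 < m) {a b : ℤ} (ha : a % 2 = 1) (hb : b % 2 = 1)
    (ha0 : 0 < a) (ha1 : a < 2 * n) (hb0 : 0 < b) (hb1 : b < 2 * n) (hab : a ≠ b) :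
    ∃ u, FlagConn ![n, n, m] (topFlag m a b) (upTop n m u) := by
  have key : ∀ a b : ℤ, a % 2 = 1 → b % 2 = 1 → 0 < b → b < a → a < 2 * n →
      ∃ u, FlagConn ![n, n, m] (topFlag m a b) (upTop n m u) := by
    intro a b ha hb h0 h1 h2
    obtain ⟨i, hi⟩ : ∃ i : ℕ, 2 * (i : ℤ) = b - 1 := ⟨((b - 1) / 2).toNat, by omega⟩
    have := topFlag_conn (n := n) (m := m) (a := a - b + 1) (b := 1) (by omega) (by omega)
      (by omega) (by omega) i (by omega) (by omega)
    rw [hi, add_sub_cancel, show a - b + 1 + (b - 1) = a by ring] at this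
    refine ⟨(a - b) / 2, this.symm.trans ?_⟩
    have h := upTop_conn_topFlag (n := n) hm (u := (a - b) / 2) (by omega) (by omega)
    rw [show 2 * ((a - b) / 2) = a - b by omega] at h
    exact h.symm
  rcases hab.lt_or_gt with h | h
  · obtain ⟨u, hu⟩ := key (2 * n - a) (2 * n - b) (by omega) (by omega) (by omega) (by omega)
      (by omega)
    refine ⟨u + n + n, (FlagConn.flip _ _).trans ?_⟩
    have := hu.quarterTurn.quarterTurn
    rw [quarterTurn_upTop (by omega), quarterTurn_upTop (by omega)] at this
    convert this using 1
    change (_, 2 • (topFlag m a b).1 - (topFlag m a b).2) = _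
    rw [topFlag_flip]
    simp [topFlag, quarterTurn]
    ring_nf
    simp
  · exact key a b ha hb hb0 h ha1

/-- Every diagonal contains one of these flags. -/
def IsRepresentative (n m r : ℤ) (y : (Fin 3 → ℤ) × (Fin 3 → ℤ)) : Prop :=
  (∃ u, y = upTop n m u) ∨ (r = 0 ∧ ∃ j, y = downTop n m (j * n)) ∨
    ∃ i, 0 ≤ i ∧ i < 4 ∧ y = cornerFlag n m i

theorem mul_ediv_lt {n y : ℤ} (hn : 0 < n) (h : y % n ≠ 0) :
    y / n * n < y ∧ y < (y / n + 1) * n := by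
  have h1 := Int.emod_add_mul_ediv y n
  have h2 := Int.emod_nonneg y hn.ne'
  have h3 := Int.emod_lt_of_pos y hn
  have h4 : 0 < y % n := lt_of_le_of_ne h2 h.symm
  constructor <;> nlinarith

theorem PrismParams.exists_representative_downTop {n m : ℕ} {k r : ℤ} (P : PrismParams n m k r)
    (y : ℤ) : ∃ z, IsRepresentative n m r z ∧ FlagConn ![n, n, m] (downTop n m y) z := by
  have hm : 0 < m := by exact_mod_cast P.m_pos
  have hn := P.n_pos
  by_cases hy : (y + m) % n = 0
  · by_cases hy' : y % n = 0
    · obtain ⟨j, rfl⟩ := Int.dvd_of_emod_eq_zero hy'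
      refine ⟨_, Or.inr (Or.inl ⟨?_, j, rfl⟩), by rw [mul_comm]; exact FlagConn.refl _⟩
      have h := P.eq
      have hr : (r : ℤ) % n = 0 := by
        rw [h, show (n : ℤ) * j + (k * n + r) = r + n * (j + k) by ring,
          Int.add_mul_emod_self_left] at hy
        exact hy
      rwa [Int.emod_eq_of_lt P.r_nonneg P.r_lt] at hr
    · obtain ⟨h0, h1⟩ := mul_ediv_lt hn hy'
      have h := upTop_conn_downTop (n := n) hm (j := y / n - 1) (u := 2 * (y / n) * n - y)
        (by linarith) (by linarith)
      rw [show 2 * (y / n - 1 + 1) * (n : ℤ) - (2 * (y / n) * n - y) = y by ring] at h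
      exact ⟨_, Or.inl ⟨_, rfl⟩, h.symm⟩
  · obtain ⟨h0, h1⟩ := mul_ediv_lt hn hy
    exact ⟨_, Or.inl ⟨_, rfl⟩, downTop_conn_upTop hm h0 h1⟩

theorem exists_perimeter_eq {n a b : ℤ} (hn : 0 < n)
    (h : ((a = 0 ∨ a = 2 * n) ∧ (b % 2 = 1 ∧ 0 < b ∧ b < 2 * n)) ∨
      ((b = 0 ∨ b = 2 * n) ∧ (a % 2 = 1 ∧ 0 < a ∧ a < 2 * n))) :
    ∃ u, u % 2 = 1 ∧ perimeter n u = a ∧ perimeter n (u - 2 * n) = b := by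
  rcases h with ⟨rfl | rfl, h⟩ | ⟨rfl | rfl, h⟩
  · refine ⟨8 * n - b, by omega, perimeter_left (by omega) (by omega) hn, ?_⟩
    rw [perimeter_back (by omega) (by omega) hn]
    ring
  · refine ⟨2 * n + b, by omega, perimeter_right (by omega) (by omega) hn, ?_⟩
    rw [perimeter_front (by omega) (by omega) hn]
    ring
  · exact ⟨a, by omega, perimeter_front (by omega) (by omega) hn,
      perimeter_left_neg (by omega) (by omega) hn⟩
  · refine ⟨6 * n - a, by omega, ?_, perimeter_right (by omega) (by omega) hn⟩
    rw [perimeter_back (by omega) (by omega) hn]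
    ring

theorem isCornerOf_iff_coord {c v : Fin 3 → ℤ} : IsCornerOf v c ↔
    (v 0 % 2 = 0 ∧ -1 ≤ v 0 - c 0 ∧ v 0 - c 0 ≤ 1) ∧
    (v 1 % 2 = 0 ∧ -1 ≤ v 1 - c 1 ∧ v 1 - c 1 ≤ 1) ∧
    (v 2 % 2 = 0 ∧ -1 ≤ v 2 - c 2 ∧ v 2 - c 2 ≤ 1) := by
  simp [IsCornerOf, Fin.forall_fin_succ, abs_le, Int.even_iff]

theorem vec3_ext {v w : Fin 3 → ℤ} (h0 : v 0 = w 0) (h1 : v 1 = w 1) (h2 : v 2 = w 2) :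
    v = w := by
  funext i
  fin_cases i
  exacts [h0, h1, h2]

theorem exists_belt_flag {n m : ℕ} (hn : 0 < n) {c v : Fin 3 → ℤ}
    (hc : ((c 0 = 0 ∨ c 0 = 2 * n) ∧ (c 1 % 2 = 1 ∧ 0 < c 1 ∧ c 1 < 2 * n)) ∨
      ((c 1 = 0 ∨ c 1 = 2 * n) ∧ (c 0 % 2 = 1 ∧ 0 < c 0 ∧ c 0 < 2 * n)))
    (hc2 : c 2 % 2 = 1) (hv : IsCornerOf v c) :
    ∃ u, u % 2 = 1 ∧ (FlagConn ![n, n, m] (c, v) (upFlag n u (c 2)) ∨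
      FlagConn ![n, n, m] (c, v) (downFlag n u (c 2))) := by
  have hn' : (0 : ℤ) < n := by omega
  obtain ⟨u, hu, ha, hb⟩ := exists_perimeter_eq hn' hc
  refine ⟨u, hu, ?_⟩
  rw [isCornerOf_iff_coord] at hv
  have hodd := perimeter_odd hn' hu ha hb rfl rfl rfl rfl
  have hcu : c = beltPoint n u (c 2) := vec3_ext ha.symm hb.symm rfl
  have hv' : v = beltPoint n (u + 1) (v 2) ∨ v = beltPoint n (u - 1) (v 2) := by
    obtain ⟨h0, h1, -⟩ := hv
    have : (v 0 = perimeter n (u + 1) ∧ v 1 = perimeter n (u + 1 - 2 * n)) ∨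
        (v 0 = perimeter n (u - 1) ∧ v 1 = perimeter n (u - 1 - 2 * n)) := by
      rcases hodd with h | h | h | h <;> omega
    rcases this with h | h
    · exact Or.inl (vec3_ext h.1 h.2 rfl)
    · exact Or.inr (vec3_ext h.1 h.2 rfl)
  have hv2 : v 2 = c 2 + 1 ∨ v 2 = c 2 - 1 := by omega
  rcases hv' with h | h
  · rcases hv2 with h2 | h2 <;> rw [h2] at h
    · left
      rw [upFlag, ← h, ← hcu]
      exact FlagConn.refl _
    · right
      rw [downFlag, ← h, ← hcu]
      exact FlagConn.refl _
  · rcases hv2 with h2 | h2 <;> rw [h2] at h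
    · right
      have := FlagConn.flip_beltPoint (L := ![n, n, m]) hn' hu
        (show c 2 + 1 + (c 2 - 1) = 2 * c 2 by ring)
      rw [← h, ← hcu] at this
      rwa [downFlag, ← hcu]
    · left
      have := FlagConn.flip_beltPoint (L := ![n, n, m]) hn' hu
        (show c 2 - 1 + (c 2 + 1) = 2 * c 2 by ring)
      rw [← h, ← hcu] at this
      rwa [upFlag, ← hcu]

/-- Every diagonal of the top goes up through a top edge or joins two corners. -/
theorem exists_top_flag {n m : ℕ} (hm : 0 < m) {c v : Fin 3 → ℤ}
    (h2 : c 2 = 2 * m) (h0 : c 0 % 2 = 1 ∧ 0 < c 0 ∧ c 0 < 2 * n)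
    (h1 : c 1 % 2 = 1 ∧ 0 < c 1 ∧ c 1 < 2 * n) (hv : IsCornerOf v c) :
    (∃ u, FlagConn ![n, n, m] (c, v) (upTop n m u)) ∨
      FlagConn ![n, n, m] (c, v) (cornerFlag n m 0) ∨
      FlagConn ![n, n, m] (c, v) (cornerFlag n m 1) := by
  rw [isCornerOf_iff_coord] at hv
  obtain ⟨hv0, hv1, hv2⟩ := hv
  have hn : (0 : ℤ) < n := by omega
  have key : FlagConn ![n, n, m] (c, v) (topFlag m (c 0) (c 1)) ∨
      FlagConn ![n, n, m] (c, v)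
        (Prod.map (quarterTurn n) (quarterTurn n) (topFlag m (c 1) (2 * n - c 0))) := by
    have hc : c = (topFlag m (c 0) (c 1)).1 := vec3_ext rfl rfl h2
    have hc' : c = quarterTurn n (topFlag m (c 1) (2 * n - c 0)).1 :=
      vec3_ext (by simp [quarterTurn, topFlag]) rfl h2
    have e0 : v 0 = c 0 + 1 ∨ v 0 = c 0 - 1 := by omega
    have e1 : v 1 = c 1 + 1 ∨ v 1 = c 1 - 1 := by omega
    have e2 : v 2 = 2 * m := by omega
    rcases e0 with e0 | e0 <;> rcases e1 with e1 | e1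
    · left
      rw [show (c, v) = topFlag m (c 0) (c 1) from Prod.ext hc (vec3_ext e0 e1 e2)]
      exact FlagConn.refl _
    · right
      refine (FlagConn.flip _ _).trans ?_
      rw [show (c, 2 • c - v) = Prod.map (quarterTurn n) (quarterTurn n)
        (topFlag m (c 1) (2 * n - c 0)) from Prod.ext hc' (vec3_ext ?_ ?_ ?_)]
      · exact FlagConn.refl _
      all_goals
        simp [quarterTurn, topFlag]
        omega
    · right
      rw [show (c, v) = Prod.map (quarterTurn n) (quarterTurn n)
        (topFlag m (c 1) (2 * n - c 0)) from Prod.ext hc' (vec3_ext ?_ ?_ ?_)]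
      · exact FlagConn.refl _
      all_goals
        simp [quarterTurn, topFlag]
        omega
    · left
      refine (FlagConn.flip _ _).trans ?_
      rw [show (c, 2 • c - v) = topFlag m (c 0) (c 1) from Prod.ext hc (vec3_ext ?_ ?_ ?_)]
      · exact FlagConn.refl _
      all_goals
        simp [topFlag]
        omega
  rcases key with h | h
  · by_cases hab : c 0 = c 1
    · rw [← hab] at h
      exact Or.inr (Or.inl (h.trans (topFlag_conn_cornerFlag h0.1 h0.2.1 h0.2.2)))
    · obtain ⟨u, hu⟩ := topFlag_conn_upTop (n := n) hm h0.1 h1.1 h0.2.1 h0.2.2 h1.2.1 h1.2.2 hab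
      exact Or.inl ⟨u, h.trans hu⟩
  · by_cases hab : c 1 = 2 * n - c 0
    · rw [← hab] at h
      exact Or.inr (Or.inr (h.trans (topFlag_conn_cornerFlag h1.1 h1.2.1 h1.2.2).quarterTurn))
    · obtain ⟨u, hu⟩ := topFlag_conn_upTop (n := n) (m := m) hm h1.1
        (show (2 * n - c 0) % 2 = 1 by omega) h1.2.1 h1.2.2 (by omega) (by omega) hab
      refine Or.inl ⟨u + n, h.trans ?_⟩
      rw [← quarterTurn_upTop hn]
      exact hu.quarterTurn

theorem PrismParams.exists_representative {n m : ℕ} {k r : ℤ} (P : PrismParams n m k r)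
    {c v : Fin 3 → ℤ} (hc : IsSurfaceSquare ![n, n, m] c) (hv : IsCornerOf v c) :
    ∃ y, IsRepresentative n m r y ∧ FlagConn ![n, n, m] (c, v) y := by
  have hm : 0 < m := by exact_mod_cast P.m_pos
  have hn : 0 < n := by exact_mod_cast P.n_pos
  rw [isSurfaceSquare_prism_iff] at hc
  have belt : (((c 0 = 0 ∨ c 0 = 2 * n) ∧ (c 1 % 2 = 1 ∧ 0 < c 1 ∧ c 1 < 2 * n)) ∨
      ((c 1 = 0 ∨ c 1 = 2 * n) ∧ (c 0 % 2 = 1 ∧ 0 < c 0 ∧ c 0 < 2 * n))) →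
      (c 2 % 2 = 1 ∧ 0 < c 2 ∧ c 2 < 2 * m) →
      ∃ y, IsRepresentative n m r y ∧ FlagConn ![n, n, m] (c, v) y := by
    intro hc hc2
    obtain ⟨u, hu, h | h⟩ := exists_belt_flag (m := m) hn hc hc2.1 hv
    · exact ⟨_, Or.inl ⟨_, rfl⟩, h.trans (upFlag_conn_upTop hn hu hc2.1 hc2.2.1 hc2.2.2
        (w := (u + 2 * m - c 2) / 2) (by omega))⟩
    · obtain ⟨y, hy, h'⟩ := P.exists_representative_downTop ((u - 2 * m + c 2) / 2)
      exact ⟨y, hy, h.trans (.trans (downFlag_conn_downTop hn hu hc2.1 hc2.2.1 hc2.2.2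
        (by omega)) h')⟩
  rcases hc with ⟨h0, h1, h2⟩ | ⟨h0, h1, h2⟩ | ⟨h2 | h2, h0, h1⟩
  · exact belt (Or.inl ⟨h0, h1⟩) h2
  · exact belt (Or.inr ⟨h0, h1⟩) h2
  · have hc' : upsideDown m (upsideDown m c) = c := by
      apply vec3_ext <;> simp [upsideDown]
    have hv' : upsideDown m (upsideDown m v) = v := by
      apply vec3_ext <;> simp [upsideDown]
    have hcv : (c, v) = Prod.map (upsideDown m) (upsideDown m)
        (upsideDown m c, upsideDown m v) := by
      rw [Prod.map_apply, hc', hv']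
    rw [hcv]
    rcases exists_top_flag hm (c := upsideDown m c) (v := upsideDown m v) (n := n)
      (by simp [upsideDown, h2]) h0 h1 (by
        rw [isCornerOf_iff_coord] at hv ⊢
        simp only [upsideDown, Matrix.cons_val]
        exact ⟨hv.1, hv.2.1, by omega⟩) with ⟨u, h⟩ | h | h
    · have := h.upsideDown
      rw [upsideDown_upTop] at this
      obtain ⟨y, hy, h'⟩ := P.exists_representative_downTop (u - m)
      exact ⟨y, hy, this.trans (.trans (downFlag_conn_downTop hn (by omega) (by omega) (by omega)
        (by omega) (by ring)) h')⟩
    · exact ⟨_, Or.inr (Or.inr ⟨2, by norm_num, by norm_num, rfl⟩), h.upsideDown⟩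
    · exact ⟨_, Or.inr (Or.inr ⟨3, by norm_num, by norm_num, rfl⟩), h.upsideDown⟩
  · rcases exists_top_flag hm h2 h0 h1 hv with ⟨u, h⟩ | h | h
    · exact ⟨_, Or.inl ⟨u, rfl⟩, h⟩
    · exact ⟨_, Or.inr (Or.inr ⟨0, by norm_num, by norm_num, rfl⟩), h⟩
    · exact ⟨_, Or.inr (Or.inr ⟨1, by norm_num, by norm_num, rfl⟩), h⟩

theorem PrismParams.upTop_conn_add_two_mul {n m : ℕ} {k r : ℤ} (P : PrismParams n m k r) {u : ℤ}
    (h : posModulus k r (u % n) = 2) : FlagConn ![n, n, m] (upTop n m u) (upTop n m (u + 2 * n)) := by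
  have hm : 0 < m := by exact_mod_cast P.m_pos
  have hn := P.n_pos
  have hr0 := P.r_nonneg
  have hrn := P.r_lt
  have he := P.eq
  unfold posModulus at h
  split_ifs at h with hx
  · omega
  have hu : u % n ≠ 0 := fun h => hx (Or.inl h)
  obtain ⟨h0, h1⟩ := mul_ediv_lt hn hu
  have hux := Int.emod_add_mul_ediv u n
  generalize u % n = x at *
  generalize u / n = q at *
  have h2 := upTop_conn_downTop (n := n) hm h0 h1
  have key : ∀ j i : ℤ, j * n < 2 * (q + 1) * n - u + m → 2 * (q + 1) * n - u + m < (j + 1) * n →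
      j - q = 1 + 2 * i → FlagConn ![n, n, m] (upTop n m u) (upTop n m (u + 2 * n)) := by
    intro j i h3 h4 h5
    have h6 := h2.trans (downTop_conn_upTop (n := n) hm h3 h4)
    rw [← upTop_add_mul n m (u + 2 * n) i]
    have h7 : 2 * (j + 1) * (n : ℤ) - (2 * (q + 1) * n - u) = u + 2 * n + i * (4 * n) := by
      rw [show j = q + 1 + 2 * i by omega]
      ring
    rwa [h7] at h6
  by_cases hxr : x < r
  · exact key (q + k + 2) ((k + 1) / 2) (by linarith) (by linarith) (by omega)
  · exact key (q + k + 1) (k / 2) (by linarith) (by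
      have : r < x := by omega
      linarith) (by omega)

theorem PrismParams.upTop_conn_of_label_eq {n m : ℕ} {k r : ℤ} (P : PrismParams n m k r)
    {u v : ℤ} (h : posLabel n k r u = posLabel n k r v) :
    FlagConn ![n, n, m] (upTop n m u) (upTop n m v) := by
  simp only [posLabel, Prod.mk.injEq] at h
  obtain ⟨hx, hq⟩ := h
  have hu := Int.emod_add_mul_ediv u n
  have hv := Int.emod_add_mul_ediv v n
  have key : ∀ w : ℤ, ∀ i, v = w + i * (4 * n) →
      FlagConn ![n, n, m] (upTop n m w) (upTop n m v) := by
    rintro w i h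
    rw [h, upTop_add_mul]
    exact FlagConn.refl _
  rw [← hx] at hq
  rcases posModulus_cases k r (u % n) with h | h
  · rw [h] at hq
    refine key u ((v / n - u / n) / 4) ?_
    have : (v / n : ℤ) = u / n + (v / n - u / n) / 4 * 4 := by omega
    linear_combination (n : ℤ) * this - hv + hu - hx
  · rw [h] at hq
    have h2 := P.upTop_conn_add_two_mul h
    rcases (show u / n % 4 = v / n % 4 ∨ (u / n + 2) % 4 = v / n % 4 by omega) with h4 | h4
    · refine key u ((v / n - u / n) / 4) ?_
      have : (v / n : ℤ) = u / n + (v / n - u / n) / 4 * 4 := by omega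
      linear_combination (n : ℤ) * this - hv + hu - hx
    · refine h2.trans (key _ ((v / n - u / n - 2) / 4) ?_)
      have : (v / n : ℤ) = u / n + 2 + (v / n - u / n - 2) / 4 * 4 := by omega
      linear_combination (n : ℤ) * this - hv + hu - hx

/-- The labels that occur on the prism. -/
noncomputable def labelFinset (n k r : ℤ) : Finset (ℤ × ℤ) :=
  Finset.Ioo 0 r ×ˢ Finset.Ico 0 (if k % 2 = 0 then 4 else 2) ∪
    Finset.Ioo r n ×ˢ Finset.Ico 0 (if k % 2 = 0 then 2 else 4) ∪
    {0, -1, if r = 0 then -2 else r} ×ˢ Finset.Ico 0 4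

theorem posLabel_nonneg {n : ℤ} (hn : 0 < n) (k r u : ℤ) :
    0 ≤ (posLabel n k r u).1 := Int.emod_nonneg _ hn.ne'

theorem posLabel_mem {n k r : ℤ} (hn : 0 < n) (u : ℤ) :
    posLabel n k r u ∈ labelFinset n k r := by
  have h0 := Int.emod_nonneg u hn.ne'
  have h1 := Int.emod_lt_of_pos u hn
  simp only [posLabel, posModulus, labelFinset, Finset.mem_union, Finset.mem_product,
    Finset.mem_Ioo, Finset.mem_Ico, Finset.mem_insert, Finset.mem_singleton]
  generalize u % n = x at *
  generalize u / n = q at *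
  split_ifs <;> omega

theorem downLabel_mem {n k r : ℤ} (hn : 0 < n) (u : ℤ) :
    downLabel n k r u ∈ labelFinset n k r := by
  rw [downLabel]
  split_ifs with h1 h2
  · simp only [labelFinset, if_pos h2, Finset.mem_union, Finset.mem_product,
      Finset.mem_Ico, Finset.mem_insert, Finset.mem_singleton]
    exact Or.inr ⟨by simp, by omega, by omega⟩
  · exact posLabel_mem hn _
  · exact posLabel_mem hn _

theorem PrismParams.label_mem {n m : ℕ} {k r : ℤ} (P : PrismParams n m k r) {c v : Fin 3 → ℤ}
    (hc : IsSurfaceSquare ![n, n, m] c) (hv : IsCornerOf v c) :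
    prismLabel n m k r c v ∈ labelFinset n k r := by
  obtain ⟨y, hy, h⟩ := P.exists_representative hc hv
  rw [P.prismLabel_eq_of_flagConn h]
  rcases hy with ⟨u, rfl⟩ | ⟨-, j, rfl⟩ | ⟨i, h0, h1, rfl⟩
  · rw [prismLabel_upTop P.n_pos P.m_pos]
    exact posLabel_mem P.n_pos u
  · rw [prismLabel_downTop P.n_pos P.m_pos]
    exact downLabel_mem P.n_pos _
  · rw [prismLabel_cornerFlag P.m_pos k r h0 h1]
    simp only [labelFinset, Finset.mem_union, Finset.mem_product,
      Finset.mem_Ico, Finset.mem_insert, Finset.mem_singleton]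
    right
    simp [h0, h1]

/-- Flags with the same label lie on the same diagonal. -/
theorem PrismParams.flagConn_of_label_eq {n m : ℕ} {k r : ℤ} (P : PrismParams n m k r)
    {c v d w : Fin 3 → ℤ} (hc : IsSurfaceSquare ![n, n, m] c) (hv : IsCornerOf v c)
    (hd : IsSurfaceSquare ![n, n, m] d) (hw : IsCornerOf w d)
    (h : prismLabel n m k r c v = prismLabel n m k r d w) :
    FlagConn ![n, n, m] (c, v) (d, w) := by
  have hn := P.n_pos
  obtain ⟨y, hy, hcy⟩ := P.exists_representative hc hv
  obtain ⟨z, hz, hdz⟩ := P.exists_representative hd hw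
  rw [P.prismLabel_eq_of_flagConn hcy, P.prismLabel_eq_of_flagConn hdz] at h
  refine hcy.trans (.trans ?_ hdz.symm)
  rcases hy with ⟨u, rfl⟩ | ⟨hr, j, rfl⟩ | ⟨i, h0, h1, rfl⟩ <;>
  rcases hz with ⟨u', rfl⟩ | ⟨hr', j', rfl⟩ | ⟨i', h0', h1', rfl⟩ <;>
  simp only [prismLabel_upTop P.n_pos P.m_pos, prismLabel_downTop P.n_pos P.m_pos,
    downLabel_mul hn, if_true, prismLabel_cornerFlag P.m_pos, *] at h
  · exact P.upTop_conn_of_label_eq h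
  · have := posLabel_nonneg hn k 0 u
    rw [h] at this
    simp at this
  · have := posLabel_nonneg hn k r u
    rw [h] at this
    simp at this
  · have := posLabel_nonneg hn k 0 u'
    rw [← h] at this
    simp at this
  · simp only [Prod.mk.injEq, true_and] at h
    rw [show j' * (n : ℤ) = j * n + (j' - j) / 4 * (4 * n) by
      have : j' = j + (j' - j) / 4 * 4 := by omega
      linear_combination (n : ℤ) * this, downTop_add_mul]
    exact FlagConn.refl _
  · simp at h
  · have := posLabel_nonneg hn k r u'
    rw [← h] at this
    simp at this
  · simp at h
  · simp only [Prod.mk.injEq, true_and] at h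
    rw [h]
    exact FlagConn.refl _

/-- A diagonal only visits lattice points of one parity. -/
def vertexParity (v : Fin 3 → ℤ) : ℤ := (v 0 + v 1 + v 2) / 2 % 2

theorem FlagConn.vertexParity_eq {n m : ℕ} {c v d w : Fin 3 → ℤ}
    (h : FlagConn ![n, n, m] (c, v) (d, w)) (hc : IsSurfaceSquare ![n, n, m] c)
    (hv : IsCornerOf v c) : vertexParity v = vertexParity w := by
  have key : ∀ y : (Fin 3 → ℤ) × (Fin 3 → ℤ), FlagConn ![n, n, m] (c, v) y →
      IsSurfaceSquare ![n, n, m] y.1 ∧ IsCornerOf y.2 y.1 ∧ vertexParity v = vertexParity y.2 := by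
    intro y h
    induction h with
    | refl => exact ⟨hc, hv, rfl⟩
    | @tail y z _ hyz ih =>
      obtain ⟨h1, h2, h3⟩ := ih
      rcases hyz with ⟨h4, h5⟩ | ⟨h4, h5, h6, h7⟩
      · rw [h4, h5]
        refine ⟨h1, ?_, ?_⟩
        · rw [isCornerOf_iff_coord] at h2 ⊢
          simp only [Pi.sub_apply, Pi.smul_apply]
          simp only [nsmul_eq_mul, Nat.cast_ofNat]
          exact ⟨by omega, by omega, by omega⟩
        · have h8 := h1.coord.2.2.2
          rw [isCornerOf_iff_coord] at h2
          rw [h3]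
          simp only [vertexParity, Pi.sub_apply, Pi.smul_apply]
          simp only [nsmul_eq_mul, Nat.cast_ofNat]
          omega
      · rw [h4]
        exact ⟨h6, ((h7 _).2 rfl).2, h3⟩
  exact (key _ h).2.2

theorem exists_corner_vertexParity {n m : ℕ} {c : Fin 3 → ℤ} (hc : IsSurfaceSquare ![n, n, m] c)
    {p : ℤ} (hp : p = 0 ∨ p = 1) : ∃ v, IsCornerOf v c ∧ vertexParity v = p := by
  have key : ∀ a b d a' b' d' : ℤ, IsCornerOf ![a, b, d] c → IsCornerOf ![a', b', d'] c →
      (a' + b' + d') = a + b + d + 2 → ∃ v, IsCornerOf v c ∧ vertexParity v = p := by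
    intro a b d a' b' d' h1 h2 h3
    by_cases h : vertexParity ![a, b, d] = p
    · exact ⟨_, h1, h⟩
    · refine ⟨_, h2, ?_⟩
      rw [isCornerOf_iff_coord] at h1 h2
      simp only [vertexParity, Matrix.cons_val] at h h1 h2 ⊢
      omega
  rw [isSurfaceSquare_prism_iff] at hc
  rcases hc with hc | hc | hc
  · refine key (c 0) (c 1 + 1) (c 2 - 1) (c 0) (c 1 + 1) (c 2 + 1) ?_ ?_ (by ring)
    all_goals
      rw [isCornerOf_iff_coord]
      simp only [Matrix.cons_val]
      omega
  · refine key (c 0 + 1) (c 1) (c 2 - 1) (c 0 + 1) (c 1) (c 2 + 1) ?_ ?_ (by ring)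
    all_goals
      rw [isCornerOf_iff_coord]
      simp only [Matrix.cons_val]
      omega
  · refine key (c 0 + 1) (c 1 - 1) (c 2) (c 0 + 1) (c 1 + 1) (c 2) ?_ ?_ (by ring)
    all_goals
      rw [isCornerOf_iff_coord]
      simp only [Matrix.cons_val]
      omega

theorem PrismParams.eq_of_label_eq {n m : ℕ} {k r : ℤ} (P : PrismParams n m k r)
    {s : Finset (SurfaceSquare ![n, n, m])} (hs : (prismBishopGraph n m).IsIndepSet s)
    {a b : SurfaceSquare ![n, n, m]} (ha : a ∈ s) (hb : b ∈ s) {v w : Fin 3 → ℤ}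
    (hv : IsCornerOf v a.1) (hw : IsCornerOf w b.1)
    (h : prismLabel n m k r a.1 v = prismLabel n m k r b.1 w) :
    a = b ∧ vertexParity v = vertexParity w := by
  have hconn := P.flagConn_of_label_eq a.2 hv b.2 hw h
  refine ⟨?_, hconn.vertexParity_eq a.2 hv⟩
  by_contra hab
  exact hs ha hb hab ⟨hab, hconn.onCommonDiagonal⟩

/-- Every square of an independent set uses up two of the diagonals. -/
theorem PrismParams.two_mul_indepNum_le {n m : ℕ} {k r : ℤ} (P : PrismParams n m k r) :
    2 * (prismBishopGraph n m).indepNum ≤ (labelFinset n k r).card := by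
  obtain ⟨s, hs⟩ := (prismBishopGraph n m).exists_isNIndepSet_indepNum
  have hex : ∀ (a : SurfaceSquare ![n, n, m]) (p : Bool), ∃ v, IsCornerOf v a.1 ∧
      vertexParity v = if p then 1 else 0 := fun a p =>
    exists_corner_vertexParity a.2 (by cases p <;> simp)
  choose f hf hp using hex
  have hcard : 2 * s.card = (s ×ˢ (Finset.univ : Finset Bool)).card := by
    rw [Finset.card_product, Finset.card_univ, Fintype.card_bool, mul_comm]
  rw [← hs.card_eq, hcard]
  refine Finset.card_le_card_of_injOn (fun x => prismLabel n m k r x.1.1 (f x.1 x.2)) ?_ ?_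
  · intro x _
    exact P.label_mem x.1.2 (hf _ _)
  · rintro ⟨a, p⟩ hx ⟨b, q⟩ hy h
    rw [Finset.mem_coe, Finset.mem_product] at hx hy
    obtain ⟨h1, h2⟩ := P.eq_of_label_eq hs.isIndepSet hx.1 hy.1 (hf _ _) (hf _ _) h
    rw [hp, hp] at h2
    refine Prod.ext h1 ?_
    cases p <;> cases q <;> simp at h2 ⊢

theorem perimeter_sum {n : ℤ} (hn : 0 < n) {u : ℤ} (hu : u % 2 = 0) :
    (perimeter n u + perimeter n (u - 2 * n) - u) % 4 = 0 := by
  refine perimeter_induction hn u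
    (p := fun u => (perimeter n u + perimeter n (u - 2 * n) - u) % 4 = 0)
    (fun v i hv => ?_) (fun v hv h0 h1 => ?_)
  · rw [show v + i * (8 * n) - 2 * n = v - 2 * n + i * (8 * n) by ring, perimeter_add_mul,
      perimeter_add_mul, show i * (8 * n) = 4 * (i * (2 * n)) by ring]
    omega
  · rcases le_or_gt v (2 * n) with h | h
    · rw [perimeter_front (u := v) (by omega) (by omega) hn,
        perimeter_left_neg (u := v - 2 * n) (by omega) (by omega) hn]
      omega
    rcases le_or_gt v (4 * n) with h | h
    · rw [perimeter_right (u := v) (by omega) (by omega) hn,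
        perimeter_front (u := v - 2 * n) (by omega) (by omega) hn]
      omega
    rcases le_or_gt v (6 * n) with h | h
    · rw [perimeter_back (u := v) (by omega) (by omega) hn,
        perimeter_right (u := v - 2 * n) (by omega) (by omega) hn]
      omega
    · rw [perimeter_left (u := v) (by omega) (by omega) hn,
        perimeter_back (u := v - 2 * n) (by omega) (by omega) hn]
      omega

/-- If all sides are even, the diagonals through the odd lattice points avoid the corners. -/
theorem PrismParams.exists_odd_upTop {n m : ℕ} {k r : ℤ} (P : PrismParams n m k r)
    (hn : n % 2 = 0) (hm : m % 2 = 0) {c v : Fin 3 → ℤ} (hc : IsSurfaceSquare ![n, n, m] c)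
    (hv : IsCornerOf v c) (hp : vertexParity v = 1) :
    ∃ u, u % 2 = 1 ∧ prismLabel n m k r c v = posLabel n k r u := by
  obtain ⟨y, hy, h⟩ := P.exists_representative hc hv
  rw [P.prismLabel_eq_of_flagConn h]
  have h' : vertexParity v = vertexParity y.2 := FlagConn.vertexParity_eq h hc hv
  rw [hp] at h'
  rcases hy with ⟨u, rfl⟩ | ⟨-, j, rfl⟩ | ⟨i, h0, h1, rfl⟩
  · refine ⟨u, ?_, prismLabel_upTop P.n_pos P.m_pos _ _ _⟩
    have := perimeter_sum P.n_pos (u := 2 * u - 1 + 1) (by omega)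
    simp only [upTop, upFlag, vertexParity, beltPoint, Matrix.cons_val] at h'
    omega
  · exfalso
    have := perimeter_sum P.n_pos (u := 2 * (j * (n : ℤ)) + 1 + 1) (by omega)
    simp only [downTop, downFlag, vertexParity, beltPoint, Matrix.cons_val] at h'
    have hj : j * (n : ℤ) % 2 = 0 := by
      rw [Int.mul_emod, show (n : ℤ) % 2 = 0 by omega]
      simp
    omega
  · exfalso
    interval_cases i <;>
      simp [cornerFlag, topFlag, vertexParity, upsideDown, quarterTurn] at h' <;> omega

theorem PrismParams.indepNum_le_of_even {n m : ℕ} {k r : ℤ} (P : PrismParams n m k r)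
    (hn : n % 2 = 0) (hm : m % 2 = 0) (hr : r % 2 = 0) :
    (prismBishopGraph n m).indepNum ≤
      (Finset.Ico 0 (r / 2) ×ˢ Finset.Ico 0 (if k % 2 = 0 then 4 else 2) ∪
        Finset.Ico (r / 2) (n / 2 : ℤ) ×ˢ Finset.Ico 0 (if k % 2 = 0 then 2 else 4) :
        Finset (ℤ × ℤ)).card := by
  obtain ⟨s, hs⟩ := (prismBishopGraph n m).exists_isNIndepSet_indepNum
  have hn' := P.n_pos
  choose f hf hp using fun a : SurfaceSquare ![n, n, m] =>
    exists_corner_vertexParity a.2 (Or.inr rfl)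
  have hlab : ∀ a, (prismLabel n m k r a.1 (f a)).1 % 2 = 1 ∧
      ((prismLabel n m k r a.1 (f a)).1 / 2, (prismLabel n m k r a.1 (f a)).2) ∈
      (Finset.Ico 0 (r / 2) ×ˢ Finset.Ico 0 (if k % 2 = 0 then 4 else 2) ∪
        Finset.Ico (r / 2) (n / 2 : ℤ) ×ˢ Finset.Ico 0 (if k % 2 = 0 then 2 else 4) :
        Finset (ℤ × ℤ)) := by
    intro a
    obtain ⟨u, hu, h⟩ := P.exists_odd_upTop hn hm a.2 (hf a) (hp a)
    rw [h]
    have h0 := Int.emod_nonneg u hn'.ne'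
    have h1 := Int.emod_lt_of_pos u hn'
    have h2 : u % n % 2 = 1 := by
      rw [Int.emod_emod_of_dvd u (by omega), hu]
    simp only [posLabel, posModulus, Finset.mem_union, Finset.mem_product, Finset.mem_Ico]
    generalize u % n = x at *
    generalize u / n = q at *
    refine ⟨h2, ?_⟩
    split_ifs <;> omega
  rw [← hs.card_eq]
  refine Finset.card_le_card_of_injOn (fun a => ((prismLabel n m k r a.1 (f a)).1 / 2,
    (prismLabel n m k r a.1 (f a)).2)) (fun a _ => (hlab a).2) ?_
  intro a ha b hb h
  simp only [Prod.mk.injEq] at h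
  refine (P.eq_of_label_eq hs.isIndepSet ha hb (hf a) (hf b) (Prod.ext ?_ h.2)).1
  have := (hlab a).1
  have := (hlab b).1
  omega

/-- There is a square through which the diagonals labelled `a` and `b` pass. -/
def LabelsMeet (n m : ℕ) (k r : ℤ) (a b : ℤ × ℤ) : Prop :=
  ∃ c, IsSurfaceSquare ![n, n, m] c ∧
    ∀ v, IsCornerOf v c → prismLabel n m k r c v = a ∨ prismLabel n m k r c v = b

/-- Squares at the crossings of disjoint pairs of diagonals are independent. -/
theorem PrismParams.card_le_indepNum {n m : ℕ} {k r : ℤ} (P : PrismParams n m k r)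
    (I : Finset (ℤ × ℤ)) (idx : ℤ × ℤ → ℤ × ℤ)
    (h : ∀ i ∈ I, ∃ a b, LabelsMeet n m k r a b ∧ idx a = i ∧ idx b = i) :
    I.card ≤ (prismBishopGraph n m).indepNum := by
  classical
  have h' : ∀ i ∈ I, ∃ c : SurfaceSquare ![n, n, m],
      ∀ v, IsCornerOf v c.1 → idx (prismLabel n m k r c.1 v) = i := by
    intro i hi
    obtain ⟨a, b, ⟨c, hc, hv⟩, ha, hb⟩ := h i hi
    refine ⟨⟨c, hc⟩, fun v hvc => ?_⟩
    rcases hv v hvc with h | h <;> rw [h] <;> assumption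
  have hn := P.n_pos
  have : Nonempty (SurfaceSquare ![n, n, m]) := ⟨⟨![1, 1, 0], by
    rw [isSurfaceSquare_prism_iff]
    refine Or.inr (Or.inr ⟨Or.inl rfl, ?_, ?_⟩) <;>
    · change (1 : ℤ) % 2 = 1 ∧ (0 : ℤ) < 1 ∧ (1 : ℤ) < 2 * n
      omega⟩⟩
  choose! f hf using h'
  have hinj : Set.InjOn f I := by
    intro i hi j hj hij
    obtain ⟨v, hv, -⟩ := exists_corner_vertexParity (f i).2 (Or.inl rfl)
    rw [← hf i hi v hv, ← hf j hj v (hij ▸ hv), hij]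
  rw [← Finset.card_image_of_injOn hinj]
  refine SimpleGraph.IsIndepSet.card_le_indepNum ?_
  intro a ha b hb hab hadj
  simp only [Finset.coe_image, Set.mem_image, Finset.mem_coe] at ha hb
  obtain ⟨i, hi, rfl⟩ := ha
  obtain ⟨j, hj, rfl⟩ := hb
  obtain ⟨v, w, hv, hw, hvw⟩ := P.exists_label_eq hadj.2 hab
  have := hf i hi v hv
  rw [hvw, hf j hj w hw] at this
  exact hab (by rw [this])

theorem LabelsMeet.symm {n m : ℕ} {k r : ℤ} {a b : ℤ × ℤ} (h : LabelsMeet n m k r a b) :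
    LabelsMeet n m k r b a := by
  obtain ⟨c, hc, h⟩ := h
  exact ⟨c, hc, fun v hv => (h v hv).symm⟩

theorem labelsMeet_top {n m : ℕ} {k r a b : ℤ} (ha : a % 2 = 1 ∧ 0 < a ∧ a < 2 * n)
    (hb : b % 2 = 1 ∧ 0 < b ∧ b < 2 * n) {p q : ℤ × ℤ} (hp : topLabel n k r a b True = p)
    (hq : topLabel n k r a b False = q) : LabelsMeet n m k r p q := by
  refine ⟨![a, b, 2 * m], ?_, fun v hv => ?_⟩
  · rw [isSurfaceSquare_prism_iff]
    exact Or.inr (Or.inr ⟨Or.inr rfl, ha, hb⟩)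
  · simp only [prismLabel, Matrix.cons_val]
    rw [flagLabel_top rfl]
    by_cases h : v 0 - a = v 1 - b
    · left
      simpa [topLabel, h] using hp
    · right
      simpa [topLabel, h] using hq

theorem labelsMeet_bottom {n m : ℕ} {k r a b : ℤ} (hm : 0 < m)
    (ha : a % 2 = 1 ∧ 0 < a ∧ a < 2 * n)
    (hb : b % 2 = 1 ∧ 0 < b ∧ b < 2 * n) {p q : ℤ × ℤ} (hp : bottomLabel n m k r a b True = p)
    (hq : bottomLabel n m k r a b False = q) : LabelsMeet n m k r p q := by
  refine ⟨![a, b, 0], ?_, fun v hv => ?_⟩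
  · rw [isSurfaceSquare_prism_iff]
    exact Or.inr (Or.inr ⟨Or.inl rfl, ha, hb⟩)
  · simp only [prismLabel, Matrix.cons_val]
    rw [flagLabel_bottom (by omega) rfl]
    by_cases h : v 0 - a = v 1 - b
    · left
      simpa [bottomLabel, h] using hp
    · right
      simpa [bottomLabel, h] using hq

theorem labelsMeet_belt {n m : ℕ} {k r u y : ℤ} (hn : 0 < n) (hodd : (u - y) % 2 = 1)
    (h0 : 0 < u - y) (h1 : u - y < 2 * m) :
    LabelsMeet n m k r (posLabel n k r u) (downLabel n k r y) := by
  have hn' : (0 : ℤ) < n := by omega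
  have hu : (u + y) % 2 = 1 := by omega
  refine ⟨beltPoint n (u + y) (2 * m - (u - y)), ?_, fun v hv => ?_⟩
  · exact isSurfaceSquare_beltPoint hn hu (by omega) (by omega) (by omega)
  · have key : ∀ g, g = 2 * m - (u - y) + 1 ∨ g = 2 * m - (u - y) - 1 →
        prismLabel n m k r (beltPoint n (u + y) (2 * m - (u - y))) (beltPoint n (u + y + 1) g) =
          posLabel n k r u ∨
        prismLabel n m k r (beltPoint n (u + y) (2 * m - (u - y))) (beltPoint n (u + y + 1) g) =
          downLabel n k r y := by
      intro g hg
      rw [prismLabel_beltPoint hn' k r hu (by omega) (by omega) hg, beltLabel]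
      split_ifs
      · left; congr 1; omega
      · right; congr 1; omega
    have hodd := perimeter_odd hn' hu rfl rfl rfl rfl rfl rfl
    rw [isCornerOf_iff_coord] at hv
    simp only [beltPoint, Matrix.cons_val] at hv
    obtain ⟨hv0, hv1, hv2⟩ := hv
    have hv' : (v 0 = perimeter n (u + y + 1) ∧ v 1 = perimeter n (u + y + 1 - 2 * n)) ∨
        (v 0 = perimeter n (u + y - 1) ∧ v 1 = perimeter n (u + y - 1 - 2 * n)) := by
      rcases hodd with h | h | h | h <;> omega
    rcases hv' with h | h
    · rw [show v = beltPoint n (u + y + 1) (v 2) from vec3_ext h.1 h.2 rfl]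
      exact key _ (by omega)
    · rw [show v = beltPoint n (u + y - 1) (v 2) from vec3_ext h.1 h.2 rfl, ← prismLabel_flip,
        beltPoint_reflect hn' hu (g' := 2 * (2 * m - (u - y)) - v 2) (by ring)]
      exact key _ (by omega)

theorem labelsMeet_top_next {n m : ℕ} {k r x x' : ℤ} (hn : 0 < n) (h0 : 0 < x) (h0' : 0 < x')
    (h1 : x + x' < n) (hodd : (n + x + x') % 2 = 1) (j : ℤ) :
    LabelsMeet n m k r (posLabel n k r (j * n + x)) (posLabel n k r ((j + 1) * n + x')) := by
  have hn' : (0 : ℤ) < n := by omega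
  obtain ⟨i, rfl | rfl | rfl | rfl⟩ :
      ∃ i, j = 4 * i ∨ j = 4 * i + 1 ∨ j = 4 * i + 2 ∨ j = 4 * i + 3 := ⟨j / 4, by omega⟩
  · rw [show 4 * i * n + x = x + i * (4 * n) by ring,
      show (4 * i + 1) * n + x' = n + x' + i * (4 * n) by ring, posLabel_add_mul hn',
      posLabel_add_mul hn']
    refine labelsMeet_top (a := n + x' + x) (b := n + x' - x) (by omega) (by omega) ?_ ?_
    all_goals
      simp only [topLabel, if_true, if_false]
      split_ifs <;> first | (exfalso; omega) | exact posLabel_congr hn' (by omega)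
  · rw [show (4 * i + 1) * n + x = n + x + i * (4 * n) by ring,
      show (4 * i + 1 + 1) * n + x' = 2 * n + x' + i * (4 * n) by ring, posLabel_add_mul hn',
      posLabel_add_mul hn']
    refine (labelsMeet_top (a := n + x - x') (b := n + x + x') (by omega) (by omega) ?_ ?_).symm
    all_goals
      simp only [topLabel, if_true, if_false]
      split_ifs <;> first | (exfalso; omega) | exact posLabel_congr hn' (by omega)
  · rw [show (4 * i + 2) * n + x = 2 * n + x + i * (4 * n) by ring,
      show (4 * i + 2 + 1) * n + x' = 3 * n + x' + i * (4 * n) by ring, posLabel_add_mul hn',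
      posLabel_add_mul hn']
    refine labelsMeet_top (a := n - x' - x) (b := n - x' + x) (by omega) (by omega) ?_ ?_
    all_goals
      simp only [topLabel, if_true, if_false]
      split_ifs <;> first | (exfalso; omega) | exact posLabel_congr hn' (by omega)
  · rw [show (4 * i + 3) * n + x = 3 * n + x + i * (4 * n) by ring,
      show (4 * i + 3 + 1) * n + x' = x' + (i + 1) * (4 * n) by ring, posLabel_add_mul hn',
      posLabel_add_mul hn']
    refine (labelsMeet_top (a := n - x + x') (b := n - x - x') (by omega) (by omega) ?_ ?_).symm
    all_goals
      simp only [topLabel, if_true, if_false]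
      split_ifs <;> first | (exfalso; omega) | exact posLabel_congr hn' (by omega)

theorem labelsMeet_bottom_next {n m : ℕ} {k r x x' : ℤ} (hn : 0 < n) (hm : 0 < m) (h0 : 0 < x)
    (h0' : 0 < x') (h1 : x + x' < n) (hodd : (n + x + x') % 2 = 1) (j : ℤ) :
    LabelsMeet n m k r (posLabel n k r (m + j * n - x)) (posLabel n k r (m + (j + 1) * n - x')) := by
  have hn' : (0 : ℤ) < n := by omega
  obtain ⟨i, rfl | rfl | rfl | rfl⟩ :
      ∃ i, j = 4 * i ∨ j = 4 * i + 1 ∨ j = 4 * i + 2 ∨ j = 4 * i + 3 := ⟨j / 4, by omega⟩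
  · rw [show m + 4 * i * n - x = m - x + i * (4 * n) by ring,
      show m + (4 * i + 1) * n - x' = m + n - x' + i * (4 * n) by ring, posLabel_add_mul hn',
      posLabel_add_mul hn']
    refine labelsMeet_bottom (a := n - x' - x) (b := n - x' + x) hm (by omega) (by omega) ?_ ?_
    all_goals
      simp only [bottomLabel, if_true, if_false]
      split_ifs <;> first | (exfalso; omega) | exact posLabel_congr hn' (by omega)
  · rw [show m + (4 * i + 1) * n - x = m + n - x + i * (4 * n) by ring,
      show m + (4 * i + 1 + 1) * n - x' = m + 2 * n - x' + i * (4 * n) by ring,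
      posLabel_add_mul hn', posLabel_add_mul hn']
    refine (labelsMeet_bottom (a := n - x + x') (b := n - x - x') hm (by omega) (by omega)
      ?_ ?_).symm
    all_goals
      simp only [bottomLabel, if_true, if_false]
      split_ifs <;> first | (exfalso; omega) | exact posLabel_congr hn' (by omega)
  · rw [show m + (4 * i + 2) * n - x = m + 2 * n - x + i * (4 * n) by ring,
      show m + (4 * i + 2 + 1) * n - x' = m + 3 * n - x' + i * (4 * n) by ring,
      posLabel_add_mul hn', posLabel_add_mul hn']
    refine labelsMeet_bottom (a := n + x' + x) (b := n + x' - x) hm (by omega) (by omega) ?_ ?_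
    all_goals
      simp only [bottomLabel, if_true, if_false]
      split_ifs <;> first | (exfalso; omega) | exact posLabel_congr hn' (by omega)
  · rw [show m + (4 * i + 3) * n - x = m + 3 * n - x + i * (4 * n) by ring,
      show m + (4 * i + 3 + 1) * n - x' = m - x' + (i + 1) * (4 * n) by ring,
      posLabel_add_mul hn', posLabel_add_mul hn']
    refine (labelsMeet_bottom (a := n + x - x') (b := n + x + x') hm (by omega) (by omega)
      ?_ ?_).symm
    all_goals
      simp only [bottomLabel, if_true, if_false]
      split_ifs <;> first | (exfalso; omega) | exact posLabel_congr hn' (by omega)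

theorem PrismParams.k_nonneg {n m k r : ℤ} (P : PrismParams n m k r) : 0 ≤ k := by
  obtain ⟨hn, hm, he, hr0, hrn⟩ := P
  by_contra h
  nlinarith

theorem PrismParams.le_of_k_pos {n m k r : ℤ} (P : PrismParams n m k r) (hk : 0 < k) : n ≤ m := by
  obtain ⟨hn, hm, he, hr0, hrn⟩ := P
  nlinarith

/-- Diagonals that go up through neighbouring top edges meet if their parities differ. -/
theorem PrismParams.labelsMeet_next {n m : ℕ} {k r : ℤ} (P : PrismParams n m k r) {x x' : ℤ}
    (h0 : 0 < x) (h0' : 0 < x') (h1 : x < n) (h1' : x' < n) (hodd : (n + x + x') % 2 = 1) (j : ℤ) :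
    LabelsMeet n m k r (posLabel n k r (j * n + x)) (posLabel n k r ((j + 1) * n + x')) := by
  have hn : 0 < n := by exact_mod_cast P.n_pos
  have hm : 0 < m := by exact_mod_cast P.m_pos
  rcases lt_or_ge (x + x') n with h | h
  · exact labelsMeet_top_next hn h0 h0' h hodd j
  rcases lt_or_ge (x + x') (n + 2 * m) with h' | h'
  · have := labelsMeet_belt (n := n) (m := m) (k := k) (r := r) (u := (j + 1) * n + x')
      (y := (j + 2) * n - x) hn (by ring_nf; omega) (by linarith [show (n : ℤ) < x + x' by omega])
      (by linarith)
    rw [downLabel_of_lt (j := j + 1) (z := j * n + x) (by linarith) (by linarith) (by ring)] at this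
    exact this.symm
  · have hk : k = 0 := by
      by_contra hk
      have := P.le_of_k_pos (lt_of_le_of_ne P.k_nonneg (Ne.symm hk))
      omega
    have he := P.eq
    have hr0 := P.r_nonneg
    have := P.r_lt
    rw [hk, zero_mul, zero_add] at he
    have := labelsMeet_bottom_next (n := n) (m := m) (k := k) (r := r) (x := n + r - x)
      (x' := n + r - x') hn hm (by omega) (by omega) (by omega) (by omega) (j + 1)
    rw [he] at this
    convert this using 2 <;> ring

/-- Diagonals that go up through opposite top edges meet on the belt if it is high enough. -/
theorem PrismParams.labelsMeet_opposite {n m : ℕ} {k r : ℤ} (P : PrismParams n m k r) {x x' : ℤ}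
    (h0 : 0 < x) (h0' : 0 < x') (h1 : x' < n) (h2 : x + x' < 2 * m) (hodd : (x + x') % 2 = 1)
    (j : ℤ) :
    LabelsMeet n m k r (posLabel n k r (j * n + x)) (posLabel n k r ((j - 2) * n + x')) := by
  have hn : 0 < n := by exact_mod_cast P.n_pos
  have := labelsMeet_belt (n := n) (m := m) (k := k) (r := r) (u := j * n + x)
    (y := j * n - x') hn (by ring_nf; omega) (by linarith) (by linarith)
  rwa [downLabel_of_lt (j := j - 1) (z := (j - 2) * n + x') (by linarith) (by linarith)
    (by ring)] at this

theorem labelsMeet_top_corner {n m : ℕ} (k r : ℤ) (hn : n % 2 = 1) :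
    LabelsMeet n m k r (-1, 0) (-1, 1) := by
  refine labelsMeet_top (a := n) (b := n) (by omega) (by omega) ?_ ?_
  · simp [topLabel]
  · simp [topLabel, two_mul]

theorem labelsMeet_bottom_corner {n m : ℕ} (k r : ℤ) (hm : 0 < m) (hn : n % 2 = 1) :
    LabelsMeet n m k r (-1, 2) (-1, 3) := by
  refine labelsMeet_bottom (a := n) (b := n) hm (by omega) (by omega) ?_ ?_
  · simp [bottomLabel]
  · simp [bottomLabel, two_mul]

theorem posModulus_zero (k r : ℤ) : posModulus k r 0 = 4 := if_pos (Or.inl rfl)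

theorem posModulus_self (k r : ℤ) : posModulus k r r = 4 := if_pos (Or.inr (Or.inl rfl))

theorem posModulus_of_lt {k r x : ℤ} (h0 : 0 < x) (h1 : x < r) :
    posModulus k r x = if k % 2 = 0 then 4 else 2 := by
  unfold posModulus
  split_ifs <;> first | rfl | omega

theorem posModulus_of_gt {k r x : ℤ} (h0 : 0 ≤ r) (h1 : r < x) :
    posModulus k r x = if k % 2 = 0 then 2 else 4 := by
  unfold posModulus
  split_ifs <;> first | rfl | omega

theorem posLabel_mul {n k r : ℤ} (hn : 0 < n) (q : ℤ) : posLabel n k r (q * n) = (0, q % 4) := by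
  have := posLabel_mul_add (n := n) (k := k) (r := r) (q := q) le_rfl hn
  rwa [add_zero, posModulus_zero] at this

theorem card_Ioo_product (a b c : ℤ) :
    (Finset.Ioo a b ×ˢ Finset.Ico 0 c).card = (b - a - 1).toNat * c.toNat := by
  rw [Finset.card_product, Int.card_Ioo, Int.card_Ico, sub_zero]

theorem card_Ico_product (a b c : ℤ) :
    (Finset.Ico a b ×ˢ Finset.Ico 0 c).card = (b - a).toNat * c.toNat := by
  rw [Finset.card_product, Int.card_Ico, Int.card_Ico, sub_zero]

theorem card_labelFinset_le (n k r : ℤ) : (labelFinset n k r).card ≤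
    (r - 1).toNat * (if k % 2 = 0 then 4 else 2) +
      (n - r - 1).toNat * (if k % 2 = 0 then 2 else 4) + 12 := by
  unfold labelFinset
  refine (Finset.card_union_le _ _).trans (Nat.add_le_add ?_ ?_)
  · refine (Finset.card_union_le _ _).trans ?_
    rw [card_Ioo_product, card_Ioo_product]
    split_ifs <;> simp
  · rw [Finset.card_product, Int.card_Ico]
    exact Nat.mul_le_mul_right 4 Finset.card_le_three

/-- The number of diagonals, halved. -/
theorem PrismParams.indepNum_le {n m : ℕ} {k r : ℤ} (P : PrismParams n m k r) :
    ((prismBishopGraph n m).indepNum : ℤ) ≤ 6 + max (r - 1) 0 * (if k % 2 = 0 then 2 else 1) +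
      (n - r - 1) * (if k % 2 = 0 then 1 else 2) := by
  have h := P.two_mul_indepNum_le.trans (card_labelFinset_le n k r)
  have := P.r_lt
  split_ifs at h ⊢ <;> omega

/-- The crossings that are used when `n` is odd: the diagonals that pass the edges `0` and `1` and
those that pass the edges `2` and `3` of the top at the same position are paired. -/
noncomputable def adjacentPairs (n k r : ℤ) : Finset (ℤ × ℤ) :=
  Finset.Ioo 0 r ×ˢ Finset.Ico 0 (if k % 2 = 0 then 2 else 1) ∪
    Finset.Ioo r n ×ˢ Finset.Ico 0 (if k % 2 = 0 then 1 else 2) ∪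
    (Finset.Ico (-1) 0 ×ˢ Finset.Ico 0 2 ∪ Finset.Ico 0 1 ×ˢ Finset.Ico 0 (if r = 0 then 4 else 2) ∪
      Finset.Ico (max r 1) (r + 1) ×ˢ Finset.Ico 0 2)

def adjacentIndex (r : ℤ) (a : ℤ × ℤ) : ℤ × ℤ :=
  if a.1 = -2 then (0, (a.2 + 1) % 4) else if a.1 = 0 ∧ r = 0 then a else (a.1, a.2 / 2)

theorem card_adjacentPairs {n k r : ℤ} (hr : 0 ≤ r) (hrn : r < n) :
    ((adjacentPairs n k r).card : ℤ) = 6 + max (r - 1) 0 * (if k % 2 = 0 then 2 else 1) +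
      (n - r - 1) * (if k % 2 = 0 then 1 else 2) := by
  unfold adjacentPairs
  have h (A B : Finset (ℤ × ℤ)) (h : ∀ x q, (x, q) ∈ A → (x, q) ∈ B → False) : Disjoint A B :=
    Finset.disjoint_left.2 fun a => h a.1 a.2
  rw [Finset.card_union_of_disjoint, Finset.card_union_of_disjoint, Finset.card_union_of_disjoint,
    Finset.card_union_of_disjoint, card_Ioo_product, card_Ioo_product, card_Ico_product,
    card_Ico_product, card_Ico_product]
  · simp only [apply_ite Int.toNat, sub_zero, Int.reduceToNat, Int.reduceSub]
    split_ifs <;> omega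
  all_goals
    refine h _ _ fun x q => ?_
    simp only [Finset.mem_union, Finset.mem_product, Finset.mem_Ioo, Finset.mem_Ico]
    omega

theorem adjacentIndex_of_pos {r x q : ℤ} (hx : 0 < x) : adjacentIndex r (x, q) = (x, q / 2) := by
  simp only [adjacentIndex]
  rw [if_neg (by omega), if_neg (by omega)]

theorem PrismParams.le_indepNum_of_odd {n m : ℕ} {k r : ℤ} (P : PrismParams n m k r)
    (hodd : n % 2 = 1) :
    6 + max (r - 1) 0 * (if k % 2 = 0 then 2 else 1) + (n - r - 1) * (if k % 2 = 0 then 1 else 2) ≤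
      ((prismBishopGraph n m).indepNum : ℤ) := by
  have hn := P.n_pos
  have hm := P.m_pos
  have hr0 := P.r_nonneg
  have hrn := P.r_lt
  have he := P.eq
  rw [← card_adjacentPairs hr0 hrn, Nat.cast_le]
  refine P.card_le_indepNum _ (adjacentIndex r) ?_
  rintro ⟨x, p⟩ hi
  simp only [adjacentPairs, Finset.mem_union, Finset.mem_product, Finset.mem_Ioo,
    Finset.mem_Ico] at hi
  have hnext : 0 < x → x < n → 0 ≤ p → 2 * p < posModulus k r x →
      ∃ a b, LabelsMeet n m k r a b ∧ adjacentIndex r a = (x, p) ∧ adjacentIndex r b = (x, p) := by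
    intro hx hxn hp0 hp
    refine ⟨_, _, P.labelsMeet_next hx hx hxn hxn (by omega) (2 * p), ?_, ?_⟩ <;>
    · rw [posLabel_mul_add hx.le hxn, adjacentIndex_of_pos hx, Prod.mk.injEq]
      refine ⟨rfl, ?_⟩
      rcases posModulus_cases k r x with h | h <;> rw [h] at hp ⊢ <;> omega
  rcases hi with (⟨hx, hp⟩ | ⟨hx, hp⟩) | ((⟨hx, hp⟩ | ⟨hx, hp⟩) | ⟨hx, hp⟩)
  · refine hnext hx.1 (by omega) hp.1 ?_
    rw [posModulus_of_lt hx.1 hx.2]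
    split_ifs at hp ⊢ <;> omega
  · refine hnext (by omega) hx.2 hp.1 ?_
    rw [posModulus_of_gt hr0 hx.1]
    split_ifs at hp ⊢ <;> omega
  · obtain rfl : x = -1 := by omega
    rcases (show p = 0 ∨ p = 1 by omega) with rfl | rfl
    · exact ⟨_, _, labelsMeet_top_corner k r hodd, by simp [adjacentIndex],
        by simp [adjacentIndex]⟩
    · exact ⟨_, _, labelsMeet_bottom_corner k r (by omega) hodd, by simp [adjacentIndex],
        by simp [adjacentIndex]⟩
  · obtain rfl : x = 0 := by omega
    have hbelt : ∀ j : ℤ, (n : ℤ) < 2 * m →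
        LabelsMeet n m k r (posLabel n k r (j * n)) (downLabel n k r ((j - 1) * n)) := by
      intro j h
      have e : j * n - (j - 1) * n = (n : ℤ) := by ring
      exact labelsMeet_belt (by omega) (by omega) (by omega) (by omega)
    by_cases hr : r = 0
    · have hk : 0 < k := by
        refine lt_of_le_of_ne P.k_nonneg fun h => ?_
        rw [← h, hr] at he
        omega
      refine ⟨_, _, hbelt p (by linarith [P.le_of_k_pos hk]), ?_, ?_⟩
      · rw [if_pos hr] at hp
        rw [posLabel_mul hn, adjacentIndex, if_neg (by norm_num), if_pos ⟨rfl, hr⟩, Prod.mk.injEq]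
        exact ⟨rfl, by omega⟩
      · rw [if_pos hr] at hp
        rw [downLabel_mul hn, if_pos hr, adjacentIndex, if_pos rfl, Prod.mk.injEq]
        exact ⟨rfl, by dsimp only; omega⟩
    · rw [if_neg hr] at hp
      have hidx : ∀ q : ℤ, q % 4 / 2 = p → adjacentIndex r (0, q % 4) = (0, p) := by
        intro q hq
        rw [adjacentIndex, if_neg (by norm_num), if_neg (by tauto)]
        exact Prod.ext rfl hq
      rcases lt_or_ge (n : ℤ) (2 * m) with h | h
      · have key : ∀ j : ℤ, j % 4 / 2 = p → (j + 2 * k + 1) % 4 / 2 = p → ∃ a b,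
            LabelsMeet n m k r a b ∧ adjacentIndex r a = (0, p) ∧ adjacentIndex r b = (0, p) := by
          intro j h1 h2
          refine ⟨_, _, hbelt j h, ?_, ?_⟩
          · rw [posLabel_mul hn, hidx _ h1]
          · rw [downLabel_mul hn, if_neg hr, posLabel_mul hn, hidx]
            rwa [show j - 1 + 2 * k + 2 = j + 2 * k + 1 by ring]
        by_cases hk : k % 2 = 0
        · exact key (2 * p) (by omega) (by omega)
        · exact key (2 * p + 1) (by omega) (by omega)
      · have hk : k = 0 := by
          by_contra hk
          have := P.le_of_k_pos (lt_of_le_of_ne P.k_nonneg (Ne.symm hk))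
          omega
        rw [hk, zero_mul, zero_add] at he
        have := labelsMeet_bottom_next (n := n) (m := m) (k := k) (r := r) (x := r) (x' := r)
          (by omega) (by omega) (by omega) (by omega) (by omega) (by omega) (2 * p)
        rw [he, add_sub_cancel_left, add_sub_cancel_left] at this
        refine ⟨_, _, this, ?_, ?_⟩
        · rw [posLabel_mul hn, hidx _ (by omega)]
        · rw [posLabel_mul hn, hidx _ (by omega)]
  · obtain rfl : x = r := by omega
    exact hnext (by omega) hrn hp.1 (by rw [posModulus_self]; omega)

/-- The crossings that are used when `n` is even and `r` is odd. -/
noncomputable def mixedPairs (n k r : ℤ) : Finset (ℤ × ℤ) :=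
  Finset.Ico 0 (r / 2) ×ˢ Finset.Ico 0 (if k % 2 = 0 then 4 else 2) ∪
    Finset.Ioo (r / 2) (n / 2) ×ˢ Finset.Ico 0 (if k % 2 = 0 then 2 else 4) ∪
    Finset.Ico (-1) 0 ×ˢ Finset.Ico 0 6

def mixedIndex (k r : ℤ) (a : ℤ × ℤ) : ℤ × ℤ :=
  if a.1 = -1 then a
  else if a.1 = 0 then
    (-1, if k % 2 = 0 then (if a.2 < 2 then a.2 + 4 else 5 - a.2) else a.2 + 2)
  else if a.1 = r then (-1, if a.2 < 2 then 1 - a.2 else a.2 + 2)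
  else if a.1 < r then
    (if a.1 % 2 = 1 then (a.1 / 2, a.2)
      else (a.1 / 2 - 1, if k % 2 = 0 then (a.2 + 2) % 4 else a.2))
  else if a.1 % 2 = 0 then (a.1 / 2, a.2)
  else (a.1 / 2, if k % 2 = 0 then (a.2 + 1) % 2 else (a.2 + 2) % 4)

theorem card_mixedPairs {n k r : ℤ} (hr : 0 ≤ r) (hrn : r < n) (hn : n % 2 = 0)
    (hodd : r % 2 = 1) :
    ((mixedPairs n k r).card : ℤ) = 6 + max (r - 1) 0 * (if k % 2 = 0 then 2 else 1) +
      (n - r - 1) * (if k % 2 = 0 then 1 else 2) := by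
  unfold mixedPairs
  have h (A B : Finset (ℤ × ℤ)) (h : ∀ x q, (x, q) ∈ A → (x, q) ∈ B → False) : Disjoint A B :=
    Finset.disjoint_left.2 fun a => h a.1 a.2
  rw [Finset.card_union_of_disjoint, Finset.card_union_of_disjoint, card_Ioo_product,
    card_Ico_product, card_Ico_product]
  · simp only [apply_ite Int.toNat, sub_zero, Int.reduceToNat, Int.reduceSub]
    split_ifs <;> omega
  all_goals
    refine h _ _ fun x q => ?_
    simp only [Finset.mem_union, Finset.mem_product, Finset.mem_Ioo, Finset.mem_Ico]
    omega

theorem PrismParams.labelsMeet_bottom_diag {n m : ℕ} {k r : ℤ} (P : PrismParams n m k r)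
    (hn : n % 2 = 0) (hodd : r % 2 = 1) {c : ℤ} (h0 : 0 ≤ c) (h1 : c < 4)
    (hc : (k + 1) % 2 = c % 2) : LabelsMeet n m k r (-1, 2) (0, c) := by
  have hn' := P.n_pos
  have hm := P.m_pos
  have hr0 := P.r_nonneg
  have hrn := P.r_lt
  have he := P.eq
  rcases (show (k + 1) % 4 = c ∨ (k + 3) % 4 = c by omega) with rfl | rfl
  · refine labelsMeet_bottom (a := n - r) (b := n - r) (by omega) (by omega) (by omega)
      (by simp [bottomLabel]) ?_
    rw [bottomLabel, if_neg not_false, if_neg (by omega), if_pos (by omega), ← posLabel_mul hn']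
    congr 1
    rw [show (n - r + (n - r) : ℤ) / 2 = n - r by omega, he]
    ring
  · refine labelsMeet_bottom (a := n + r) (b := n + r) (by omega) (by omega) (by omega)
      (by simp [bottomLabel]) ?_
    rw [bottomLabel, if_neg not_false, if_neg (by omega), if_neg (by omega), ← posLabel_mul hn']
    congr 1
    rw [show (n + r + (n + r) : ℤ) / 2 = n + r by omega, he]
    ring

theorem PrismParams.labelsMeet_bottom_antidiag {n m : ℕ} {k r : ℤ} (P : PrismParams n m k r)
    (hn : n % 2 = 0) (hodd : r % 2 = 1) {c : ℤ} (h0 : 0 ≤ c) (h1 : c < 4)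
    (hc : k % 2 = c % 2) : LabelsMeet n m k r (0, c) (-1, 3) := by
  have hn' := P.n_pos
  have hm := P.m_pos
  have hr0 := P.r_nonneg
  have hrn := P.r_lt
  have he := P.eq
  rcases (show (k + 2) % 4 = c ∨ (k + 4) % 4 = c by omega) with rfl | rfl
  · refine labelsMeet_bottom (a := n + r) (b := n - r) (by omega) (by omega) (by omega) ?_
      (by rw [bottomLabel, if_neg not_false, if_pos (by ring)])
    rw [bottomLabel, if_pos trivial, if_neg (by omega), if_pos (by omega), ← posLabel_mul hn']
    congr 1
    rw [show (n + r - (n - r) : ℤ) / 2 = r by omega, he]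
    ring
  · refine labelsMeet_bottom (a := n - r) (b := n + r) (by omega) (by omega) (by omega) ?_
      (by rw [bottomLabel, if_neg not_false, if_pos (by ring)])
    rw [bottomLabel, if_pos trivial, if_neg (by omega), if_neg (by omega), ← posLabel_mul hn']
    congr 1
    rw [show (n + r - (n - r) : ℤ) / 2 = r by omega, he]
    ring

theorem PrismParams.labelsMeet_top_diag {n m : ℕ} {k r : ℤ} (P : PrismParams n m k r)
    (hn : n % 2 = 0) (hodd : r % 2 = 1) : LabelsMeet n m k r (-1, 0) (r, 1) := by
  have hr0 := P.r_nonneg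
  have hrn := P.r_lt
  refine labelsMeet_top (a := n + r) (b := n + r) (by omega) (by omega) (by simp [topLabel]) ?_
  have := posLabel_mul_add (k := k) (r := r) (q := 1) hr0 hrn
  rw [posModulus_self] at this
  rw [topLabel, if_neg not_false, if_neg (by omega), if_neg (by omega),
    show (n + r + (n + r) : ℤ) / 2 = 1 * n + r by omega, this]
  rfl

theorem PrismParams.labelsMeet_top_antidiag {n m : ℕ} {k r : ℤ} (P : PrismParams n m k r)
    (hn : n % 2 = 0) (hodd : r % 2 = 1) : LabelsMeet n m k r (r, 0) (-1, 1) := by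
  have hr0 := P.r_nonneg
  have hrn := P.r_lt
  refine labelsMeet_top (a := n + r) (b := n - r) (by omega) (by omega) ?_
    (by rw [topLabel, if_neg not_false, if_pos (by ring)])
  have := posLabel_mul_add (k := k) (r := r) (q := 0) hr0 hrn
  rw [posModulus_self] at this
  rw [topLabel, if_pos trivial, if_neg (by omega), if_pos (by omega),
    show (n + r - (n - r) : ℤ) / 2 = 0 * n + r by omega, this]
  rfl

theorem PrismParams.le_indepNum_of_mixed {n m : ℕ} {k r : ℤ} (P : PrismParams n m k r)
    (heven : n % 2 = 0) (hodd : r % 2 = 1) :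
    6 + max (r - 1) 0 * (if k % 2 = 0 then 2 else 1) + (n - r - 1) * (if k % 2 = 0 then 1 else 2) ≤
      ((prismBishopGraph n m).indepNum : ℤ) := by
  have hn := P.n_pos
  have hm := P.m_pos
  have hr0 := P.r_nonneg
  have hrn := P.r_lt
  have he := P.eq
  have hk0 := P.k_nonneg
  have hrm : r ≤ m := by nlinarith
  rw [← card_mixedPairs hr0 hrn (by omega) hodd, Nat.cast_le]
  refine P.card_le_indepNum _ (mixedIndex k r) ?_
  rintro ⟨x, p⟩ hi
  simp only [mixedPairs, Finset.mem_union, Finset.mem_product, Finset.mem_Ioo,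
    Finset.mem_Ico] at hi
  rcases hi with (⟨hx, hp⟩ | ⟨hx, hp⟩) | ⟨hx, hp⟩
  · have h := P.labelsMeet_opposite (x := 2 * x + 1) (x' := 2 * x + 2) (by omega) (by omega)
      (by omega) (by omega) (by omega) p
    rw [posLabel_mul_add (by omega) (by omega), posLabel_mul_add (by omega) (by omega),
      posModulus_of_lt (by omega) (by omega), posModulus_of_lt (by omega) (by omega)] at h
    refine ⟨_, _, h, ?_, ?_⟩
    · simp only [mixedIndex]
      rw [if_neg (by omega), if_neg (by omega), if_neg (by omega), if_pos (by omega),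
        if_pos (by omega), Prod.mk.injEq]
      exact ⟨by omega, by split_ifs at hp ⊢ <;> omega⟩
    · simp only [mixedIndex]
      rw [if_neg (by omega), if_neg (by omega), if_neg (by omega), if_pos (by omega),
        if_neg (by omega), Prod.mk.injEq]
      exact ⟨by omega, by split_ifs at hp ⊢ <;> omega⟩
  · by_cases hk : k % 2 = 0
    · have h := P.labelsMeet_next (x := 2 * x) (x' := 2 * x + 1) (by omega) (by omega)
        (by omega) (by omega) (by omega) p
      rw [posLabel_mul_add (by omega) (by omega), posLabel_mul_add (by omega) (by omega),
        posModulus_of_gt (by omega) (by omega), posModulus_of_gt (by omega) (by omega),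
        if_pos hk] at h
      rw [if_pos hk] at hp
      refine ⟨_, _, h, ?_, ?_⟩
      · simp only [mixedIndex]
        rw [if_neg (by omega), if_neg (by omega), if_neg (by omega), if_neg (by omega),
          if_pos (by omega), Prod.mk.injEq]
        exact ⟨by omega, by omega⟩
      · simp only [mixedIndex]
        rw [if_neg (by omega), if_neg (by omega), if_neg (by omega), if_neg (by omega),
          if_neg (by omega), if_pos hk, Prod.mk.injEq]
        exact ⟨by omega, by omega⟩
    · have hnm := P.le_of_k_pos (by omega)
      have h := P.labelsMeet_opposite (x := 2 * x) (x' := 2 * x + 1) (by omega) (by omega)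
        (by omega) (by omega) (by omega) p
      rw [posLabel_mul_add (by omega) (by omega), posLabel_mul_add (by omega) (by omega),
        posModulus_of_gt (by omega) (by omega), posModulus_of_gt (by omega) (by omega),
        if_neg hk] at h
      rw [if_neg hk] at hp
      refine ⟨_, _, h, ?_, ?_⟩
      · simp only [mixedIndex]
        rw [if_neg (by omega), if_neg (by omega), if_neg (by omega), if_neg (by omega),
          if_pos (by omega), Prod.mk.injEq]
        exact ⟨by omega, by omega⟩
      · simp only [mixedIndex]
        rw [if_neg (by omega), if_neg (by omega), if_neg (by omega), if_neg (by omega),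
          if_neg (by omega), if_neg hk, Prod.mk.injEq]
        exact ⟨by omega, by omega⟩
  · obtain rfl : x = -1 := by omega
    have hcorner : ∀ i, mixedIndex k r (-1, i) = (-1, i) := fun i => if_pos rfl
    have hself : ∀ q p : ℤ, (q < 2 ∧ p = 1 - q ∨ 2 ≤ q ∧ p = q + 2) →
        mixedIndex k r (r, q) = (-1, p) := by
      intro q p hq
      simp only [mixedIndex]
      rw [if_neg (by omega), if_neg (by omega), if_pos trivial, Prod.mk.injEq]
      exact ⟨rfl, by split_ifs <;> omega⟩
    have hzero : ∀ q p : ℤ, (k % 2 = 0 → q < 2 ∧ p = q + 4 ∨ 2 ≤ q ∧ p = 5 - q) →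
        (k % 2 = 1 → p = q + 2) → mixedIndex k r (0, q) = (-1, p) := by
      intro q p h1 h2
      simp only [mixedIndex]
      rw [if_neg (by omega), if_pos trivial, Prod.mk.injEq]
      exact ⟨rfl, by split_ifs <;> omega⟩
    have hdirect : ∀ j : ℤ, 2 ≤ j → j < 4 → p = j + 2 → ∃ a b,
        LabelsMeet n m k r a b ∧ mixedIndex k r a = (-1, p) ∧ mixedIndex k r b = (-1, p) := by
      intro j h2 h4 hj
      have h := labelsMeet_belt (n := n) (m := m) (k := k) (r := r) (u := j * n + r) (y := j * n)
        (by omega) (by omega) (by omega) (by omega)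
      rw [posLabel_mul_add hr0 hrn, posModulus_self, downLabel_mul hn, if_neg (by omega),
        posLabel_mul hn] at h
      exact ⟨_, _, h, hself _ _ (by omega), hzero _ _ (by omega) (by omega)⟩
    rcases (show p = 0 ∨ p = 1 ∨ p = 2 ∨ p = 3 ∨ p = 4 ∨ p = 5 by omega) with
      rfl | rfl | rfl | rfl | rfl | rfl
    · exact ⟨_, _, P.labelsMeet_top_diag heven hodd, hcorner _, hself _ _ (by omega)⟩
    · exact ⟨_, _, P.labelsMeet_top_antidiag heven hodd, hself _ _ (by omega), hcorner _⟩
    · rcases Int.emod_two_eq_zero_or_one k with hk | hk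
      · exact ⟨_, _, P.labelsMeet_bottom_diag heven hodd (c := 3) (by omega) (by omega) (by omega),
          hcorner _, hzero _ _ (by omega) (by omega)⟩
      · exact ⟨_, _, P.labelsMeet_bottom_diag heven hodd (c := 0) (by omega) (by omega) (by omega),
          hcorner _, hzero _ _ (by omega) (by omega)⟩
    · rcases Int.emod_two_eq_zero_or_one k with hk | hk
      · exact ⟨_, _, P.labelsMeet_bottom_antidiag heven hodd (c := 2) (by omega) (by omega)
          (by omega), hzero _ _ (by omega) (by omega), hcorner _⟩
      · exact ⟨_, _, P.labelsMeet_bottom_antidiag heven hodd (c := 1) (by omega) (by omega)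
          (by omega), hzero _ _ (by omega) (by omega), hcorner _⟩
    · exact hdirect 2 (by omega) (by omega) (by omega)
    · exact hdirect 3 (by omega) (by omega) (by omega)

/-- The crossings that are used when `n` and `r` are even. -/
noncomputable def evenPairs (n k r : ℤ) : Finset (ℤ × ℤ) :=
  Finset.Ico 0 (r / 2) ×ˢ Finset.Ico 0 (if k % 2 = 0 then 4 else 2) ∪
    Finset.Ico (r / 2) (n / 2 : ℤ) ×ˢ Finset.Ico 0 (if k % 2 = 0 then 2 else 4)

def evenIndex (k r : ℤ) (a : ℤ × ℤ) : ℤ × ℤ :=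
  if a.1 % 2 = 1 then (a.1 / 2, a.2)
  else if a.1 = -2 then (0, a.2)
  else if a.1 = 0 then (0, (a.2 + 2 * k + 2) % 4)
  else if a.1 < r then (a.1 / 2, if k % 2 = 0 then (a.2 + 2) % 4 else a.2)
  else if k % 2 = 1 then (a.1 / 2, (a.2 + 2) % 4)
  else if a.1 = r then (a.1 / 2, (a.2 + 3) % 4)
  else (a.1 / 2, (a.2 + 1) % 2)

theorem card_evenPairs {n k r : ℤ} (hr : 0 ≤ r) (hrn : r < n) (hn : n % 2 = 0)
    (heven : r % 2 = 0) :
    ((evenPairs n k r).card : ℤ) = if k % 2 = 0 then n + r else 2 * n - r := by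
  unfold evenPairs
  rw [Finset.card_union_of_disjoint, card_Ico_product, card_Ico_product]
  · simp only [apply_ite Int.toNat, sub_zero, Int.reduceToNat]
    split_ifs <;> omega
  · refine Finset.disjoint_left.2 fun a => ?_
    simp only [Finset.mem_product, Finset.mem_Ico]
    omega

theorem PrismParams.le_indepNum_of_even {n m : ℕ} {k r : ℤ} (P : PrismParams n m k r)
    (hne : n % 2 = 0) (hre : r % 2 = 0) :
    (evenPairs n k r).card ≤ (prismBishopGraph n m).indepNum := by
  have hn := P.n_pos
  have hm := P.m_pos
  have hr0 := P.r_nonneg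
  have hrn := P.r_lt
  have he := P.eq
  have hk0 := P.k_nonneg
  have hrm : r ≤ m := by nlinarith
  refine P.card_le_indepNum _ (evenIndex k r) ?_
  rintro ⟨x, p⟩ hi
  have hx0 : 0 ≤ x ∧ 2 * x + 1 < n := by
    simp only [evenPairs, Finset.mem_union, Finset.mem_product, Finset.mem_Ico] at hi
    omega
  have hp0 : 0 ≤ p ∧ p < posModulus k r (2 * x + 1) ∧ p < 4 := by
    simp only [evenPairs, Finset.mem_union, Finset.mem_product, Finset.mem_Ico] at hi
    rcases hi with ⟨h, h'⟩ | ⟨h, h'⟩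
    · rw [posModulus_of_lt (by omega) (by omega)]
      split_ifs at h' ⊢ <;> omega
    · rw [posModulus_of_gt hr0 (by omega)]
      split_ifs at h' ⊢ <;> omega
  have hself : evenIndex k r (posLabel n k r (p * n + (2 * x + 1))) = (x, p) := by
    rw [posLabel_mul_add (by omega) hx0.2, Int.emod_eq_of_lt hp0.1 hp0.2.1]
    simp only [evenIndex]
    rw [if_pos (by omega), Prod.mk.injEq]
    exact ⟨by omega, rfl⟩
  by_cases hx : x = 0
  · subst hx
    have h := labelsMeet_belt (n := n) (m := m) (k := k) (r := r) (u := p * n + (2 * 0 + 1))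
      (y := p * n) (by omega) (by omega) (by omega) (by omega)
    refine ⟨_, _, h, hself, ?_⟩
    rw [downLabel_mul hn]
    split_ifs with hr
    · simp [evenIndex]
      omega
    · rw [posLabel_mul hn]
      simp [evenIndex]
      omega
  by_cases hcase : 2 * x + 1 < r ∨ k % 2 = 1
  · have hlt : 2 * x + 1 ≤ m := by
      rcases hcase with h | h
      · omega
      · have := P.le_of_k_pos (by omega)
        omega
    have h := P.labelsMeet_opposite (x := 2 * x + 1) (x' := 2 * x) (by omega) (by omega)
      (by omega) (by omega) (by omega) p
    refine ⟨_, _, h, hself, ?_⟩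
    rw [posLabel_mul_add (by omega) (by omega)]
    simp only [evenIndex]
    rw [if_neg (by omega), if_neg (by omega), if_neg (by omega)]
    obtain ⟨hp0, hp1, hp4⟩ := hp0
    by_cases hxr : 2 * x < r
    · rw [posModulus_of_lt (by omega) (by omega)] at hp1
      rw [if_pos hxr, posModulus_of_lt (by omega) (by omega), Prod.mk.injEq]
      exact ⟨by omega, by split_ifs at hp1 ⊢ <;> omega⟩
    · have hk : k % 2 = 1 := by omega
      rw [posModulus_of_gt (by omega) (by omega), if_neg (by omega)] at hp1
      rw [if_neg hxr, if_pos hk, Prod.mk.injEq]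
      refine ⟨by omega, ?_⟩
      rcases (show r < 2 * x ∨ 2 * x = r by omega) with h | h
      · rw [posModulus_of_gt hr0 h, if_neg (by omega)]
        omega
      · rw [h, posModulus_self]
        omega
  · have h := P.labelsMeet_next (x := 2 * x + 1) (x' := 2 * x) (by omega) (by omega)
      (by omega) (by omega) (by omega) p
    refine ⟨_, _, h, hself, ?_⟩
    rw [posLabel_mul_add (by omega) (by omega)]
    simp only [evenIndex]
    rw [if_neg (by omega), if_neg (by omega), if_neg (by omega), if_neg (by omega),
      if_neg (by omega)]
    obtain ⟨hp0, hp1, hp4⟩ := hp0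
    rw [posModulus_of_gt (by omega) (by omega), if_pos (by omega)] at hp1
    rcases (show r < 2 * x ∨ 2 * x = r by omega) with h | h
    · have hk : k % 2 = 0 := by omega
      rw [posModulus_of_gt hr0 h, if_pos hk, if_neg (show ¬ 2 * x = r by omega), Prod.mk.injEq]
      exact ⟨by omega, by omega⟩
    · rw [h, posModulus_self, if_pos rfl, Prod.mk.injEq]
      exact ⟨by omega, by omega⟩

theorem PrismParams.indepNum_eq_of_even {n m : ℕ} {k r : ℤ} (P : PrismParams n m k r)
    (hne : n % 2 = 0) (hre : r % 2 = 0) :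
    ((prismBishopGraph n m).indepNum : ℤ) = if k % 2 = 0 then n + r else 2 * n - r := by
  have hm : m % 2 = 0 := by
    have : (m : ℤ) % 2 = 0 := by
      rw [P.eq, Int.add_emod, Int.mul_emod, show (n : ℤ) % 2 = 0 by omega, hre]
      simp
    omega
  rw [← card_evenPairs P.r_nonneg P.r_lt (by omega) hre, Nat.cast_inj]
  exact le_antisymm (P.indepNum_le_of_even hne hm hre) (P.le_indepNum_of_even hne hre)

theorem PrismParams.indepNum_eq {n m : ℕ} {k r : ℤ} (P : PrismParams n m k r)
    (h : n % 2 = 1 ∨ r % 2 = 1) : ((prismBishopGraph n m).indepNum : ℤ) =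
      6 + max (r - 1) 0 * (if k % 2 = 0 then 2 else 1) +
        (n - r - 1) * (if k % 2 = 0 then 1 else 2) := by
  refine le_antisymm P.indepNum_le ?_
  rcases Nat.mod_two_eq_zero_or_one n with hn | hn
  · exact P.le_indepNum_of_mixed hn (by omega)
  · exact P.le_indepNum_of_odd hn

theorem mainTheorem1 (n m : ℕ) (k r : ℤ) (hm : 0 < m)
    (hmk : (m : ℤ) = k * n + r) (hr0 : 0 ≤ r) (hrn : r < n) :
    (Odd k ∧ Odd n ∧ r = 0 →
      ((prismBishopGraph n m).indepNum : ℤ) = 2 * n + 4) ∧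
    ((Odd k ∧ Odd n ∧ 0 < r) ∨ (Odd k ∧ Odd r) →
      ((prismBishopGraph n m).indepNum : ℤ) = 2 * n + 3 - r) ∧
    (Odd k ∧ Even n ∧ Even r →
      ((prismBishopGraph n m).indepNum : ℤ) = 2 * n - r) ∧
    (Even k ∧ Odd n ∧ r = 0 →
      ((prismBishopGraph n m).indepNum : ℤ) = n + 5) ∧
    ((Even k ∧ Odd n ∧ 0 < r) ∨ (Even k ∧ Odd r) →
      ((prismBishopGraph n m).indepNum : ℤ) = n + 3 + r) ∧
    (Even k ∧ Even n ∧ Even r →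
      ((prismBishopGraph n m).indepNum : ℤ) = n + r) := by
  have P : PrismParams n m k r := ⟨by omega, by omega, hmk, hr0, hrn⟩
  have h1 : n % 2 = 1 ∨ r % 2 = 1 → k % 2 = 0 → ((prismBishopGraph n m).indepNum : ℤ) =
      6 + max (r - 1) 0 * 2 + (n - r - 1) := by
    intro h hk
    rw [P.indepNum_eq h, if_pos hk, if_pos hk, mul_one]
  have h2 : n % 2 = 1 ∨ r % 2 = 1 → k % 2 = 1 → ((prismBishopGraph n m).indepNum : ℤ) =
      6 + max (r - 1) 0 + (n - r - 1) * 2 := by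
    intro h hk
    rw [P.indepNum_eq h, if_neg (by omega), if_neg (by omega), mul_one]
  have h3 : n % 2 = 0 → r % 2 = 0 → ((prismBishopGraph n m).indepNum : ℤ) =
      if k % 2 = 0 then n + r else 2 * n - r := P.indepNum_eq_of_even
  simp only [Nat.odd_iff, Nat.even_iff, Int.odd_iff, Int.even_iff]
  refine ⟨?_, ?_, ?_, ?_, ?_, ?_⟩
  · rintro ⟨hk, hn, hr⟩
    rw [h2 (Or.inl hn) hk]
    omega
  · intro h
    rw [h2 (by omega) (by omega)]
    omega
  · rintro ⟨hk, hn, hr⟩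
    rw [h3 hn hr, if_neg (by omega)]
  · rintro ⟨hk, hn, hr⟩
    rw [h1 (Or.inl hn) hk]
    omega
  · intro h
    rw [h1 (by omega) (by omega)]
    omega
  · rintro ⟨hk, hn, hr⟩
    rw [h3 hn hr, if_pos hk]
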